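/- **Theorem 1.1.** Let $N\ge 1$, let $\Omega\subset\mathbb R^N$ be a domain and $1<p<\infty$. Let $A\in L^\infty_{\rm loc}(\Omega;\mathbb R^{N\times N})$ be symmetric and locally uniformly positive definite, put $|\xi|_A^2=\langle A\xi,\xi\rangle$, and let $V$ belong to the local Morrey space $\mathcal M^q_{\rm loc}(p;\Omega)\subset L^1_{\rm loc}(\Omega)$ defined as follows, with "for all open $\omega\Subset\Omega$" understood in the last two cases: if $p>N$, this is $L^1_{\rm loc}(\Omega)$; if $p<N$, then $\sup_{y\in\omega,\,0<r<\operatorname{diam}\omega} r^{-N/q'}\int_{\omega\cap B_r(y)}|V|\,dx<\infty$ for some $q>N/p$ not depending on $\omega$; if $p=N$, then $\sup_{y\in\omega,\,0<r<\operatorname{diam}\omega}\bigl[\log\frac{\operatorname{diam}\omega}{r}\bigr]^{q/N'}\int_{\omega\cap B_r(y)}|V|\,dx<\infty$ for some $q>N$ not depending on $\omega$. (Here $q'=q/(q-1)$ and $N'=N/(N-1)$.) Assume that $$Q_{p,A,V}(\phi)=\int_\Omega\bigl(|\nabla\phi|_A^p+V|\phi|^p\bigr)dx\ge 0\qquad\text{for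 all }\phi\in W^{1,p}(\Omega)\cap C_c(\Omega),$$ and let $u\in W^{1,p}_{\rm loc}(\Omega)\cap C(\Omega)$ be a positive weak solution of $-\operatorname{div}(|\nabla u|_A^{p-2}A\nabla u)+V|u|^{p-2}u=0$ in $\Omega$. For compact $F\subset\Omega$ let $\operatorname{Cap}_u(F,\Omega)=\inf\{Q_{p,A,V}(\phi):\phi\in W^{1,p}(\Omega)\cap C_c(\Omega),\ \phi\ge u\text{ on }F\}$, and for $g\in L^1_{\rm loc}(\Omega)$ let $$\|g\|_{\mathcal H_p(\Omega,V)}=\sup_{F\subset\Omega\text{ compact}}\frac{\int_F|g|u^p\,dx}{\operatorname{Cap}_u(F,\Omega)}\in[0,\infty],$$ where $0/0=0$ and $a/0=\infty$ for $a>0$. Consider the Hardy-type inequality $$\int_\Omega|g||\phi|^p\,dx\le C\,Q_{p,A,V}(\phi)\qquad\text{for all }\phi\in W^{1,p}(\Omega)\cap C_c(\Omega),\tag{H}$$ let $\mathcal B_g(\Omega,V)\in[0,\infty]$ be the infimum of all $C>0$ for which (H) holds, and let $\mathcal H_p(\Omega,V)$ be the set of all $g\in L^1_{\rm loc}(\Omega)$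 for which (H) holds with some $C>0$. Then: 1. For $g\in L^1_{\rm loc}(\Omega)$, $\|g\|_{\mathcal H_p(\Omega,V)}<\infty$ if and only if (H) holds for some $C>0$. 2. There is a constant $C_H\in(0,\infty)$, independent of $g$, such that for all $g\in L^1_{\rm loc}(\Omega)$ $$\|g\|_{\mathcal H_p(\Omega,V)}\le\mathcal B_g(\Omega,V)\le C_H\|g\|_{\mathcal H_p(\Omega,V)}.$$ 3. $\mathcal H_p(\Omega,V)$ (modulo equality almost everywhere) is a vector space, on which $g\mapsto\|g\|_{\mathcal H_p(\Omega,V)}$ and $g\mapsto\mathcal B_g(\Omega,V)$ are equivalent norms. 4. Up to equivalence of norms, $\|\cdot\|_{\mathcal H_p(\Omega,V)}$ does not depend on the positive solution $u$. 5. If $Q_{p,A,V}$ is subcritical in $\Omega$, that is, $\mathcal H_p(\Omega,V)\ne\{0\}$, then for all $g\in L^1_{\rm loc}(\Omega)$ the supremum defining $\|g\|_{\mathcal H_p(\Omega,V)}$ may be restricted to the compact sets $F$ with $\operatorname{Cap}_u(F,\Omega)\ne 0$. -/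

import Mathlib

open MeasureTheory Set
open scoped ENNReal

noncomputable section

namespace HardyWeights

variable {N : ℕ}

/-! ### Weak gradients and Sobolev spaces -/

/-- `η ∈ C_c^∞(Ω)`. -/
def IsTestFunction (Ω : Set (EuclideanSpace ℝ (Fin N))) (η : EuclideanSpace ℝ (Fin N) → ℝ) : Prop :=
  ContDiff ℝ (⊤ : ℕ∞) η ∧ HasCompactSupport η ∧ tsupport η ⊆ Ω

/-- `G` is a weak gradient of `f` in the open set `Ω`. -/
def HasWeakGradient (Ω : Set (EuclideanSpace ℝ (Fin N))) (f : EuclideanSpace ℝ (Fin N) → ℝ)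
    (G : EuclideanSpace ℝ (Fin N) → EuclideanSpace ℝ (Fin N)) : Prop :=
  LocallyIntegrableOn f Ω ∧ LocallyIntegrableOn G Ω ∧
    ∀ η : EuclideanSpace ℝ (Fin N) → ℝ, IsTestFunction Ω η → ∀ v : EuclideanSpace ℝ (Fin N),
      ∫ x in Ω, f x * fderiv ℝ η x v = -∫ x in Ω, inner ℝ (G x) v * η x

open Classical in
/-- The weak gradient of `f` in `Ω` (unique up to a null set), when `f` has one. -/
def weakGradient (Ω : Set (EuclideanSpace ℝ (Fin N))) (f : EuclideanSpace ℝ (Fin N) → ℝ) :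
    EuclideanSpace ℝ (Fin N) → EuclideanSpace ℝ (Fin N) :=
  if h : ∃ G, HasWeakGradient Ω f G then h.choose else 0

/-- `f ∈ W^{1,p}(Ω)`. -/
def MemW1 (p : ℝ) (Ω : Set (EuclideanSpace ℝ (Fin N))) (f : EuclideanSpace ℝ (Fin N) → ℝ) : Prop :=
  MemLp f (ENNReal.ofReal p) (volume.restrict Ω) ∧
    ∃ G, HasWeakGradient Ω f G ∧ MemLp G (ENNReal.ofReal p) (volume.restrict Ω)

/-- `f ∈ W^{1,p}_loc(Ω)`. -/
def MemW1Loc (p : ℝ) (Ω : Set (EuclideanSpace ℝ (Fin N))) (f : EuclideanSpace ℝ (Fin N) → ℝ) :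
    Prop :=
  (∀ K, IsCompact K → K ⊆ Ω → MemLp f (ENNReal.ofReal p) (volume.restrict K)) ∧
    ∃ G, HasWeakGradient Ω f G ∧
      ∀ K, IsCompact K → K ⊆ Ω → MemLp G (ENNReal.ofReal p) (volume.restrict K)

/-- The space `W^{1,p}(Ω) ∩ C_c(Ω)`; its elements are extended by zero outside `Ω`. -/
def testSpace (p : ℝ) (Ω : Set (EuclideanSpace ℝ (Fin N))) :
    Set (EuclideanSpace ℝ (Fin N) → ℝ) :=
  {φ | MemW1 p Ω φ ∧ Continuous φ ∧ HasCompactSupport φ ∧ tsupport φ ⊆ Ω}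

/-! ### The coefficients -/

/-- The bilinear form `⟨M ξ, ζ⟩`. -/
def matForm (M : Matrix (Fin N) (Fin N) ℝ) (ξ ζ : EuclideanSpace ℝ (Fin N)) : ℝ :=
  ∑ i, ∑ j, M i j * ξ j * ζ i

/-- `|ξ|_M = ⟨M ξ, ξ⟩^{1/2}`. -/
def matNorm (M : Matrix (Fin N) (Fin N) ℝ) (ξ : EuclideanSpace ℝ (Fin N)) : ℝ :=
  √(matForm M ξ ξ)

/-- `A ∈ L^∞_loc(Ω; ℝ^{N×N})` is symmetric and locally uniformly positive definite. -/
structure IsEllipticMatrix (Ω : Set (EuclideanSpace ℝ (Fin N)))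
    (A : EuclideanSpace ℝ (Fin N) → Matrix (Fin N) (Fin N) ℝ) : Prop where
  meas : ∀ i j, AEStronglyMeasurable (fun x => A x i j) (volume.restrict Ω)
  bdd : ∀ K, IsCompact K → K ⊆ Ω →
    ∃ M : ℝ, ∀ᵐ x ∂(volume.restrict K), ∀ i j, |A x i j| ≤ M
  symm : ∀ᵐ x ∂(volume.restrict Ω), (A x).IsSymm
  elliptic : ∀ K, IsCompact K → K ⊆ Ω →
    ∃ θ : ℝ, 0 < θ ∧ ∀ᵐ x ∂(volume.restrict K), ∀ ξ, θ * ‖ξ‖ ^ 2 ≤ matForm (A x) ξ ξ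

/-- The local Morrey-type condition with weight `m`: for every open `U ⋐ Ω`,
the supremum of `m (diam U) r * ∫_{U ∩ B_r(y)} |V|` over `y ∈ U` and `0 < r < diam U` is finite. -/
def MorreyBound (m : ℝ → ℝ → ℝ) (Ω : Set (EuclideanSpace ℝ (Fin N)))
    (V : EuclideanSpace ℝ (Fin N) → ℝ) : Prop :=
  ∀ U : Set (EuclideanSpace ℝ (Fin N)), IsOpen U → IsCompact (closure U) → closure U ⊆ Ω →
    ∃ M : ℝ, ∀ y ∈ U, ∀ r : ℝ, 0 < r → r < Metric.diam U →
      m (Metric.diam U) r * ∫ x in U ∩ Metric.ball y r, |V x| ≤ M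

/-- The local Morrey space `M^q_loc(p; Ω)`, where `1 / q' = 1 - 1 / q`: `L^1_loc(Ω)` if `p > N`;
weight `r^{-N/q'}` for some `q > N / p` if `p < N` (finite `q` suffice, since the local Morrey
space for `q = ∞` is contained in those for finite `q`); weight `log(diam U / r)^{q/N'}` for some
`q > N` if `p = N`. Membership in `L^1_loc(Ω)` is automatic in the last two cases. -/
def MemMorreyLoc (p : ℝ) (Ω : Set (EuclideanSpace ℝ (Fin N)))
    (V : EuclideanSpace ℝ (Fin N) → ℝ) : Prop :=
  LocallyIntegrableOn V Ω ∧
    (p < N → ∃ q : ℝ, N / p < q ∧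
      MorreyBound (fun _ r => r ^ (-(N * (1 - 1 / q)) : ℝ)) Ω V) ∧
    (p = N → ∃ q : ℝ, N < q ∧
      MorreyBound (fun d r => Real.log (d / r) ^ (q * (1 - 1 / N) : ℝ)) Ω V)

/-! ### The energy functional, solutions, capacity -/

/-- `Q_{p,A,V}(φ) = ∫_Ω (|∇φ|_A^p + V |φ|^p) dx`. -/
def energy (p : ℝ) (Ω : Set (EuclideanSpace ℝ (Fin N)))
    (A : EuclideanSpace ℝ (Fin N) → Matrix (Fin N) (Fin N) ℝ) (V : EuclideanSpace ℝ (Fin N) → ℝ)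
    (φ : EuclideanSpace ℝ (Fin N) → ℝ) : ℝ :=
  ∫ x in Ω, (matNorm (A x) (weakGradient Ω φ x) ^ p + V x * |φ x| ^ p)

/-- `u ∈ W^{1,p}_loc(Ω) ∩ C(Ω)` is a positive weak solution of
`-div(|∇u|_A^{p-2} A ∇u) + V |u|^{p-2} u = 0` in `Ω`. -/
structure IsPositiveSolution (p : ℝ) (Ω : Set (EuclideanSpace ℝ (Fin N)))
    (A : EuclideanSpace ℝ (Fin N) → Matrix (Fin N) (Fin N) ℝ) (V : EuclideanSpace ℝ (Fin N) → ℝ)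
    (u : EuclideanSpace ℝ (Fin N) → ℝ) : Prop where
  memW1Loc : MemW1Loc p Ω u
  continuousOn : ContinuousOn u Ω
  pos : ∀ x ∈ Ω, 0 < u x
  weak : ∀ η, IsTestFunction Ω η →
    ∫ x in Ω, (matNorm (A x) (weakGradient Ω u x) ^ (p - 2) *
        matForm (A x) (weakGradient Ω u x) (gradient η x) + V x * |u x| ^ (p - 2) * u x * η x) = 0

/-- The `Q_{p,A,V}`-capacity `Cap_u(F, Ω)` of a compact set `F ⊆ Ω`: the infimum of `Q_{p,A,V}(φ)`
over the `φ ∈ W^{1,p}(Ω) ∩ C_c(Ω)` with `φ ≥ u` on `F`. -/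
def capacity (p : ℝ) (Ω : Set (EuclideanSpace ℝ (Fin N)))
    (A : EuclideanSpace ℝ (Fin N) → Matrix (Fin N) (Fin N) ℝ) (V : EuclideanSpace ℝ (Fin N) → ℝ)
    (u : EuclideanSpace ℝ (Fin N) → ℝ) (F : Set (EuclideanSpace ℝ (Fin N))) : ℝ :=
  sInf (energy p Ω A V '' {φ | φ ∈ testSpace p Ω ∧ ∀ x ∈ F, u x ≤ φ x})

/-! ### Hardy weights and the two norms -/

/-- The Hardy-type inequality for the weight `|g|` with constant `C`. -/
def HardyInequality (p : ℝ) (Ω : Set (EuclideanSpace ℝ (Fin N)))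
    (A : EuclideanSpace ℝ (Fin N) → Matrix (Fin N) (Fin N) ℝ) (V : EuclideanSpace ℝ (Fin N) → ℝ)
    (g : EuclideanSpace ℝ (Fin N) → ℝ) (C : ℝ) : Prop :=
  ∀ φ ∈ testSpace p Ω, ∫ x in Ω, |g x| * |φ x| ^ p ≤ C * energy p Ω A V φ

/-- The space of Hardy weights. -/
def hardySpace (p : ℝ) (Ω : Set (EuclideanSpace ℝ (Fin N)))
    (A : EuclideanSpace ℝ (Fin N) → Matrix (Fin N) (Fin N) ℝ) (V : EuclideanSpace ℝ (Fin N) → ℝ) :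
    Set (EuclideanSpace ℝ (Fin N) → ℝ) :=
  {g | LocallyIntegrableOn g Ω ∧ ∃ C : ℝ, 0 < C ∧ HardyInequality p Ω A V g C}

/-- `Q_{p,A,V}` is subcritical in `Ω`: there is a nonzero Hardy weight. -/
def IsSubcritical (p : ℝ) (Ω : Set (EuclideanSpace ℝ (Fin N)))
    (A : EuclideanSpace ℝ (Fin N) → Matrix (Fin N) (Fin N) ℝ) (V : EuclideanSpace ℝ (Fin N) → ℝ) :
    Prop :=
  ∃ g ∈ hardySpace p Ω A V, ¬ g =ᵐ[volume.restrict Ω] 0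

/-- The best constant in the Hardy-type inequality (`∞` if there is none). -/
def bestConstant (p : ℝ) (Ω : Set (EuclideanSpace ℝ (Fin N)))
    (A : EuclideanSpace ℝ (Fin N) → Matrix (Fin N) (Fin N) ℝ) (V : EuclideanSpace ℝ (Fin N) → ℝ)
    (g : EuclideanSpace ℝ (Fin N) → ℝ) : ℝ≥0∞ :=
  ⨅ (C : ℝ) (_ : 0 < C ∧ HardyInequality p Ω A V g C), ENNReal.ofReal C

/-- The quotient `∫_F |g| |u|^p dx / Cap_u(F, Ω)` in `[0, ∞]`; division in `[0, ∞]` satisfies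
`0 / 0 = 0` and `a / 0 = ∞` for `a > 0`. -/
def capacityQuotient (p : ℝ) (Ω : Set (EuclideanSpace ℝ (Fin N)))
    (A : EuclideanSpace ℝ (Fin N) → Matrix (Fin N) (Fin N) ℝ) (V : EuclideanSpace ℝ (Fin N) → ℝ)
    (u g : EuclideanSpace ℝ (Fin N) → ℝ) (F : Set (EuclideanSpace ℝ (Fin N))) : ℝ≥0∞ :=
  ENNReal.ofReal (∫ x in F, |g x| * |u x| ^ p) / ENNReal.ofReal (capacity p Ω A V u F)

/-- The norm `‖g‖_{H_p(Ω,V)}` built from the positive solution `u`, as the supremum of the capacity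
quotients over all compact `F ⊆ Ω`, that is, the least `C` in `[0, ∞]` with
`∫_F |g| |u|^p dx ≤ C Cap_u(F, Ω)` for all these `F`. -/
def hardyNorm (p : ℝ) (Ω : Set (EuclideanSpace ℝ (Fin N)))
    (A : EuclideanSpace ℝ (Fin N) → Matrix (Fin N) (Fin N) ℝ) (V : EuclideanSpace ℝ (Fin N) → ℝ)
    (u g : EuclideanSpace ℝ (Fin N) → ℝ) : ℝ≥0∞ :=
  ⨆ (F : Set (EuclideanSpace ℝ (Fin N))) (_ : IsCompact F ∧ F ⊆ Ω),
    capacityQuotient p Ω A V u g F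

/-- The supremum of the capacity quotients over the compact `F ⊆ Ω` with `Cap_u(F, Ω) ≠ 0`. -/
def hardyNormPosCap (p : ℝ) (Ω : Set (EuclideanSpace ℝ (Fin N)))
    (A : EuclideanSpace ℝ (Fin N) → Matrix (Fin N) (Fin N) ℝ) (V : EuclideanSpace ℝ (Fin N) → ℝ)
    (u g : EuclideanSpace ℝ (Fin N) → ℝ) : ℝ≥0∞ :=
  ⨆ (F : Set (EuclideanSpace ℝ (Fin N)))
    (_ : IsCompact F ∧ F ⊆ Ω ∧ capacity p Ω A V u F ≠ 0), capacityQuotient p Ω A V u g F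

/-- `S`, taken modulo equality a.e. in `Ω`, is a real vector space of functions on `Ω`, and `ν` is a
(finite) norm on it. -/
structure IsNormOn (Ω : Set (EuclideanSpace ℝ (Fin N)))
    (S : Set (EuclideanSpace ℝ (Fin N) → ℝ)) (ν : (EuclideanSpace ℝ (Fin N) → ℝ) → ℝ≥0∞) :
    Prop where
  zero_mem : 0 ∈ S
  add_mem : ∀ g ∈ S, ∀ h ∈ S, g + h ∈ S
  smul_mem : ∀ c : ℝ, ∀ g ∈ S, c • g ∈ S
  congr_mem : ∀ g ∈ S, ∀ h, g =ᵐ[volume.restrict Ω] h → h ∈ S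
  congr : ∀ g ∈ S, ∀ h, g =ᵐ[volume.restrict Ω] h → ν g = ν h
  lt_top : ∀ g ∈ S, ν g < ∞
  eq_zero_iff : ∀ g ∈ S, ν g = 0 ↔ g =ᵐ[volume.restrict Ω] 0
  smul : ∀ c : ℝ, ∀ g ∈ S, ν (c • g) = ENNReal.ofReal |c| * ν g
  add_le : ∀ g ∈ S, ∀ h ∈ S, ν (g + h) ≤ ν g + ν h

/-- Two norms on `S` are equivalent. -/
def EquivalentOn (S : Set (EuclideanSpace ℝ (Fin N) → ℝ))
    (ν₁ ν₂ : (EuclideanSpace ℝ (Fin N) → ℝ) → ℝ≥0∞) : Prop :=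
  ∃ c C : ℝ, 0 < c ∧ 0 < C ∧
    ∀ g ∈ S, ENNReal.ofReal c * ν₁ g ≤ ν₂ g ∧ ν₂ g ≤ ENNReal.ofReal C * ν₁ g

end HardyWeights

end

open HardyWeights

/-!
Everything rests on Picone's identity (`IsPositiveSolution.energy_eq_integral_bregman`): testing the
equation for the positive solution `u` with `|φ|^p / u^{p-1}` turns the energy of a test function
`φ` into the integral of the nonnegative density
`|∇φ|^p - |ψ ∇u|^p - p |ψ ∇u|^{p-2} ⟨A ψ ∇u, ∇φ - ψ ∇u⟩`, where `ψ = φ / u`, that is, of the Bregman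
divergence of `|·|_A^p` between `∇φ` and `ψ ∇u`. The sign of the potential no longer matters, and
the local integrability of `V` is the only part of the Morrey condition that is needed.

A Hardy-type inequality bounds the capacitary norm by its constant directly. For the converse, `φ`
is cut into dyadic layers `2^k u ≤ |φ|`, as in Maz'ya's proof of capacitary inequalities. The
function `u f(2^{-k} φ / u)`, with `f(t) = t² (2 - t²)` on `[-1, 1]` and `f = 1` elsewhere, is
admissible for the capacity of the `k`-th layer. By a doubling property of the Bregman divergence
(`exists_bregman_doubling`), its energy is at most a constant times the integral of
`2^{-kp} |ψ/2^k|^p` times the density of `φ` over `|ψ| < 2^k`; the quadratic vanishing of `f` at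
zero keeps the ratio `t f'(t) / f(t)` in `[0, 2]`, which is the range in which doubling is used. After
multiplication by `2^{kp}`, these bounds form a geometric series at each point, and their sum is a
multiple of the energy of `φ` (`IsPositiveSolution.exists_lintegral_le_hardyNorm_mul_energy`). The
norm axioms and the independence of `u` follow by comparison with the best constant, which does not
involve `u`.

In the subcritical case a compact set `F` of zero capacity is a null set. Otherwise there are test
functions `w_n` with energies tending to zero such that `θ_n = w_n / u` takes values in `[0, 1]` and
equals `1` on `F`. The Bregman divergence controls the gradients of `θ_n`, which tend to zero in
`L^1_loc`; by a Poincaré inequality on balls and the connectedness of `Ω`, the `θ_n` tend to `1` in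
`L^1_loc`, and then the Hardy-type inequality forces every Hardy weight to vanish
(`IsPositiveSolution.ae_eq_zero_of_capacity_eq_zero`).
-/

open HardyWeights

namespace HardyWeights

/-! ### One-dimensional inequalities for `r ^ p` -/

/-- The Bregman divergence of `t ↦ t ^ p` at `r` based at `1` is nonnegative. -/
lemma young_gap_nonneg {p : ℝ} (hp : 1 < p) {r : ℝ} (hr : 0 ≤ r) :
    0 ≤ r ^ p + (p - 1) - p * r := by
  have := one_add_mul_self_le_rpow_one_add (s := r - 1) (by linarith) hp.le
  rw [show 1 + (r - 1) = r by ring] at this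
  linarith

lemma young_gap_pos {p : ℝ} (hp : 1 < p) {r : ℝ} (hr : 0 ≤ r) (h1 : r ≠ 1) :
    0 < r ^ p + (p - 1) - p * r := by
  have := one_add_mul_self_lt_rpow_one_add (s := r - 1) (by linarith) (sub_ne_zero.2 h1) hp
  rw [show 1 + (r - 1) = r by ring] at this
  linarith

/-- Comparison of the derivatives in `r` of the two sides of `exists_young_gap_swap_le`, to the right
of `1`. -/
lemma rpow_slope_le_of_one_le {p : ℝ} (hp : 1 < p) {r : ℝ} (hr : 1 ≤ r) :
    (p - 1) * (r ^ (p - 1) - r ^ (p - 2)) ≤ max (p - 1) 2 * (r ^ (p - 1) - 1) := by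
  have h0 : 0 < r := by linarith
  have h1 : 1 ≤ r ^ (p - 1) := Real.one_le_rpow hr (by linarith)
  have hm1 := le_max_left (p - 1) 2
  have hm2 := le_max_right (p - 1) 2
  rcases le_or_gt 2 p with h2 | h2
  · have : 1 ≤ r ^ (p - 2) := Real.one_le_rpow hr (by linarith)
    nlinarith
  · have hb := rpow_one_add_le_one_add_mul_self (s := r⁻¹ - 1) (by have := inv_pos.2 h0; linarith)
      (p := p - 1) (by linarith) (by linarith)
    rw [show 1 + (r⁻¹ - 1) = r⁻¹ by ring, Real.inv_rpow h0.le] at hb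
    have e : r ^ (p - 2) = r ^ (p - 1) * r⁻¹ := by
      rw [show p - 2 = (p - 1) - 1 by ring, Real.rpow_sub_one h0.ne']; rfl
    have h3 : 1 ≤ r ^ (p - 1) * (1 + (p - 1) * (r⁻¹ - 1)) := by
      have := mul_le_mul_of_nonneg_left hb (by linarith : 0 ≤ r ^ (p - 1))
      rwa [mul_inv_cancel₀ (by linarith)] at this
    rw [e]
    nlinarith

/-- Comparison of the derivatives in `r` of the two sides of `exists_young_gap_swap_le`, to the left
of `1`. -/
lemma rpow_slope_le_of_le_one {p : ℝ} (hp : 1 < p) {r : ℝ} (hr : 1 / 2 ≤ r) (hr1 : r ≤ 1) :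
    (p - 1) * (r ^ (p - 2) - r ^ (p - 1)) ≤ max (p - 1) 2 * (1 - r ^ (p - 1)) := by
  have h0 : 0 < r := by linarith
  have h1 : r ^ (p - 1) ≤ 1 := Real.rpow_le_one h0.le hr1 (by linarith)
  have hm1 := le_max_left (p - 1) 2
  have hm2 := le_max_right (p - 1) 2
  rcases le_or_gt 2 p with h2 | h2
  · have : r ^ (p - 2) ≤ 1 := Real.rpow_le_one h0.le hr1 (by linarith)
    nlinarith
  · have hb := rpow_one_add_le_one_add_mul_self (s := r - 1) (by linarith)
      (p := p - 1) (by linarith) (by linarith)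
    rw [show 1 + (r - 1) = r by ring] at hb
    have e : r ^ (p - 1) = r ^ (p - 2) * r := by
      rw [show p - 1 = (p - 2) + 1 by ring, Real.rpow_add_one h0.ne']
    have h3 : r ^ (p - 2) ≤ 2 := by
      calc r ^ (p - 2) ≤ r ^ (-1 : ℝ) :=
            Real.rpow_le_rpow_of_exponent_ge h0 hr1 (by linarith)
        _ = r⁻¹ := Real.rpow_neg_one r
        _ ≤ 2 := by rw [inv_le_comm₀ h0 (by norm_num)]; linarith
    have h4 : (p - 1) * (r ^ (p - 2) - r ^ (p - 1)) ≤ 2 * (1 - r ^ (p - 1)) := by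
      have : r ^ (p - 2) - r ^ (p - 1) = r ^ (p - 2) * (1 - r) := by rw [e]; ring
      rw [this]
      have := mul_le_mul_of_nonneg_right h3 (by linarith : 0 ≤ 1 - r)
      nlinarith
    nlinarith

/-- The Bregman divergence of `t ↦ t ^ p` from `r` to `1` is controlled by the one from `1`
to `r`. -/
lemma exists_young_gap_swap_le {p : ℝ} (hp : 1 < p) :
    ∃ K : ℝ, ∀ r : ℝ, 0 ≤ r →
      1 + (p - 1) * r ^ p - p * r ^ (p - 1) ≤ K * (r ^ p + (p - 1) - p * r) := by
  set L := max (p - 1) 2 with hL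
  set D : ℝ → ℝ := fun r => r ^ p + (p - 1) - p * r
  set k : ℝ → ℝ := fun r => L * (r ^ p + (p - 1) - p * r) - (1 + (p - 1) * r ^ p - p * r ^ (p - 1))
    with hk
  have hD2 : 0 < D (1 / 2) := young_gap_pos hp (by norm_num) (by norm_num)
  have hkc : Continuous k := by
    have h1 : Continuous fun r : ℝ => r ^ p := Real.continuous_rpow_const (by linarith)
    have h2 : Continuous fun r : ℝ => r ^ (p - 1) := Real.continuous_rpow_const (by linarith)
    simp only [hk]; fun_prop
  have hd : ∀ r : ℝ, 0 < r → HasDerivAt k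
      (p * (L * (r ^ (p - 1) - 1) - (p - 1) * (r ^ (p - 1) - r ^ (p - 2)))) r := by
    intro r hr
    have h1 := Real.hasDerivAt_rpow_const (x := r) (p := p) (Or.inl hr.ne')
    have h2 := Real.hasDerivAt_rpow_const (x := r) (p := p - 1) (Or.inl hr.ne')
    have := (((h1.add_const (p - 1)).sub ((hasDerivAt_id r).const_mul p)).const_mul L).sub
      (((h1.const_mul (p - 1)).const_add 1).sub (h2.const_mul p))
    refine this.congr_deriv ?_
    rw [show p - 1 - 1 = p - 2 by ring]; ring
  have hk1 : k 1 = 0 := by simp [hk]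
  have hup : ∀ r, 1 ≤ r → 0 ≤ k r := by
    intro r hr
    rw [← hk1]
    refine monotoneOn_of_deriv_nonneg (convex_Ici 1) hkc.continuousOn ?_ ?_ self_mem_Ici hr hr
    · intro x hx
      rw [interior_Ici] at hx
      exact (hd x (by have := hx.out; linarith)).differentiableAt.differentiableWithinAt
    · intro x hx
      rw [interior_Ici] at hx
      have hx' := hx.out
      rw [(hd x (by linarith)).deriv]
      have := rpow_slope_le_of_one_le hp hx'.le
      exact mul_nonneg (by linarith) (by linarith)
  have hdn : ∀ r, 1 / 2 ≤ r → r ≤ 1 → 0 ≤ k r := by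
    intro r hr hr1
    rw [← hk1]
    refine antitoneOn_of_deriv_nonpos (convex_Icc (1 / 2) 1) hkc.continuousOn ?_ ?_ ⟨hr, hr1⟩
      ⟨by norm_num, le_rfl⟩ hr1
    · intro x hx
      rw [interior_Icc] at hx
      exact (hd x (by have := hx.1; linarith)).differentiableAt.differentiableWithinAt
    · intro x hx
      rw [interior_Icc] at hx
      rw [(hd x (by have := hx.1; linarith)).deriv]
      have := rpow_slope_le_of_le_one hp hx.1.le hx.2.le
      exact mul_nonpos_of_nonneg_of_nonpos (by linarith) (by linarith)
  have hLpos : 0 < L := lt_of_lt_of_le (by norm_num) (le_max_right _ _)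
  refine ⟨max L (p / D (1 / 2)), fun r hr => ?_⟩
  have hDr : 0 ≤ D r := young_gap_nonneg hp hr
  rcases le_or_gt (1 / 2) r with h | h
  · have : 0 ≤ k r := by
      rcases le_or_gt r 1 with h1 | h1
      exacts [hdn r h h1, hup r h1.le]
    have h2 : L * D r ≤ max L (p / D (1 / 2)) * D r :=
      mul_le_mul_of_nonneg_right (le_max_left _ _) hDr
    simp only [hk] at this
    linarith
  · have h2 : p / D (1 / 2) * D r ≤ max L (p / D (1 / 2)) * D r :=
      mul_le_mul_of_nonneg_right (le_max_right _ _) hDr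
    have h3 : D (1 / 2) ≤ D r := by
      have hb := young_gap_nonneg hp (r := 2 * r) (by linarith)
      have hp2 : (0 : ℝ) < (1 / 2) ^ p := by positivity
      have e : r ^ p = (1 / 2) ^ p * (2 * r) ^ p := by
        rw [← Real.mul_rpow (by norm_num) (by linarith)]; congr 1; ring
      have e3 : (1 / 2 : ℝ) ^ p ≤ 1 / 2 := by
        calc (1 / 2 : ℝ) ^ p ≤ (1 / 2) ^ (1 : ℝ) :=
              Real.rpow_le_rpow_of_exponent_ge (by norm_num) (by norm_num) hp.le
          _ = _ := Real.rpow_one _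
      have := mul_nonneg hp2.le hb
      simp only [D]
      rw [e]
      nlinarith [mul_nonneg (mul_nonneg (by linarith : 0 ≤ p) (by linarith : 0 ≤ 1 - 2 * r))
        (by linarith : 0 ≤ 1 / 2 - (1 / 2 : ℝ) ^ p)]
    have h4 : p ≤ p / D (1 / 2) * D r := by
      rw [div_mul_eq_mul_div, le_div_iff₀ hD2]
      exact mul_le_mul_of_nonneg_left h3 (by linarith)
    have h5 : 1 + (p - 1) * r ^ p - p * r ^ (p - 1) ≤ p := by
      have : r ^ p ≤ 1 := Real.rpow_le_one hr (by linarith) (by linarith)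
      have h6 : 0 ≤ r ^ (p - 1) := Real.rpow_nonneg hr _
      nlinarith
    linarith

/-- Symmetry of the Bregman divergence of `ξ ↦ |ξ| ^ p` up to a constant, in terms of
`x = |a|`, `r = |c|` and `y = ⟨a, c⟩`. Both sides are affine in `y`, so that only the extreme
cases `y = ± x r`, which are one-dimensional, have to be checked. -/
lemma exists_bregman_swap_le_real {p : ℝ} (hp : 1 < p) :
    ∃ K : ℝ, 0 < K ∧ ∀ x r y : ℝ, 0 ≤ x → 0 ≤ r → |y| ≤ x * r →
      x ^ p + (p - 1) * r ^ p - p * (r ^ (p - 2) * y) ≤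
        K * (r ^ p + (p - 1) * x ^ p - p * (x ^ (p - 2) * y)) := by
  obtain ⟨K₁, hK₁⟩ := exists_young_gap_swap_le hp
  have hq : 0 < p - 1 := by linarith
  set K₂ : ℝ := (2 * p) / (p - 1) + 2 * p with hK₂
  set K := max K₁ K₂ with hKdef
  have hK₂pos : 0 < K₂ := by positivity
  have hKpos : 0 < K := hK₂pos.trans_le (le_max_right _ _)
  have hK₂1 : 2 * p ≤ K := by
    have : 0 ≤ (2 * p) / (p - 1) := by positivity
    exact le_trans (by linarith) (le_max_right _ _)
  have hK₂2 : 2 * p ≤ K * (p - 1) := by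
    have : (2 * p) / (p - 1) ≤ K := le_trans (by linarith) (le_max_right K₁ K₂)
    rwa [div_le_iff₀ hq] at this
  have hplus : ∀ r : ℝ, 0 ≤ r →
      1 + (p - 1) * r ^ p - p * r ^ (p - 1) ≤ K * (r ^ p + (p - 1) - p * r) := fun r hr =>
    (hK₁ r hr).trans (mul_le_mul_of_nonneg_right (le_max_left _ _) (young_gap_nonneg hp hr))
  have hminus : ∀ r : ℝ, 0 ≤ r →
      1 + (p - 1) * r ^ p + p * r ^ (p - 1) ≤ K * (r ^ p + (p - 1) + p * r) := by
    intro r hr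
    have h0 : 0 ≤ r ^ p := Real.rpow_nonneg hr _
    have h1 : r ^ (p - 1) ≤ 1 + r ^ p := by
      rcases le_or_gt r 1 with h | h
      · have := Real.rpow_le_one hr h hq.le
        linarith
      · have := Real.rpow_le_rpow_of_exponent_le h.le (by linarith : p - 1 ≤ p)
        linarith
    have h3 : 0 ≤ K * (p * r) := by positivity
    have h4 : (2 * p) * r ^ p ≤ K * r ^ p :=
      mul_le_mul_of_nonneg_right (by linarith) h0
    nlinarith [mul_le_mul_of_nonneg_left h1 (by linarith : 0 ≤ p)]
  refine ⟨K, hKpos, fun x r y hx hr hy => ?_⟩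
  rcases hx.eq_or_lt with rfl | hx
  · have hy0 : y = 0 := by simpa using hy
    subst hy0
    simp only [Real.zero_rpow (by linarith : p ≠ 0)]
    have h0 : 0 ≤ r ^ p := Real.rpow_nonneg hr _
    nlinarith [mul_le_mul_of_nonneg_right hK₂1 h0]
  -- normalize to `x = 1`
  set ρ := r / x
  have hρ : 0 ≤ ρ := by positivity
  have hrρ : r = ρ * x := by simp only [ρ]; field_simp
  have hxp : 0 < x ^ p := Real.rpow_pos_of_pos hx p
  have hx2 : x ^ (p - 2) * x * x = x ^ p := by
    rw [← Real.rpow_add_one hx.ne', ← Real.rpow_add_one hx.ne']; congr 1; ring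
  rcases hρ.eq_or_lt with h | hρpos
  · have hr0 : r = 0 := by rw [hrρ, ← h, zero_mul]
    subst hr0
    have hy0 : y = 0 := by simpa using hy
    subst hy0
    simp only [Real.zero_rpow (by linarith : p ≠ 0)]
    nlinarith
  have hrpos : 0 < r := by rw [hrρ]; positivity
  set σ := y / (x * r)
  have hyσ : y = σ * (x * r) := by simp only [σ]; field_simp
  have hσ1 : |σ| ≤ 1 := by
    simp only [σ]
    rw [abs_div, abs_of_pos (by positivity : 0 < x * r), div_le_one (by positivity)]
    exact hy
  obtain ⟨hσa, hσb⟩ := abs_le.1 hσ1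
  have hr1 : r ^ p = ρ ^ p * x ^ p := by rw [hrρ, Real.mul_rpow hρ hx.le]
  have hρ2 : ρ ^ (p - 2) * ρ = ρ ^ (p - 1) := by
    rw [← Real.rpow_add_one hρpos.ne']; congr 1; ring
  have e1 : r ^ (p - 2) * y = x ^ p * (ρ ^ (p - 1) * σ) := by
    rw [hyσ, hrρ, Real.mul_rpow hρ hx.le, ← hx2, ← hρ2]; ring
  have e2 : x ^ (p - 2) * y = x ^ p * (ρ * σ) := by
    rw [hyσ, hrρ, ← hx2]; ring
  rw [e1, e2, hr1]
  have key : 1 + (p - 1) * ρ ^ p - p * (ρ ^ (p - 1) * σ) ≤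
      K * (ρ ^ p + (p - 1) - p * (ρ * σ)) := by
    have h1 := mul_le_mul_of_nonneg_left (hplus ρ hρ) (by linarith : 0 ≤ (1 + σ) / 2)
    have h2 := mul_le_mul_of_nonneg_left (hminus ρ hρ) (by linarith : 0 ≤ (1 - σ) / 2)
    linarith
  have := mul_le_mul_of_nonneg_left key hxp.le
  linarith

lemma bregman_real_nonneg {p : ℝ} (hp : 1 < p) {x r y : ℝ} (hx : 0 ≤ x) (hr : 0 ≤ r)
    (hy : y ≤ x * r) : 0 ≤ r ^ p + (p - 1) * x ^ p - p * (x ^ (p - 2) * y) := by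
  rcases hx.eq_or_lt with rfl | hx
  · have h0 : 0 ≤ r ^ p := Real.rpow_nonneg hr _
    simp only [Real.zero_rpow (by linarith : p ≠ 0)]
    rcases eq_or_ne p 2 with rfl | h2
    · simp at hy ⊢; nlinarith
    · rw [Real.zero_rpow (sub_ne_zero.2 h2)]; simpa using h0
  have hx2 : x ^ (p - 2) * x * x = x ^ p := by
    rw [← Real.rpow_add_one hx.ne', ← Real.rpow_add_one hx.ne']; congr 1; ring
  have hr1 : r ^ p = (r / x) ^ p * x ^ p := by
    rw [← Real.mul_rpow (by positivity) hx.le]; congr 1; field_simp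
  have h1 := young_gap_nonneg hp (r := r / x) (by positivity)
  have h2 : x ^ (p - 2) * y ≤ x ^ (p - 2) * (x * r) :=
    mul_le_mul_of_nonneg_left hy (Real.rpow_nonneg hx.le _)
  have h3 : x ^ (p - 2) * (x * r) = x ^ p * (r / x) := by rw [← hx2]; field_simp
  rw [hr1]
  have h4 := mul_nonneg h1 (Real.rpow_nonneg hx.le p)
  nlinarith

/-- The Bregman divergence dominates `|b| ^ p` for `b = c - a`, up to an arbitrarily small multiple
of `|a| ^ p`; here `x = |a|`, `z = |b|`, `y = ⟨a, b⟩`. -/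
lemma exists_rpow_le_bregman_real {p : ℝ} (hp : 1 < p) {δ : ℝ} (hδ : 0 < δ) :
    ∃ C : ℝ, 0 < C ∧ ∀ x z y r : ℝ, 0 ≤ x → 0 ≤ z → 0 ≤ r → |y| ≤ x * z →
      r ^ 2 = x ^ 2 + 2 * y + z ^ 2 →
      z ^ p ≤ C * (r ^ p + (p - 1) * x ^ p - p * (x ^ (p - 2) * (x ^ 2 + y))) + δ * x ^ p := by
  -- by homogeneity `z = 1`, and the cases `δ x ^ p ≥ 1` are trivial: compactness applies
  set X : ℝ := δ⁻¹ ^ (1 / p)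
  set S : Set (ℝ × ℝ) := Icc 0 X ×ˢ Icc (-1) 1
  set Φ : ℝ × ℝ → ℝ := fun q => (√(q.1 ^ 2 + 2 * (q.1 * q.2) + 1)) ^ p - q.1 ^ p -
    p * (q.1 ^ (p - 1) * q.2)
  have hS : IsCompact S := isCompact_Icc.prod isCompact_Icc
  have hX : 0 ≤ X := by positivity
  have hSne : S.Nonempty := ⟨(0, 0), by simp [S, hX]⟩
  have hΦ : Continuous Φ := by
    have h1 : Continuous fun r : ℝ => r ^ p := Real.continuous_rpow_const (by linarith)
    have h2 : Continuous fun r : ℝ => r ^ (p - 1) := Real.continuous_rpow_const (by linarith)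
    have h3 : Continuous fun q : ℝ × ℝ => (√(q.1 ^ 2 + 2 * (q.1 * q.2) + 1)) ^ p :=
      h1.comp (by fun_prop)
    have h4 : Continuous fun q : ℝ × ℝ => q.1 ^ p := h1.comp continuous_fst
    have h5 : Continuous fun q : ℝ × ℝ => q.1 ^ (p - 1) := h2.comp continuous_fst
    simp only [Φ]; fun_prop
  have hpos : ∀ q ∈ S, 0 < Φ q := by
    rintro ⟨x, s⟩ ⟨⟨hx0, -⟩, hs1, hs2⟩
    simp only at hx0 hs1 hs2
    simp only [Φ]
    set r := √(x ^ 2 + 2 * (x * s) + 1) with hr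
    have hs : s ^ 2 ≤ 1 := by nlinarith
    have hr2 : r ^ 2 = x ^ 2 + 2 * (x * s) + 1 := Real.sq_sqrt (by nlinarith [sq_nonneg (x + s)])
    have hr0 : 0 ≤ r := Real.sqrt_nonneg _
    rcases hx0.eq_or_lt with rfl | hx
    · have : r = 1 := by rw [hr]; simp
      rw [this]
      simp [Real.zero_rpow (by linarith : p ≠ 0), Real.zero_rpow (by linarith : p - 1 ≠ 0)]
    have hxp : 0 < x ^ p := Real.rpow_pos_of_pos hx p
    have hx1 : x ^ (p - 1) * x = x ^ p := by
      rw [← Real.rpow_add_one hx.ne']; congr 1; ring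
    have hr1 : r ^ p = (r / x) ^ p * x ^ p := by
      rw [← Real.mul_rpow (by positivity) hx.le]; congr 1; field_simp
    have hle : x + s ≤ r := by
      apply le_of_sq_le_sq _ hr0
      nlinarith
    have hx1p : 0 < x ^ (p - 1) := Real.rpow_pos_of_pos hx _
    have e3 : x ^ p * (r / x) = x ^ (p - 1) * r := by rw [← hx1]; field_simp
    rcases hle.eq_or_lt with h | h
    · have hne : r / x ≠ 1 := by
        intro h1
        rw [div_eq_one_iff_eq hx.ne'] at h1
        have : s = 0 := by linarith
        rw [this, h1] at hr2
        norm_num at hr2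
      have := mul_pos (young_gap_pos hp (r := r / x) (by positivity) hne) hxp
      rw [hr1]
      have e4 : x ^ (p - 1) * s = x ^ p * (r / x) - x ^ p := by rw [e3, ← h, ← hx1]; ring
      rw [e4]; linarith
    · have := mul_nonneg (young_gap_nonneg hp (r := r / x) (by positivity)) hxp.le
      rw [hr1]
      have e4 : x ^ (p - 1) * s < x ^ p * (r / x) - x ^ p := by
        rw [e3, ← hx1]
        have := mul_lt_mul_of_pos_left h hx1p
        linarith
      nlinarith
  obtain ⟨q₀, hq₀, hmin⟩ := hS.exists_isMinOn hSne hΦ.continuousOn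
  have hm := hpos q₀ hq₀
  set m := Φ q₀
  refine ⟨m⁻¹, inv_pos.2 hm, fun x z y r hx hz hr hy hr2 => ?_⟩
  obtain ⟨hy1, hy2⟩ := abs_le.1 hy
  have hxp : 0 ≤ x ^ p := Real.rpow_nonneg hx p
  have hB : 0 ≤ r ^ p + (p - 1) * x ^ p - p * (x ^ (p - 2) * (x ^ 2 + y)) := by
    apply bregman_real_nonneg hp hx hr
    have : (x ^ 2 + y) ^ 2 ≤ (x * r) ^ 2 := by
      rw [mul_pow, hr2]
      have : y ^ 2 ≤ (x * z) ^ 2 := sq_le_sq' hy1 hy2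
      nlinarith
    exact (le_abs_self _).trans (abs_le_of_sq_le_sq this (by positivity))
  have hB' := mul_nonneg (inv_pos.2 hm).le hB
  rcases hz.eq_or_lt with rfl | hzpos
  · rw [Real.zero_rpow (by linarith : p ≠ 0)]
    have := mul_nonneg hδ.le hxp
    linarith
  have hzp : 0 < z ^ p := Real.rpow_pos_of_pos hzpos p
  rcases le_or_gt (z ^ p) (δ * x ^ p) with h | h
  · linarith
  -- now `x / z ≤ X`
  have hxz : x / z ≤ X := by
    have h1 : (x / z) ^ p ≤ δ⁻¹ := by
      rw [Real.div_rpow hx hz, div_le_iff₀ hzp, inv_mul_eq_div, le_div_iff₀ hδ]; linarith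
    calc x / z = ((x / z) ^ p) ^ (1 / p) := by
          rw [← Real.rpow_mul (by positivity), mul_one_div_cancel (by linarith), Real.rpow_one]
      _ ≤ _ := Real.rpow_le_rpow (by positivity) h1 (by positivity)
  obtain ⟨s, hs1, hs2, hys⟩ : ∃ s : ℝ, -1 ≤ s ∧ s ≤ 1 ∧ y = s * (x * z) := by
    rcases hx.eq_or_lt with rfl | hxpos
    · exact ⟨0, by norm_num, by norm_num, by simpa using hy⟩
    · have hxz : 0 < x * z := by positivity
      refine ⟨y / (x * z), ?_, ?_, by field_simp⟩
      · rw [le_div_iff₀ hxz]; linarith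
      · rw [div_le_one hxz]; exact hy2
  have hmem : ((x / z, s) : ℝ × ℝ) ∈ S := ⟨⟨by positivity, hxz⟩, hs1, hs2⟩
  have hge : m ≤ Φ (x / z, s) := hmin hmem
  have hrz : r = z * √((x / z) ^ 2 + 2 * (x / z * s) + 1) := by
    rw [← Real.sqrt_sq hr, ← Real.sqrt_sq hz, ← Real.sqrt_mul (sq_nonneg _), Real.sqrt_sq hz, hr2,
      hys]
    congr 1; field_simp
  have e1 : z ^ p * Φ (x / z, s) =
      r ^ p + (p - 1) * x ^ p - p * (x ^ (p - 2) * (x ^ 2 + y)) := by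
    have hr1 : r ^ p = z ^ p * (√((x / z) ^ 2 + 2 * (x / z * s) + 1)) ^ p := by
      conv_lhs => rw [hrz]
      rw [Real.mul_rpow hz (Real.sqrt_nonneg _)]
    have hx1 : x ^ p = z ^ p * (x / z) ^ p := by
      rw [← Real.mul_rpow hz (by positivity)]; congr 1; field_simp
    rcases hx.eq_or_lt with hx0 | hxpos
    · have hy0 : y = 0 := by rw [hys, ← hx0]; ring
      have hx00 : x = 0 := hx0.symm
      subst hx00
      simp only [Φ, hr1]
      rw [hy0]
      simp [Real.zero_rpow (by linarith : p ≠ 0), Real.zero_rpow (by linarith : p - 1 ≠ 0)]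
    have hx3 : x ^ (p - 2) * x * x = x ^ p := by
      rw [← Real.rpow_add_one hxpos.ne', ← Real.rpow_add_one hxpos.ne']; congr 1; ring
    have hx2 : x ^ (p - 2) * (x ^ 2 + y) = x ^ p + z ^ p * ((x / z) ^ (p - 1) * s) := by
      have : z ^ p * (x / z) ^ (p - 1) = x ^ (p - 2) * x * z := by
        rw [Real.div_rpow hx hz, ← Real.rpow_add_one hxpos.ne', show p - 2 + 1 = p - 1 by ring,
          Real.rpow_sub_one hzpos.ne']
        field_simp
      rw [← mul_assoc, this, ← hx3, hys]; ring
    rw [hx2, hr1]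
    simp only [Φ]
    linear_combination hx1
  have h6 : z ^ p * m ≤ z ^ p * Φ (x / z, s) := mul_le_mul_of_nonneg_left hge hzp.le
  rw [e1] at h6
  have h7 : z ^ p ≤ m⁻¹ * (r ^ p + (p - 1) * x ^ p - p * (x ^ (p - 2) * (x ^ 2 + y))) := by
    rw [inv_mul_eq_div, le_div_iff₀ hm]; exact h6
  have := mul_nonneg hδ.le hxp
  linarith

/-! ### The Bregman divergence of `ξ ↦ |ξ|_M ^ p` -/

section Bregman

variable {N : ℕ} {M : Matrix (Fin N) (Fin N) ℝ}

lemma matForm_add_left (M : Matrix (Fin N) (Fin N) ℝ) (a b c : EuclideanSpace ℝ (Fin N)) :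
    matForm M (a + b) c = matForm M a c + matForm M b c := by
  simp only [matForm, ← Finset.sum_add_distrib, PiLp.add_apply]
  exact Finset.sum_congr rfl fun i _ => Finset.sum_congr rfl fun j _ => by ring

lemma matForm_add_right (M : Matrix (Fin N) (Fin N) ℝ) (a b c : EuclideanSpace ℝ (Fin N)) :
    matForm M a (b + c) = matForm M a b + matForm M a c := by
  simp only [matForm, ← Finset.sum_add_distrib, PiLp.add_apply]
  exact Finset.sum_congr rfl fun i _ => Finset.sum_congr rfl fun j _ => by ring

lemma matForm_smul_left (M : Matrix (Fin N) (Fin N) ℝ) (t : ℝ) (a c : EuclideanSpace ℝ (Fin N)) :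
    matForm M (t • a) c = t * matForm M a c := by
  simp only [matForm, Finset.mul_sum, PiLp.smul_apply, smul_eq_mul]
  exact Finset.sum_congr rfl fun i _ => Finset.sum_congr rfl fun j _ => by ring

lemma matForm_smul_right (M : Matrix (Fin N) (Fin N) ℝ) (t : ℝ)
    (a c : EuclideanSpace ℝ (Fin N)) : matForm M a (t • c) = t * matForm M a c := by
  simp only [matForm, Finset.mul_sum, PiLp.smul_apply, smul_eq_mul]
  exact Finset.sum_congr rfl fun i _ => Finset.sum_congr rfl fun j _ => by ring

lemma matForm_comm (hS : M.IsSymm) (a c : EuclideanSpace ℝ (Fin N)) :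
    matForm M a c = matForm M c a := by
  simp only [matForm]
  rw [Finset.sum_comm]
  refine Finset.sum_congr rfl fun i _ => Finset.sum_congr rfl fun j _ => ?_
  rw [hS.apply i j]; ring

lemma matNorm_nonneg (M : Matrix (Fin N) (Fin N) ℝ) (a : EuclideanSpace ℝ (Fin N)) :
    0 ≤ matNorm M a := Real.sqrt_nonneg _

lemma matNorm_smul (M : Matrix (Fin N) (Fin N) ℝ) (t : ℝ) (a : EuclideanSpace ℝ (Fin N)) :
    matNorm M (t • a) = |t| * matNorm M a := by
  rw [matNorm, matForm_smul_left, matForm_smul_right, ← mul_assoc, Real.sqrt_mul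
    (mul_self_nonneg t), Real.sqrt_mul_self_eq_abs, matNorm]

lemma matNorm_sq (hP : ∀ ξ, 0 ≤ matForm M ξ ξ) (a : EuclideanSpace ℝ (Fin N)) :
    matNorm M a ^ 2 = matForm M a a := Real.sq_sqrt (hP a)

lemma abs_matForm_le (hS : M.IsSymm) (hP : ∀ ξ, 0 ≤ matForm M ξ ξ)
    (a c : EuclideanSpace ℝ (Fin N)) : |matForm M a c| ≤ matNorm M a * matNorm M c := by
  have h : ∀ t : ℝ, 0 ≤ matForm M a a * (t * t) + 2 * matForm M a c * t + matForm M c c := by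
    intro t
    have := hP (t • a + c)
    rw [matForm_add_left, matForm_add_right, matForm_add_right, matForm_smul_left,
      matForm_smul_left, matForm_smul_right, matForm_smul_right, matForm_comm hS c a] at this
    linarith
  have := discrim_le_zero h
  rw [discrim] at this
  apply abs_le_of_sq_le_sq _ (mul_nonneg (matNorm_nonneg _ _) (matNorm_nonneg _ _))
  rw [mul_pow, matNorm_sq hP, matNorm_sq hP]
  linarith

/-- The Bregman divergence `|c|^p - |a|^p - p |a|^{p-2} ⟨M a, c - a⟩` of `ξ ↦ |ξ|_M ^ p` at `c`
based at `a`. Since `⟨M a, a⟩ = |a|^2`, it is written with `⟨M a, c⟩` in place of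
`⟨M a, c - a⟩`. At `a = 0` the last term vanishes for every `p`, because `⟨M a, c⟩ = 0`. -/
noncomputable def bregman (p : ℝ) (M : Matrix (Fin N) (Fin N) ℝ)
    (c a : EuclideanSpace ℝ (Fin N)) : ℝ :=
  matNorm M c ^ p + (p - 1) * matNorm M a ^ p - p * (matNorm M a ^ (p - 2) * matForm M a c)

variable {p : ℝ}

lemma rpow_sub_two_mul_sq (hp : 1 < p) {x : ℝ} (hx : 0 ≤ x) : x ^ (p - 2) * x ^ 2 = x ^ p := by
  rcases hx.eq_or_lt with rfl | hx
  · simp [Real.zero_rpow (by linarith : p ≠ 0)]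
  · rw [← Real.rpow_natCast, ← Real.rpow_add hx]; norm_num

lemma bregman_nonneg (hp : 1 < p) (hS : M.IsSymm) (hP : ∀ ξ, 0 ≤ matForm M ξ ξ)
    (c a : EuclideanSpace ℝ (Fin N)) : 0 ≤ bregman p M c a :=
  bregman_real_nonneg hp (matNorm_nonneg _ _) (matNorm_nonneg _ _)
    ((le_abs_self _).trans (abs_matForm_le hS hP a c))

lemma bregman_self (hp : 1 < p) (hP : ∀ ξ, 0 ≤ matForm M ξ ξ) (a : EuclideanSpace ℝ (Fin N)) :
    bregman p M a a = 0 := by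
  rw [bregman, ← matNorm_sq hP, rpow_sub_two_mul_sq hp (matNorm_nonneg _ _)]; ring

lemma bregman_smul (hp : 1 < p) (t : ℝ) (c a : EuclideanSpace ℝ (Fin N)) :
    bregman p M (t • c) (t • a) = |t| ^ p * bregman p M c a := by
  simp only [bregman, matNorm_smul, matForm_smul_left, matForm_smul_right]
  rw [Real.mul_rpow (abs_nonneg _) (matNorm_nonneg _ _),
    Real.mul_rpow (abs_nonneg _) (matNorm_nonneg _ _),
    Real.mul_rpow (abs_nonneg _) (matNorm_nonneg _ _), ← rpow_sub_two_mul_sq hp (abs_nonneg t),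
    sq_abs]
  ring

/-- The divergence at `a + l b` based at `a`, as a function of `l`. -/
lemma bregman_add_smul (hp : 1 < p) (hP : ∀ ξ, 0 ≤ matForm M ξ ξ)
    (a b : EuclideanSpace ℝ (Fin N)) (l : ℝ) :
    bregman p M (a + l • b) a = matNorm M (a + l • b) ^ p - matNorm M a ^ p -
      l * (p * (matNorm M a ^ (p - 2) * matForm M a b)) := by
  have := rpow_sub_two_mul_sq hp (matNorm_nonneg M a)
  rw [matNorm_sq hP] at this
  rw [bregman, matForm_add_right, matForm_smul_right]
  linear_combination (-p) * this

lemma bregman_add_smul_le (hp : 1 < p) (hS : M.IsSymm) (hP : ∀ ξ, 0 ≤ matForm M ξ ξ)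
    (a b : EuclideanSpace ℝ (Fin N)) {k : ℝ} (hk0 : 0 ≤ k) (hk1 : k ≤ 1) :
    bregman p M (a + k • b) a ≤ k * bregman p M (a + b) a := by
  -- convexity of `|·|^p`: compare both `a` and `a + b` with `c = a + k b`
  set c := a + k • b with hc
  have e1 : a = c + (-k) • b := by rw [hc]; module
  have e2 : a + b = c + (1 - k) • b := by rw [hc]; module
  have h1 := bregman_nonneg hp hS hP (c + (-k) • b) c
  have h2 := bregman_nonneg hp hS hP (c + (1 - k) • b) c
  rw [bregman_add_smul hp hP, ← e1] at h1
  rw [bregman_add_smul hp hP, ← e2] at h2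
  have h3 := bregman_add_smul hp hP a b k
  have h4 := bregman_add_smul hp hP a b 1
  rw [one_smul] at h4
  rw [← hc] at h3
  rw [h3, h4]
  nlinarith [mul_le_mul_of_nonneg_left h1 (by linarith : 0 ≤ 1 - k),
    mul_le_mul_of_nonneg_left h2 hk0]

/-- A dilation by a fixed factor `r > 1` about the base point increases the divergence at most by a
constant factor. -/
lemma exists_bregman_dilation_le (hp : 1 < p) :
    ∃ r : ℝ, 1 < r ∧ ∀ {N : ℕ} (M : Matrix (Fin N) (Fin N) ℝ), M.IsSymm →
      (∀ ξ, 0 ≤ matForm M ξ ξ) → ∀ a b : EuclideanSpace ℝ (Fin N),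
        bregman p M (a + r • b) a ≤ 2 * bregman p M (a + b) a := by
  obtain ⟨K, hK, hswap⟩ := exists_bregman_swap_le_real hp
  set ε : ℝ := 1 / (2 * (1 + K)) with hε
  have hε0 : 0 < ε := by positivity
  have hεK : ε * (1 + K) = 1 / 2 := by rw [hε]; field_simp
  have hε1 : ε < 1 := by nlinarith
  set r : ℝ := 1 / (1 - ε) with hr
  have hr0 : 0 < r := by apply one_div_pos.2; linarith
  have hrε : r - 1 = r * ε := by
    have : 1 - ε ≠ 0 := by linarith
    rw [hr]; field_simp; ring
  refine ⟨r, by nlinarith, fun M hS hP a b => ?_⟩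
  -- with `h l` the divergence at `a + l b` based at `a`, the symmetry of the divergence yields
  -- `l h'(l) ≤ (1 + K) h l`, and `h 1 ≥ h r - (r - 1) h' r` by convexity
  set c := a + r • b with hc
  have e1 : a = c + (-r) • b := by rw [hc]; module
  have e2 : a + b = c + (1 - r) • b := by rw [hc]; module
  have h1 : bregman p M a c ≤ K * bregman p M c a := by
    have := hswap (matNorm M a) (matNorm M c) (matForm M a c) (matNorm_nonneg _ _)
      (matNorm_nonneg _ _) (abs_matForm_le hS hP a c)
    simp only [bregman]
    rw [matForm_comm hS c a]
    exact this
  have h2 := bregman_nonneg hp hS hP (a + b) c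
  have e3 := bregman_add_smul hp hP c b (-r)
  have e4 := bregman_add_smul hp hP c b (1 - r)
  have e5 := bregman_add_smul hp hP a b r
  have e6 := bregman_add_smul hp hP a b 1
  rw [← e1] at e3
  rw [← e2] at e4
  rw [one_smul] at e6
  rw [← hc] at e5
  set g := p * (matNorm M c ^ (p - 2) * matForm M c b)
  set T := p * (matNorm M a ^ (p - 2) * matForm M a b)
  have h3 : r * (g - T) ≤ (1 + K) * bregman p M c a := by linarith
  have h4 : bregman p M c a - bregman p M (a + b) a ≤ (r - 1) * (g - T) := by linarith
  have h5 : (r - 1) * (g - T) ≤ 1 / 2 * bregman p M c a := by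
    rw [hrε, ← hεK]
    have := mul_le_mul_of_nonneg_left h3 hε0.le
    linarith
  linarith

/-- The Bregman divergence of `|·|^p` is doubling along rays issuing from its base point. -/
lemma exists_bregman_doubling (hp : 1 < p) :
    ∃ C : ℝ, 0 < C ∧ ∀ {N : ℕ} (M : Matrix (Fin N) (Fin N) ℝ), M.IsSymm →
      (∀ ξ, 0 ≤ matForm M ξ ξ) → ∀ (a b : EuclideanSpace ℝ (Fin N)) (k : ℝ), 0 ≤ k → k ≤ 2 →
        bregman p M (a + k • b) a ≤ C * bregman p M (a + b) a := by
  obtain ⟨r, hr, H⟩ := exists_bregman_dilation_le hp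
  obtain ⟨m, hm⟩ := pow_unbounded_of_one_lt 2 hr
  refine ⟨2 ^ m, by positivity, fun M hS hP a b k hk0 hk2 => ?_⟩
  have hrm : 0 < r ^ m := by positivity
  have hiter : ∀ n : ℕ, bregman p M (a + r ^ n • b) a ≤ 2 ^ n * bregman p M (a + b) a := by
    intro n
    induction n with
    | zero => simp
    | succ n ih =>
      have := H M hS hP a (r ^ n • b)
      rw [smul_smul, ← pow_succ'] at this
      rw [pow_succ 2 n]
      linarith
  have h1 := bregman_add_smul_le hp hS hP a (r ^ m • b) (k := k / r ^ m) (by positivity)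
    (by rw [div_le_one hrm]; linarith)
  rw [smul_smul, div_mul_cancel₀ _ hrm.ne'] at h1
  have h2 := bregman_nonneg hp hS hP (a + r ^ m • b) a
  have h3 : k / r ^ m * bregman p M (a + r ^ m • b) a ≤ 1 * bregman p M (a + r ^ m • b) a :=
    mul_le_mul_of_nonneg_right (by rw [div_le_one hrm]; linarith) h2
  linarith [hiter m]

/-- The divergence controls the increment, up to an arbitrarily small multiple of the base point. -/
lemma exists_matNorm_rpow_le_bregman (hp : 1 < p) {δ : ℝ} (hδ : 0 < δ) :
    ∃ C : ℝ, 0 < C ∧ ∀ {N : ℕ} (M : Matrix (Fin N) (Fin N) ℝ), M.IsSymm →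
      (∀ ξ, 0 ≤ matForm M ξ ξ) → ∀ a b : EuclideanSpace ℝ (Fin N),
        matNorm M b ^ p ≤ C * bregman p M (a + b) a + δ * matNorm M a ^ p := by
  obtain ⟨C, hC, H⟩ := exists_rpow_le_bregman_real hp hδ
  refine ⟨C, hC, fun M hS hP a b => ?_⟩
  have := H (matNorm M a) (matNorm M b) (matForm M a b) (matNorm M (a + b)) (matNorm_nonneg _ _)
    (matNorm_nonneg _ _) (matNorm_nonneg _ _) (abs_matForm_le hS hP a b) (by
      rw [matNorm_sq hP, matNorm_sq hP, matNorm_sq hP, matForm_add_left, matForm_add_right,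
        matForm_add_right, matForm_comm hS b a]
      ring)
  rwa [matNorm_sq hP, ← matForm_add_right] at this

end Bregman

/-! ### Mollification in `L^p` -/

section Mollification

open scoped Convolution Topology
open Filter

variable {E F : Type*} [NormedAddCommGroup E] [InnerProductSpace ℝ E] [FiniteDimensional ℝ E]
  [MeasurableSpace E] [BorelSpace E] [NormedAddCommGroup F] [NormedSpace ℝ F]

/-- Jensen's inequality: mollification does not increase the `L^p` norm. -/
lemma eLpNorm_mollify_le {p : ℝ} (hp : 1 ≤ p) (ρ : ContDiffBump (0 : E)) {f : E → F}
    (hf : AEStronglyMeasurable f volume) :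
    eLpNorm (ρ.normed volume ⋆[ContinuousLinearMap.lsmul ℝ ℝ, volume] f) (ENNReal.ofReal p) volume
      ≤ eLpNorm f (ENNReal.ofReal p) volume := by
  wlog hs : StronglyMeasurable f generalizing f
  · rw [convolution_congr (ContinuousLinearMap.lsmul ℝ ℝ) (ae_eq_refl _) hf.ae_eq_mk,
      eLpNorm_congr_ae hf.ae_eq_mk]
    exact this hf.stronglyMeasurable_mk.aestronglyMeasurable hf.stronglyMeasurable_mk
  have hp0 : 0 < p := by linarith
  have hpe0 : ENNReal.ofReal p ≠ 0 := by simpa using hp0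
  have hpr : (ENNReal.ofReal p).toReal = p := ENNReal.toReal_ofReal hp0.le
  have hρm : Measurable fun t => ENNReal.ofReal (ρ.normed volume t) :=
    (ρ.continuous_normed.measurable).ennreal_ofReal
  -- the probability measure `ρ dx`
  set ν : Measure E := volume.withDensity fun t => ENNReal.ofReal (ρ.normed volume t) with hν
  have hνp : IsProbabilityMeasure ν := by
    refine ⟨?_⟩
    rw [hν, withDensity_apply _ MeasurableSet.univ, Measure.restrict_univ,
      ← ofReal_integral_eq_lintegral_ofReal ρ.integrable_normed
        (Eventually.of_forall ρ.nonneg_normed), ρ.integral_normed, ENNReal.ofReal_one]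
  have hpt : ∀ x, ‖(ρ.normed volume ⋆[ContinuousLinearMap.lsmul ℝ ℝ, volume] f) x‖ₑ ^ p ≤
      ∫⁻ t, ‖f (x - t)‖ₑ ^ p ∂ν := by
    intro x
    have hm : StronglyMeasurable fun t => f (x - t) :=
      hs.comp_measurable (measurable_const.sub measurable_id)
    have h1 : ‖(ρ.normed volume ⋆[ContinuousLinearMap.lsmul ℝ ℝ, volume] f) x‖ₑ ≤
        ∫⁻ t, ‖f (x - t)‖ₑ ∂ν := by
      rw [convolution_def, hν, lintegral_withDensity_eq_lintegral_mul _ hρm hm.enorm]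
      refine (enorm_integral_le_lintegral_enorm _).trans (le_of_eq (lintegral_congr fun t => ?_))
      rw [ContinuousLinearMap.lsmul_apply, enorm_smul, Pi.mul_apply,
        Real.enorm_of_nonneg (ρ.nonneg_normed t)]
    have h2 := eLpNorm_le_eLpNorm_of_exponent_le (μ := ν) (p := 1) (q := ENNReal.ofReal p)
      (by simpa using ENNReal.ofReal_le_ofReal hp) hm.aestronglyMeasurable
    rw [eLpNorm_one_eq_lintegral_enorm, eLpNorm_eq_lintegral_rpow_enorm_toReal hpe0
      ENNReal.ofReal_ne_top, hpr] at h2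
    calc _ ≤ ((∫⁻ t, ‖f (x - t)‖ₑ ^ p ∂ν) ^ (1 / p)) ^ p :=
          ENNReal.rpow_le_rpow (h1.trans h2) hp0.le
      _ = _ := by rw [← ENNReal.rpow_mul, one_div_mul_cancel hp0.ne', ENNReal.rpow_one]
  rw [eLpNorm_eq_lintegral_rpow_enorm_toReal hpe0 ENNReal.ofReal_ne_top,
    eLpNorm_eq_lintegral_rpow_enorm_toReal hpe0 ENNReal.ofReal_ne_top, hpr]
  refine ENNReal.rpow_le_rpow ?_ (by positivity)
  calc _ ≤ ∫⁻ x, ∫⁻ t, ‖f (x - t)‖ₑ ^ p ∂ν := lintegral_mono hpt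
    _ = ∫⁻ t, ∫⁻ x, ‖f (x - t)‖ₑ ^ p ∂volume ∂ν := by
      refine lintegral_lintegral_swap ?_
      exact ((hs.comp_measurable (measurable_fst.sub measurable_snd)).enorm.pow_const p).aemeasurable
    _ = ∫⁻ _, (∫⁻ x, ‖f x‖ₑ ^ p ∂volume) ∂ν := by
      refine lintegral_congr fun t => ?_
      exact lintegral_sub_right_eq_self (fun x => ‖f x‖ₑ ^ p) t
    _ = _ := by rw [lintegral_const, measure_univ, mul_one]

lemma support_mollify_subset (ρ : ContDiffBump (0 : E)) (f : E → F) :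
    Function.support (ρ.normed volume ⋆[ContinuousLinearMap.lsmul ℝ ℝ, volume] f) ⊆
      Metric.cthickening ρ.rOut (tsupport f) := by
  refine (support_convolution_subset _).trans ?_
  rw [ρ.support_normed_eq]
  rintro _ ⟨y, hy, z, hz, rfl⟩
  refine Metric.mem_cthickening_of_dist_le _ z _ _ (subset_tsupport _ hz) ?_
  simpa using (mem_ball_zero_iff.1 hy).le

variable [CompleteSpace F]

/-- Mollifications of a continuous function with compact support converge uniformly, with a rate
that depends only on the radius of the mollifier. -/
lemma exists_mollify_dist_le {f : E → F} (hf : Continuous f) (hfc : HasCompactSupport f) {ε : ℝ}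
    (hε : 0 < ε) :
    ∃ R > 0, ∀ ρ : ContDiffBump (0 : E), ρ.rOut ≤ R → ∀ x,
      dist ((ρ.normed volume ⋆[ContinuousLinearMap.lsmul ℝ ℝ, volume] f) x) (f x) ≤ ε := by
  obtain ⟨R, hR, H⟩ := Metric.uniformContinuous_iff.1
    (hfc.uniformContinuous_of_continuous hf) ε hε
  refine ⟨R, hR, fun ρ hρ x => ρ.dist_normed_convolution_le hf.aestronglyMeasurable ?_⟩
  intro y hy
  exact (H (lt_of_lt_of_le (Metric.mem_ball.1 hy) hρ)).le

/-- Mollifications converge in `L^p`. -/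
lemma exists_mollify_eLpNorm_sub_le {p : ℝ} (hp : 1 ≤ p) {f : E → F}
    (hf : MemLp f (ENNReal.ofReal p) volume) {ε : ℝ≥0∞} (hε : ε ≠ 0) :
    ∃ R > 0, ∀ ρ : ContDiffBump (0 : E), ρ.rOut ≤ R →
      eLpNorm ((ρ.normed volume ⋆[ContinuousLinearMap.lsmul ℝ ℝ, volume] f) - f)
        (ENNReal.ofReal p) volume ≤ ε := by
  have hp0 : 0 < p := by linarith
  have hpe1 : 1 ≤ ENNReal.ofReal p := by simpa using ENNReal.ofReal_le_ofReal hp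
  have hε3 : ε / 3 ≠ 0 := by simp [hε]
  obtain ⟨g, hgc, hfg, hg, hgp⟩ := hf.exists_hasCompactSupport_eLpNorm_sub_le
    ENNReal.ofReal_ne_top hε3
  set K := Metric.cthickening 1 (tsupport g)
  have hK : IsCompact K := hgc.isCompact.cthickening
  obtain ⟨η, hη, hηK⟩ : ∃ η : ℝ, 0 < η ∧
      (volume K) ^ (ENNReal.ofReal p).toReal⁻¹ * ENNReal.ofReal η ≤ ε / 3 := by
    have hfin : (volume K) ^ (ENNReal.ofReal p).toReal⁻¹ ≠ ∞ :=
      ENNReal.rpow_ne_top_of_nonneg (by positivity) hK.measure_lt_top.ne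
    have ht : Tendsto (fun η : ℝ => (volume K) ^ (ENNReal.ofReal p).toReal⁻¹ * ENNReal.ofReal η)
        (𝓝[>] 0) (𝓝 0) := by
      have := ENNReal.Tendsto.const_mul (a := (volume K) ^ (ENNReal.ofReal p).toReal⁻¹)
        (ENNReal.tendsto_ofReal (tendsto_id (x := 𝓝 (0 : ℝ)))) (Or.inr hfin)
      simp only [ENNReal.ofReal_zero, mul_zero, id] at this
      exact this.mono_left nhdsWithin_le_nhds
    obtain ⟨η, h1, h2⟩ := ((ht.eventually_le_const (pos_iff_ne_zero.2 hε3)).and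
      self_mem_nhdsWithin).exists
    exact ⟨η, h2, h1⟩
  obtain ⟨R, hR, hgR⟩ := exists_mollify_dist_le hg hgc hη
  refine ⟨min R 1, by positivity, fun ρ hρ => ?_⟩
  set T := fun h : E → F => ρ.normed volume ⋆[ContinuousLinearMap.lsmul ℝ ℝ, volume] h
  have hTg : eLpNorm (T g - g) (ENNReal.ofReal p) volume ≤ ε / 3 := by
    have hind : T g - g = K.indicator (T g - g) := by
      symm
      rw [indicator_eq_self]
      intro x hx
      by_contra hxK
      have h1 : x ∉ Function.support (T g) := fun h =>
        hxK (Metric.cthickening_mono (hρ.trans (min_le_right _ _)) _ (support_mollify_subset ρ g h))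
      have h2 : g x = 0 := image_eq_zero_of_notMem_tsupport fun h =>
        hxK (Metric.self_subset_cthickening _ h)
      rw [Function.notMem_support] at h1
      exact hx (by simp [h1, h2])
    rw [hind, eLpNorm_indicator_eq_eLpNorm_restrict hK.measurableSet]
    refine (eLpNorm_le_of_ae_bound (C := η) (ae_of_all _ fun x => ?_)).trans ?_
    · rw [Pi.sub_apply, ← dist_eq_norm]
      exact hgR ρ (hρ.trans (min_le_left _ _)) x
    · rwa [Measure.restrict_apply_univ]
  have hex : ∀ h : E → F, MemLp h (ENNReal.ofReal p) volume → ConvolutionExists (ρ.normed volume) h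
      (ContinuousLinearMap.lsmul ℝ ℝ) volume := fun h hh =>
    ρ.hasCompactSupport_normed.convolutionExists_left _ ρ.continuous_normed
      (hh.locallyIntegrable hpe1)
  have hdec : T f - f = T (f - g) + (T g - g) - (f - g) := by
    have : T f = T (f - g) + T g := by
      simp only [T]
      rw [← (hex _ (hf.sub hgp)).distrib_add (hex _ hgp), sub_add_cancel]
    rw [this]; abel
  have hm : ∀ h : E → F, MemLp h (ENNReal.ofReal p) volume → AEStronglyMeasurable (T h) volume :=
    fun h hh => (ρ.hasCompactSupport_normed.continuous_convolution_left _
      ρ.continuous_normed (hh.locallyIntegrable hpe1)).aestronglyMeasurable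
  rw [show (ρ.normed volume ⋆[ContinuousLinearMap.lsmul ℝ ℝ, volume] f) - f = T f - f from rfl, hdec]
  have h1 := hm _ (hf.sub hgp)
  have h2 := (hm _ hgp).sub hgp.1
  have h3 := (hf.sub hgp).1
  calc _ ≤ eLpNorm (T (f - g) + (T g - g)) (ENNReal.ofReal p) volume +
          eLpNorm (f - g) (ENNReal.ofReal p) volume := eLpNorm_sub_le (h1.add h2) h3 hpe1
    _ ≤ (eLpNorm (T (f - g)) (ENNReal.ofReal p) volume +
          eLpNorm (T g - g) (ENNReal.ofReal p) volume) + ε / 3 :=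
        add_le_add (eLpNorm_add_le h1 h2 hpe1) hfg
    _ ≤ (ε / 3 + ε / 3) + ε / 3 := by
        gcongr
        exact (eLpNorm_mollify_le hp ρ h3).trans hfg
    _ = ε := ENNReal.add_thirds ε

end Mollification

/-! ### Weak gradients -/

section WeakGradient

open scoped Convolution Topology ContDiff
open Filter

variable {N : ℕ} {Ω : Set (EuclideanSpace ℝ (Fin N))}

local notation "𝔼" => EuclideanSpace ℝ (Fin N)

lemma exists_testFunction_eq_one {K : Set 𝔼} (hΩ : IsOpen Ω) (hK : IsCompact K) (hKΩ : K ⊆ Ω) :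
    ∃ χ : 𝔼 → ℝ, IsTestFunction Ω χ ∧ (∀ x, 0 ≤ χ x ∧ χ x ≤ 1) ∧
      ∃ U, IsOpen U ∧ K ⊆ U ∧ ∀ x ∈ U, χ x = 1 := by
  obtain ⟨L, hL, hKL, hLΩ⟩ := exists_compact_between hK hΩ hKΩ
  obtain ⟨L', hL', hKL', hLL'⟩ := exists_compact_between hK isOpen_interior hKL
  obtain ⟨χ, h1, h2, h3, h4⟩ := exists_contMDiff_support_eq_eq_one_iff (n := ⊤)
    (modelWithCornersSelf ℝ 𝔼) isOpen_interior hL'.isClosed hLL'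
  have hts : tsupport χ ⊆ L := by
    rw [tsupport, h3]
    exact closure_minimal interior_subset hL.isClosed
  refine ⟨χ, ⟨h1.contDiff, hL.of_isClosed_subset (isClosed_tsupport _) hts, hts.trans hLΩ⟩,
    fun x => h2 (mem_range_self x), interior L', isOpen_interior, hKL', fun x hx => ?_⟩
  exact (h4 x).1 (interior_subset hx)

lemma IsTestFunction.continuous_fderiv {η : 𝔼 → ℝ} (hη : IsTestFunction Ω η) (v : 𝔼) :
    Continuous fun x => fderiv ℝ η x v :=
  (hη.1.continuous_fderiv (by simp)).clm_apply continuous_const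

lemma IsTestFunction.fderiv_eq_zero {η : 𝔼 → ℝ} {x : 𝔼} (hx : x ∉ tsupport η) :
    fderiv ℝ η x = 0 :=
  Function.notMem_support.1 fun h => hx (support_fderiv_subset ℝ h)

lemma IsTestFunction.mono {Ω' : Set 𝔼} {η : 𝔼 → ℝ} (hη : IsTestFunction Ω η) (h : Ω ⊆ Ω') :
    IsTestFunction Ω' η := ⟨hη.1, hη.2.1, hη.2.2.trans h⟩

lemma IsTestFunction.setIntegral_mul_fderiv {η : 𝔼 → ℝ} (hη : IsTestFunction Ω η) (f : 𝔼 → ℝ)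
    (v : 𝔼) : ∫ x in Ω, f x * fderiv ℝ η x v = ∫ x, f x * fderiv ℝ η x v := by
  refine setIntegral_eq_integral_of_forall_compl_eq_zero fun x hx => ?_
  rw [IsTestFunction.fderiv_eq_zero fun h => hx (hη.2.2 h)]; simp

lemma IsTestFunction.setIntegral_inner_mul {η : 𝔼 → ℝ} (hη : IsTestFunction Ω η) (G : 𝔼 → 𝔼)
    (v : 𝔼) : ∫ x in Ω, inner ℝ (G x) v * η x = ∫ x, inner ℝ (G x) v * η x := by
  refine setIntegral_eq_integral_of_forall_compl_eq_zero fun x hx => ?_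
  rw [image_eq_zero_of_notMem_tsupport fun h => hx (hη.2.2 h)]; simp

lemma HasWeakGradient.mono {Ω' : Set 𝔼} {f : 𝔼 → ℝ} {G : 𝔼 → 𝔼} (h : HasWeakGradient Ω f G)
    (hΩ' : Ω' ⊆ Ω) : HasWeakGradient Ω' f G := by
  refine ⟨h.1.mono_set hΩ', h.2.1.mono_set hΩ', fun η hη v => ?_⟩
  have := h.2.2 η (hη.mono hΩ') v
  rw [(hη.mono hΩ').setIntegral_mul_fderiv, (hη.mono hΩ').setIntegral_inner_mul] at this
  rw [hη.setIntegral_mul_fderiv, hη.setIntegral_inner_mul, this]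

/-- The product of a locally integrable function with a continuous function whose compact support
lies in the open set is integrable. -/
lemma integrable_smul_of_tsupport_subset {F : Type*} [NormedAddCommGroup F] [NormedSpace ℝ F]
    {G : 𝔼 → F} (hG : LocallyIntegrableOn G Ω) {η : 𝔼 → ℝ} (hη : Continuous η)
    (hηc : HasCompactSupport η) (hηΩ : tsupport η ⊆ Ω) : Integrable fun x => η x • G x := by
  have h1 : IntegrableOn G (tsupport η) := hG.integrableOn_compact_subset hηΩ hηc
  have h2 : IntegrableOn (fun x => η x • G x) (tsupport η) :=
    h1.continuousOn_smul hη.continuousOn hηc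
  refine (integrableOn_iff_integrable_of_support_subset fun x hx => ?_).1 h2
  by_contra h
  exact hx (by simp [image_eq_zero_of_notMem_tsupport h])

/-- Weak gradients are unique up to null sets. -/
lemma HasWeakGradient.ae_eq (hΩ : IsOpen Ω) {f : 𝔼 → ℝ} {G H : 𝔼 → 𝔼}
    (hG : HasWeakGradient Ω f G) (hH : HasWeakGradient Ω f H) :
    G =ᵐ[volume.restrict Ω] H := by
  have hkey : ∀ᵐ x ∂volume, x ∈ Ω → (G - H) x = 0 := by
    refine hΩ.ae_eq_zero_of_integral_contDiff_smul_eq_zero (hG.2.1.sub hH.2.1) fun η h1 h2 h3 => ?_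
    have hη : IsTestFunction Ω η := ⟨h1, h2, h3⟩
    have hGi := integrable_smul_of_tsupport_subset hG.2.1 h1.continuous h2 h3
    have hHi := integrable_smul_of_tsupport_subset hH.2.1 h1.continuous h2 h3
    have hi := integrable_smul_of_tsupport_subset (hG.2.1.sub hH.2.1) h1.continuous h2 h3
    refine ext_inner_left ℝ fun v => ?_
    rw [inner_zero_right, ← integral_inner hi]
    have e1 := hG.2.2 η hη v
    have e2 := hH.2.2 η hη v
    rw [e1, hη.setIntegral_inner_mul, hη.setIntegral_inner_mul, neg_inj] at e2
    have e3 : ∀ x, inner ℝ v (η x • (G - H) x) =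
        inner ℝ v (η x • G x) - inner ℝ v (η x • H x) := fun x => by
      rw [Pi.sub_apply, smul_sub, inner_sub_right]
    simp only [e3]
    rw [integral_sub (hGi.const_inner v) (hHi.const_inner v), sub_eq_zero]
    have e4 : ∀ (H : 𝔼 → 𝔼) x, inner ℝ v (η x • H x) = inner ℝ (H x) v * η x := fun H x => by
      rw [inner_smul_right, real_inner_comm, mul_comm]
    simpa only [e4] using e2
  rw [Filter.EventuallyEq, ae_restrict_iff' hΩ.measurableSet]
  filter_upwards [hkey] with x hx hxΩ using sub_eq_zero.1 (hx hxΩ)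

lemma hasWeakGradient_weakGradient {f : 𝔼 → ℝ} {G : 𝔼 → 𝔼} (h : HasWeakGradient Ω f G) :
    HasWeakGradient Ω f (weakGradient Ω f) := by
  have hex : ∃ G, HasWeakGradient Ω f G := ⟨G, h⟩
  rw [weakGradient, dif_pos hex]
  exact hex.choose_spec

lemma HasWeakGradient.weakGradient_ae_eq (hΩ : IsOpen Ω) {f : 𝔼 → ℝ} {G : 𝔼 → 𝔼}
    (h : HasWeakGradient Ω f G) : weakGradient Ω f =ᵐ[volume.restrict Ω] G :=
  (hasWeakGradient_weakGradient h).ae_eq hΩ h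

/-- The gradient of a mollification is the mollification of the weak gradient. -/
lemma HasWeakGradient.hasGradientAt_mollify {f : 𝔼 → ℝ} {G : 𝔼 → 𝔼}
    (h : HasWeakGradient univ f G) (ρ : ContDiffBump (0 : 𝔼)) (x : 𝔼) :
    HasGradientAt (ρ.normed volume ⋆[ContinuousLinearMap.lsmul ℝ ℝ, volume] f)
      ((ρ.normed volume ⋆[ContinuousLinearMap.lsmul ℝ ℝ, volume] G) x) x := by
  have hf : LocallyIntegrable f volume := locallyIntegrableOn_univ.1 h.1
  have hG : LocallyIntegrable G volume := locallyIntegrableOn_univ.1 h.2.1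
  have hd := ρ.hasCompactSupport_normed.hasFDerivAt_convolution_left
    (ContinuousLinearMap.lsmul ℝ ℝ) (μ := volume)
    (ρ.contDiff_normed (μ := volume) (n := 1)) hf x
  rw [hasGradientAt_iff_hasFDerivAt]
  refine hd.congr_fderiv ?_
  ext v
  set r : 𝔼 → ℝ := ρ.normed volume
  have hr1 : ContDiff ℝ ∞ r := ρ.contDiff_normed
  -- test the weak gradient with `t ↦ ρ (x - t)`
  set η : 𝔼 → ℝ := fun t => r (x - t) with hη
  have hηt : IsTestFunction univ η := by
    refine ⟨hr1.comp (contDiff_const.sub contDiff_id), ?_, subset_univ _⟩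
    exact ρ.hasCompactSupport_normed.comp_homeomorph (Homeomorph.subLeft x)
  have hηd : ∀ t, fderiv ℝ η t v = - fderiv ℝ r (x - t) v := by
    intro t
    have h1 : HasFDerivAt (fun t => x - t) (-(ContinuousLinearMap.id ℝ 𝔼)) t := by
      simpa using (hasFDerivAt_id t).const_sub x
    have h2 : HasFDerivAt r (fderiv ℝ r (x - t)) (x - t) :=
      (hr1.differentiable (by simp) (x - t)).hasFDerivAt
    have h3 : HasFDerivAt η _ t := h2.comp t h1
    rw [h3.fderiv]; simp
  have e1 := h.2.2 η hηt v
  rw [setIntegral_univ, setIntegral_univ] at e1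
  have hcont : Continuous (fderiv ℝ r) := hr1.continuous_fderiv (by simp)
  have hcs : HasCompactSupport (fderiv ℝ r) := ρ.hasCompactSupport_normed.fderiv ℝ
  have hex1 : ConvolutionExistsAt (fderiv ℝ r) f x
      ((ContinuousLinearMap.lsmul ℝ ℝ).precompL 𝔼) volume :=
    hcs.convolutionExists_left _ hcont hf x
  have hex2 : ConvolutionExistsAt r G x (ContinuousLinearMap.lsmul ℝ ℝ) volume :=
    ρ.hasCompactSupport_normed.convolutionExists_left _ ρ.continuous_normed hG x
  rw [convolution_eq_swap, ContinuousLinearMap.integral_apply hex1.integrable_swap,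
    InnerProductSpace.toDual_apply_apply, convolution_eq_swap, real_inner_comm,
    ← integral_inner hex2.integrable_swap]
  simp only [hηd] at e1
  have e2 : ∫ t, f t * -(fderiv ℝ r (x - t)) v = -∫ t, fderiv ℝ r (x - t) v * f t := by
    rw [← integral_neg]; congr 1; ext t; ring
  rw [e2, neg_inj] at e1
  have e3 : ∀ t, (((ContinuousLinearMap.lsmul ℝ ℝ).precompL 𝔼) (fderiv ℝ r (x - t)) (f t)) v =
      fderiv ℝ r (x - t) v * f t := fun t => by simp [ContinuousLinearMap.precompL_apply]
  have e4 : ∀ t, inner ℝ v ((ContinuousLinearMap.lsmul ℝ ℝ) (r (x - t)) (G t)) =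
      inner ℝ (G t) v * η t := fun t => by
    rw [ContinuousLinearMap.lsmul_apply, inner_smul_right, real_inner_comm, mul_comm]
  simpa only [e3, e4] using e1

/-- A continuous function with compact support and weak gradient in `L^p` is approximated by smooth
functions supported in a common compact set, uniformly and with gradients converging in `L^p`. -/
lemma HasWeakGradient.exists_smooth_approx {p : ℝ} (hp : 1 ≤ p) {f : 𝔼 → ℝ} {G : 𝔼 → 𝔼}
    (hf : Continuous f) (hfc : HasCompactSupport f) (hG : MemLp G (ENNReal.ofReal p) volume)
    (h : HasWeakGradient univ f G) {U : Set 𝔼} (hU : IsOpen U) (hfU : tsupport f ⊆ U) :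
    ∃ (F : ℕ → 𝔼 → ℝ) (K : Set 𝔼), IsCompact K ∧ K ⊆ U ∧ (∀ n, ContDiff ℝ ∞ (F n)) ∧
      (∀ n, tsupport (F n) ⊆ K) ∧ TendstoUniformly F f atTop ∧
      Tendsto (fun n => eLpNorm (fun x => gradient (F n) x - G x) (ENNReal.ofReal p) volume)
        atTop (𝓝 0) := by
  obtain ⟨d, hd, hdU⟩ := hfc.isCompact.exists_cthickening_subset_open hU hfU
  have hbump : ∀ n : ℕ, ∃ ρ : ContDiffBump (0 : 𝔼), ρ.rOut = d / (n + 1) := fun n =>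
    ⟨⟨d / (n + 1) / 2, d / (n + 1), by positivity, half_lt_self (by positivity)⟩, rfl⟩
  choose ρ hρ using hbump
  have hρd : ∀ n, (ρ n).rOut ≤ d := fun n => by
    rw [hρ]; exact div_le_self hd.le (by linarith [(Nat.cast_nonneg n : (0 : ℝ) ≤ n)])
  have hlim : Tendsto (fun n => (ρ n).rOut) atTop (𝓝 0) := by
    simp only [hρ]
    simpa [div_eq_mul_inv] using (tendsto_one_div_add_atTop_nhds_zero_nat (𝕜 := ℝ)).const_mul d
  set K := Metric.cthickening d (tsupport f)
  refine ⟨fun n => (ρ n).normed volume ⋆[ContinuousLinearMap.lsmul ℝ ℝ, volume] f, K,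
    hfc.isCompact.cthickening, hdU, fun n => ?_, fun n => ?_, ?_, ?_⟩
  · exact (ρ n).hasCompactSupport_normed.contDiff_convolution_left _ (ρ n).contDiff_normed
      hf.locallyIntegrable
  · exact closure_minimal ((support_mollify_subset _ _).trans (Metric.cthickening_mono (hρd n) _))
      Metric.isClosed_cthickening
  · rw [Metric.tendstoUniformly_iff]
    intro ε hε
    obtain ⟨R, hR, H⟩ := exists_mollify_dist_le hf hfc (half_pos hε)
    filter_upwards [hlim.eventually_le_const hR] with n hn x
    rw [dist_comm]
    exact (H (ρ n) hn x).trans_lt (half_lt_self hε)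
  · rw [ENNReal.tendsto_nhds_zero]
    intro ε hε
    obtain ⟨R, hR, H⟩ := exists_mollify_eLpNorm_sub_le hp hG hε.ne'
    filter_upwards [hlim.eventually_le_const hR] with n hn
    convert H (ρ n) hn using 2
    ext1 x
    rw [(h.hasGradientAt_mollify (ρ n) x).gradient, Pi.sub_apply]

end WeakGradient

/-! ### Localization and the chain rule for weak gradients -/

section ChainRule

open scoped Convolution Topology ContDiff
open Filter

variable {N : ℕ} {Ω : Set (EuclideanSpace ℝ (Fin N))}

local notation "𝔼" => EuclideanSpace ℝ (Fin N)

lemma continuous_gradient_of_contDiff {f : 𝔼 → ℝ} (hf : ContDiff ℝ ∞ f) :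
    Continuous (gradient f) :=
  (InnerProductSpace.toDual ℝ 𝔼).symm.continuous.comp (hf.continuous_fderiv (by simp))

lemma support_gradient_subset (f : 𝔼 → ℝ) : Function.support (gradient f) ⊆ tsupport f := by
  refine fun x hx => support_fderiv_subset ℝ (fun h => hx ?_)
  rw [gradient, h, map_zero]

lemma continuous_mul_of_tsupport_subset {F : Type*} [NormedAddCommGroup F] [NormedSpace ℝ F]
    (hΩ : IsOpen Ω) {c : 𝔼 → ℝ} {f : 𝔼 → F}
    (hc : ContinuousOn c Ω) (hf : Continuous f) (hfΩ : tsupport f ⊆ Ω) :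
    Continuous fun x => c x • f x := by
  rw [continuous_iff_continuousAt]
  intro x
  by_cases hx : x ∈ Ω
  · exact (hc.continuousAt (hΩ.mem_nhds hx)).smul hf.continuousAt
  · have hx' : x ∉ tsupport f := fun h => hx (hfΩ h)
    have : (fun x => c x • f x) =ᶠ[𝓝 x] fun _ => 0 := by
      filter_upwards [(isClosed_tsupport f).isOpen_compl.mem_nhds hx'] with y hy
      rw [image_eq_zero_of_notMem_tsupport hy, smul_zero]
    exact continuousAt_const.congr this.symm

/-- Multiplication by a test function `χ` turns a weak gradient in `Ω` into one in the whole
space. -/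
lemma HasWeakGradient.testFunction_mul {f : 𝔼 → ℝ} {G : 𝔼 → 𝔼} (h : HasWeakGradient Ω f G)
    {χ : 𝔼 → ℝ} (hχ : IsTestFunction Ω χ) :
    HasWeakGradient univ (fun x => χ x * f x) (fun x => χ x • G x + f x • gradient χ x) ∧
      Integrable (fun x => f x • gradient χ x) := by
  have h1 : Integrable (fun x => χ x • f x) :=
    integrable_smul_of_tsupport_subset h.1 hχ.1.continuous hχ.2.1 hχ.2.2
  have h2 : Integrable (fun x => χ x • G x) :=
    integrable_smul_of_tsupport_subset h.2.1 hχ.1.continuous hχ.2.1 hχ.2.2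
  have h3 : Integrable (fun x => f x • gradient χ x) := by
    have h1 : IntegrableOn f (tsupport χ) := h.1.integrableOn_compact_subset hχ.2.2 hχ.2.1
    have h2 : IntegrableOn (fun x => f x • gradient χ x) (tsupport χ) :=
      h1.smul_continuousOn (continuous_gradient_of_contDiff hχ.1).continuousOn hχ.2.1
    refine (integrableOn_iff_integrable_of_support_subset fun x hx => ?_).1 h2
    refine support_gradient_subset χ fun h => hx ?_
    simp [h]
  refine ⟨⟨h1.locallyIntegrable.locallyIntegrableOn _,
    (h2.add h3).locallyIntegrable.locallyIntegrableOn _, fun η hη v => ?_⟩, h3⟩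
  have hχη : IsTestFunction Ω (fun x => χ x * η x) := by
    refine ⟨hχ.1.mul hη.1, hχ.2.1.mul_right, ?_⟩
    exact (tsupport_mul_subset_left).trans hχ.2.2
  have e := h.2.2 _ hχη v
  rw [hχη.setIntegral_mul_fderiv, hχη.setIntegral_inner_mul] at e
  have hd : ∀ x, fderiv ℝ (fun x => χ x * η x) x v =
      χ x * fderiv ℝ η x v + η x * fderiv ℝ χ x v := by
    intro x
    rw [fderiv_fun_mul (hχ.1.differentiable (by simp) x) (hη.1.differentiable (by simp) x)]
    simp
  rw [setIntegral_univ, setIntegral_univ]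
  have hηb : ∃ C, ∀ x, ‖η x‖ ≤ C := hη.2.1.exists_bound_of_continuous hη.1.continuous
  have hηdb : ∃ C, ∀ x, ‖fderiv ℝ η x v‖ ≤ C := by
    refine HasCompactSupport.exists_bound_of_continuous ?_ (hη.continuous_fderiv v)
    exact hη.2.1.fderiv_apply ℝ v
  obtain ⟨C, hC⟩ := hηb
  obtain ⟨C', hC'⟩ := hηdb
  have i1 : Integrable fun x => (χ x • f x) * fderiv ℝ η x v :=
    h1.mul_bdd (hη.continuous_fderiv v).aestronglyMeasurable (ae_of_all _ hC')
  have i2 : Integrable fun x => inner ℝ (χ x • G x) v * η x :=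
    (h2.inner_const v).mul_bdd hη.1.continuous.aestronglyMeasurable (ae_of_all _ hC)
  have i3 : Integrable fun x => inner ℝ (f x • gradient χ x) v * η x :=
    (h3.inner_const v).mul_bdd hη.1.continuous.aestronglyMeasurable (ae_of_all _ hC)
  have e1 : ∫ x, f x * fderiv ℝ (fun x => χ x * η x) x v =
      (∫ x, (χ x • f x) * fderiv ℝ η x v) + ∫ x, inner ℝ (f x • gradient χ x) v * η x := by
    rw [← integral_add i1 i3]
    refine integral_congr_ae (ae_of_all _ fun x => ?_)
    simp only [hd, inner_smul_left, inner_gradient_left, smul_eq_mul, conj_trivial]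
    ring
  have e2 : ∫ x, inner ℝ (G x) v * (χ x * η x) = ∫ x, inner ℝ (χ x • G x) v * η x := by
    refine integral_congr_ae (ae_of_all _ fun x => ?_)
    simp only [inner_smul_left, conj_trivial]
    ring
  have e3 : ∫ x, inner ℝ (χ x • G x + f x • gradient χ x) v * η x =
      (∫ x, inner ℝ (χ x • G x) v * η x) + ∫ x, inner ℝ (f x • gradient χ x) v * η x := by
    rw [← integral_add i2 i3]
    refine integral_congr_ae (ae_of_all _ fun x => ?_)
    simp only [inner_add_left]
    ring
  rw [e1, e2] at e
  rw [e3]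
  simp only [smul_eq_mul] at e ⊢
  linarith

/-- Near a compact subset of `Ω`, a continuous function with a weak gradient in `Ω` is approximated
by smooth functions, uniformly and with gradients converging in `L^1`. -/
lemma HasWeakGradient.exists_local_smooth_approx (hΩ : IsOpen Ω) {f : 𝔼 → ℝ} {G : 𝔼 → 𝔼}
    (h : HasWeakGradient Ω f G) (hf : ContinuousOn f Ω) {K : Set 𝔼} (hK : IsCompact K)
    (hKΩ : K ⊆ Ω) :
    ∃ F : ℕ → 𝔼 → ℝ, (∀ n, ContDiff ℝ ∞ (F n)) ∧ TendstoUniformlyOn F f atTop K ∧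
      Tendsto (fun n => eLpNorm (fun x => gradient (F n) x - G x) 1 (volume.restrict K))
        atTop (𝓝 0) := by
  obtain ⟨χ, hχ, -, U, hU, hKU, hχU⟩ := exists_testFunction_eq_one hΩ hK hKΩ
  obtain ⟨hw, hi⟩ := h.testFunction_mul hχ
  have hχG : Integrable (fun x => χ x • G x) :=
    integrable_smul_of_tsupport_subset h.2.1 hχ.1.continuous hχ.2.1 hχ.2.2
  have hc : Continuous fun x => χ x * f x := by
    have := continuous_mul_of_tsupport_subset hΩ hf hχ.1.continuous hχ.2.2
    simpa only [smul_eq_mul, mul_comm] using this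
  obtain ⟨F, -, -, -, hF1, -, hF3, hF4⟩ := hw.exists_smooth_approx le_rfl hc hχ.2.1.mul_right
    (by rw [ENNReal.ofReal_one, memLp_one_iff_integrable]; exact hχG.add hi) isOpen_univ
    (subset_univ _)
  refine ⟨F, hF1, ?_, ?_⟩
  · refine (hF3.tendstoUniformlyOn (s := K)).congr_right fun x hx => ?_
    simp [hχU x (hKU hx)]
  · rw [ENNReal.ofReal_one] at hF4
    refine tendsto_of_tendsto_of_tendsto_of_le_of_le tendsto_const_nhds hF4
      (fun _ => zero_le) fun n => ?_
    refine le_trans (le_of_eq (eLpNorm_congr_ae ?_)) (eLpNorm_mono_measure _ Measure.restrict_le_self)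
    filter_upwards [ae_restrict_mem hK.measurableSet] with x hx
    have h1 : gradient χ x = 0 := by
      have : χ =ᶠ[𝓝 x] fun _ => 1 := by
        filter_upwards [hU.mem_nhds (hKU hx)] with y hy using hχU y hy
      rw [this.gradient_eq, gradient_fun_const]
    rw [h1, hχU x (hKU hx)]; simp

lemma tendsto_integral_mul_of_tendsto_eLpNorm {α : Type*} [MeasurableSpace α] {μ : Measure α}
    {c : ℕ → α → ℝ} {c₀ : α → ℝ} {g : ℕ → α → ℝ} {g₀ : α → ℝ} {C : ℝ}
    (hc : ∀ᶠ n in atTop, AEStronglyMeasurable (c n) μ)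
    (hC : ∀ᶠ n in atTop, ∀ᵐ x ∂μ, ‖c n x‖ ≤ C)
    (hc₀ : ∀ᵐ x ∂μ, Tendsto (fun n => c n x) atTop (𝓝 (c₀ x)))
    (hg : ∀ n, Integrable (g n) μ) (hg₀ : Integrable g₀ μ)
    (hgl : Tendsto (fun n => eLpNorm (fun x => g n x - g₀ x) 1 μ) atTop (𝓝 0)) :
    Tendsto (fun n => ∫ x, c n x * g n x ∂μ) atTop (𝓝 (∫ x, c₀ x * g₀ x ∂μ)) := by
  have h1 : Tendsto (fun n => ∫ x, c n x * g₀ x ∂μ) atTop (𝓝 (∫ x, c₀ x * g₀ x ∂μ)) := by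
    refine tendsto_integral_filter_of_dominated_convergence (fun x => C * ‖g₀ x‖) ?_ ?_
      (hg₀.norm.const_mul C) ?_
    · filter_upwards [hc] with n hn using hn.mul hg₀.1
    · filter_upwards [hC] with n hn
      filter_upwards [hn] with x hx
      rw [norm_mul]
      exact mul_le_mul_of_nonneg_right hx (norm_nonneg _)
    · filter_upwards [hc₀] with x hx using hx.mul_const _
  have h2 : Tendsto (fun n => ∫ x, c n x * (g n x - g₀ x) ∂μ) atTop (𝓝 0) := by
    have hl : Tendsto (fun n => C * (eLpNorm (fun x => g n x - g₀ x) 1 μ).toReal) atTop (𝓝 0) := by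
      have := (ENNReal.tendsto_toReal ENNReal.zero_ne_top).comp hgl
      simpa using this.const_mul C
    refine squeeze_zero_norm' ?_ hl
    filter_upwards [hC] with n hn
    have hi : Integrable (fun x => g n x - g₀ x) μ := (hg n).sub hg₀
    have e : (eLpNorm (fun x => g n x - g₀ x) 1 μ).toReal = ∫ x, ‖g n x - g₀ x‖ ∂μ := by
      rw [eLpNorm_one_eq_lintegral_enorm, integral_norm_eq_lintegral_enorm hi.1]
    rw [e, ← integral_const_mul]
    refine norm_integral_le_of_norm_le (hi.norm.const_mul C) ?_
    filter_upwards [hn] with x hx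
    rw [norm_mul]
    exact mul_le_mul_of_nonneg_right hx (norm_nonneg _)
  have h3 := h1.add h2
  rw [add_zero] at h3
  refine h3.congr' ?_
  filter_upwards [hc, hC] with n hn hCn
  have i1 : Integrable (fun x => c n x * g₀ x) μ := hg₀.bdd_mul hn hCn
  have i2 : Integrable (fun x => c n x * (g n x - g₀ x)) μ := ((hg n).sub hg₀).bdd_mul hn hCn
  rw [← integral_add i1 i2]
  exact integral_congr_ae (ae_of_all _ fun x => by ring)

lemma eLpNorm_inner_const_tendsto_zero {α : Type*} [MeasurableSpace α] {μ : Measure α}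
    {H : ℕ → α → 𝔼} (h : Tendsto (fun n => eLpNorm (H n) 1 μ) atTop (𝓝 0)) (v : 𝔼) :
    Tendsto (fun n => eLpNorm (fun x => inner ℝ (H n x) v) 1 μ) atTop (𝓝 0) := by
  have h2 : Tendsto (fun n => ENNReal.ofReal ‖v‖ * eLpNorm (H n) 1 μ) atTop (𝓝 0) := by
    simpa using ENNReal.Tendsto.const_mul h (Or.inr (ENNReal.ofReal_ne_top (r := ‖v‖)))
  refine tendsto_of_tendsto_of_tendsto_of_le_of_le tendsto_const_nhds h2 (fun _ => zero_le)
    fun n => ?_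
  refine eLpNorm_le_mul_eLpNorm_of_ae_le_mul (ae_of_all _ fun x => ?_) 1
  rw [mul_comm]
  exact norm_inner_le_norm _ _

/-- The chain rule for `F (f, u)`, where `f` and `u > 0` are continuous with weak gradients and `F`
is continuously differentiable on `ℝ × (0, ∞)` with partial derivatives `F₁`, `F₂`. -/
lemma HasWeakGradient.comp₂ (hΩ : IsOpen Ω) {f u : 𝔼 → ℝ} {G H : 𝔼 → 𝔼}
    (hG : HasWeakGradient Ω f G) (hH : HasWeakGradient Ω u H) (hf : ContinuousOn f Ω)
    (hu : ContinuousOn u Ω) (hupos : ∀ x ∈ Ω, 0 < u x) {F F₁ F₂ : ℝ × ℝ → ℝ}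
    (hF : ∀ z : ℝ × ℝ, 0 < z.2 → HasFDerivAt F (F₁ z • ContinuousLinearMap.fst ℝ ℝ ℝ +
      F₂ z • ContinuousLinearMap.snd ℝ ℝ ℝ) z)
    (hF₁ : ContinuousOn F₁ {z | 0 < z.2}) (hF₂ : ContinuousOn F₂ {z | 0 < z.2}) :
    HasWeakGradient Ω (fun x => F (f x, u x))
      (fun x => F₁ (f x, u x) • G x + F₂ (f x, u x) • H x) := by
  have hFc : ContinuousOn F {z | 0 < z.2} := fun z hz => (hF z hz).continuousAt.continuousWithinAt
  have hO : IsOpen {z : ℝ × ℝ | 0 < z.2} := isOpen_lt continuous_const continuous_snd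
  have hmaps : MapsTo (fun x => (f x, u x)) Ω {z | 0 < z.2} := fun x hx => hupos x hx
  have hc0 : ContinuousOn (fun x => F (f x, u x)) Ω := hFc.comp (hf.prodMk hu) hmaps
  have hc1 : ContinuousOn (fun x => F₁ (f x, u x)) Ω := hF₁.comp (hf.prodMk hu) hmaps
  have hc2 : ContinuousOn (fun x => F₂ (f x, u x)) Ω := hF₂.comp (hf.prodMk hu) hmaps
  refine ⟨hc0.locallyIntegrableOn hΩ.measurableSet,
    (hG.2.1.continuousOn_smul hΩ.isLocallyClosed hc1).add
      (hH.2.1.continuousOn_smul hΩ.isLocallyClosed hc2), fun η hη v => ?_⟩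
  set K := tsupport η with hKdef
  have hK : IsCompact K := hη.2.1
  have hKΩ : K ⊆ Ω := hη.2.2
  obtain ⟨f', hf'1, hf'2, hf'3⟩ := hG.exists_local_smooth_approx hΩ hf hK hKΩ
  obtain ⟨u', hu'1, hu'2, hu'3⟩ := hH.exists_local_smooth_approx hΩ hu hK hKΩ
  -- the values of `(f, u)` and of its approximations on `K` lie in a fixed compact box
  obtain ⟨m, hm, hmu⟩ : ∃ m > 0, ∀ x ∈ K, m ≤ u x := by
    rcases K.eq_empty_or_nonempty with h | h
    · exact ⟨1, one_pos, by simp [h]⟩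
    · obtain ⟨x₀, hx₀, hmin⟩ := hK.exists_isMinOn h (hu.mono hKΩ)
      exact ⟨u x₀, hupos x₀ (hKΩ hx₀), fun x hx => hmin hx⟩
  obtain ⟨Cf, hCf⟩ := hK.exists_bound_of_continuousOn (hf.mono hKΩ)
  obtain ⟨Cu, hCu⟩ := hK.exists_bound_of_continuousOn (hu.mono hKΩ)
  set B : Set (ℝ × ℝ) := Icc (-(Cf + 1)) (Cf + 1) ×ˢ Icc (m / 2) (Cu + m / 2) with hBdef
  have hB : IsCompact B := isCompact_Icc.prod isCompact_Icc
  have hBO : B ⊆ {z | 0 < z.2} := fun z hz => lt_of_lt_of_le (half_pos hm) hz.2.1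
  have hev : ∀ᶠ n in atTop, ∀ x ∈ K, (f' n x, u' n x) ∈ B := by
    filter_upwards [Metric.tendstoUniformlyOn_iff.1 hf'2 1 one_pos,
      Metric.tendstoUniformlyOn_iff.1 hu'2 (m / 2) (half_pos hm)] with n h1 h2 x hx
    have h3 := abs_lt.1 (h1 x hx)
    have h4 := abs_lt.1 (h2 x hx)
    have h5 := abs_le.1 (hCf x hx)
    have h6 := abs_le.1 (hCu x hx)
    have h7 := hmu x hx
    refine ⟨⟨?_, ?_⟩, ?_, ?_⟩ <;> simp only <;> linarith
  have hlim : ∀ x ∈ K, Tendsto (fun n => (f' n x, u' n x)) atTop (𝓝 (f x, u x)) := fun x hx =>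
    (hf'2.tendsto_at hx).prodMk_nhds (hu'2.tendsto_at hx)
  -- convergence of the coefficients
  have hcoef : ∀ Φ : ℝ × ℝ → ℝ, ContinuousOn Φ {z | 0 < z.2} →
      (∀ᶠ n in atTop, ContinuousOn (fun x => Φ (f' n x, u' n x)) K) ∧
      (∃ C, ∀ᶠ n in atTop, ∀ x ∈ K, ‖Φ (f' n x, u' n x)‖ ≤ C) ∧
      ∀ x ∈ K, Tendsto (fun n => Φ (f' n x, u' n x)) atTop (𝓝 (Φ (f x, u x))) := by
    intro Φ hΦ
    refine ⟨?_, ?_, fun x hx => ?_⟩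
    · filter_upwards [hev] with n hn
      exact hΦ.comp ((hf'1 n).continuous.prodMk (hu'1 n).continuous).continuousOn
        fun x hx => hBO (hn x hx)
    · obtain ⟨C, hC⟩ := hB.exists_bound_of_continuousOn (hΦ.mono hBO)
      exact ⟨C, by filter_upwards [hev] with n hn x hx using hC _ (hn x hx)⟩
    · exact (hΦ.continuousAt (hO.mem_nhds (hupos x (hKΩ hx)))).tendsto.comp (hlim x hx)
  -- integrals of products with functions supported in `K`
  have hsupp : ∀ g : 𝔼 → ℝ, Function.support g ⊆ K → ∫ x, g x = ∫ x in K, g x := fun g hg =>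
    (setIntegral_eq_integral_of_forall_compl_eq_zero fun x hx => by
      by_contra h; exact hx (hg h)).symm
  have hconv : ∀ (Φ : ℝ × ℝ → ℝ) (g : ℕ → 𝔼 → ℝ) (g₀ : 𝔼 → ℝ), ContinuousOn Φ {z | 0 < z.2} →
      (∀ n, Continuous (g n)) → IntegrableOn g₀ K →
      Tendsto (fun n => eLpNorm (fun x => g n x - g₀ x) 1 (volume.restrict K)) atTop (𝓝 0) →
      Tendsto (fun n => ∫ x in K, Φ (f' n x, u' n x) * η x * g n x) atTop
        (𝓝 (∫ x in K, Φ (f x, u x) * η x * g₀ x)) := by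
    intro Φ g g₀ hΦ hg hg₀ hgl
    obtain ⟨h1, ⟨C, hC⟩, h3⟩ := hcoef Φ hΦ
    obtain ⟨Cη, hCη⟩ := hη.2.1.exists_bound_of_continuous hη.1.continuous
    refine tendsto_integral_mul_of_tendsto_eLpNorm (C := C * Cη) ?_ ?_ ?_ (fun n => ?_) hg₀ hgl
    · filter_upwards [h1] with n hn
      exact (hn.mul hη.1.continuous.continuousOn).aestronglyMeasurable hK.measurableSet
    · filter_upwards [hC] with n hn
      filter_upwards [ae_restrict_mem hK.measurableSet] with x hx
      rw [norm_mul]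
      exact mul_le_mul (hn x hx) (hCη x) (norm_nonneg _) ((norm_nonneg _).trans (hn x hx))
    · filter_upwards [ae_restrict_mem hK.measurableSet] with x hx using (h3 x hx).mul_const _
    · exact (hg n).continuousOn.integrableOn_compact hK
  have hconv0 : Tendsto (fun n => ∫ x in K, F (f' n x, u' n x) * fderiv ℝ η x v) atTop
      (𝓝 (∫ x in K, F (f x, u x) * fderiv ℝ η x v)) := by
    obtain ⟨h1, ⟨C, hC⟩, h3⟩ := hcoef F hFc
    have hi : IntegrableOn (fun x => fderiv ℝ η x v) K :=
      (hη.continuous_fderiv v).continuousOn.integrableOn_compact hK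
    refine tendsto_integral_mul_of_tendsto_eLpNorm (C := C) ?_ ?_ ?_ (fun _ => hi) hi (by simp)
    · filter_upwards [h1] with n hn using hn.aestronglyMeasurable hK.measurableSet
    · filter_upwards [hC] with n hn
      filter_upwards [ae_restrict_mem hK.measurableSet] with x hx using hn x hx
    · filter_upwards [ae_restrict_mem hK.measurableSet] with x hx using h3 x hx
  have hGi : IntegrableOn (fun x => inner ℝ (G x) v) K :=
    (hG.2.1.integrableOn_compact_subset hKΩ hK).inner_const v
  have hHi : IntegrableOn (fun x => inner ℝ (H x) v) K :=
    (hH.2.1.integrableOn_compact_subset hKΩ hK).inner_const v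
  have hl1 := hconv F₁ (fun n x => inner ℝ (gradient (f' n) x) v) _ hF₁
    (fun n => (continuous_gradient_of_contDiff (hf'1 n)).inner continuous_const) hGi
    (by simpa only [inner_sub_left] using eLpNorm_inner_const_tendsto_zero hf'3 v)
  have hl2 := hconv F₂ (fun n x => inner ℝ (gradient (u' n) x) v) _ hF₂
    (fun n => (continuous_gradient_of_contDiff (hu'1 n)).inner continuous_const) hHi
    (by simpa only [inner_sub_left] using eLpNorm_inner_const_tendsto_zero hu'3 v)
  -- integration by parts for the approximations
  have hibp : ∀ᶠ n in atTop, ∫ x in K, F (f' n x, u' n x) * fderiv ℝ η x v =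
      -((∫ x in K, F₁ (f' n x, u' n x) * η x * inner ℝ (gradient (f' n) x) v) +
        ∫ x in K, F₂ (f' n x, u' n x) * η x * inner ℝ (gradient (u' n) x) v) := by
    filter_upwards [hev, (hcoef F hFc).1, (hcoef F₁ hF₁).1, (hcoef F₂ hF₂).1] with n hn c0 c1 c2
    have hgf := continuous_gradient_of_contDiff (hf'1 n)
    have hgu := continuous_gradient_of_contDiff (hu'1 n)
    have i1 : IntegrableOn (fun x => F₁ (f' n x, u' n x) * η x * inner ℝ (gradient (f' n) x) v) K :=
      ((c1.mul hη.1.continuous.continuousOn).mul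
        (hgf.inner continuous_const).continuousOn).integrableOn_compact hK
    have i2 : IntegrableOn (fun x => F₂ (f' n x, u' n x) * η x * inner ℝ (gradient (u' n) x) v) K :=
      ((c2.mul hη.1.continuous.continuousOn).mul
        (hgu.inner continuous_const).continuousOn).integrableOn_compact hK
    set f'' : 𝔼 → (𝔼 →L[ℝ] ℝ) := fun x =>
      F₁ (f' n x, u' n x) • fderiv ℝ (f' n) x + F₂ (f' n x, u' n x) • fderiv ℝ (u' n) x
    have hpt : ∀ x, f'' x v * η x = F₁ (f' n x, u' n x) * η x * inner ℝ (gradient (f' n) x) v +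
        F₂ (f' n x, u' n x) * η x * inner ℝ (gradient (u' n) x) v := fun x => by
      simp only [f'', inner_gradient_left, add_apply,
        smul_apply, smul_eq_mul]
      ring
    have hs1 : Function.support (fun x => f'' x v * η x) ⊆ K := fun x hx => by
      refine subset_tsupport η fun h => hx ?_
      simp [h]
    have hs2 : Function.support (fun x => F (f' n x, u' n x) * fderiv ℝ η x v) ⊆ K :=
      fun x hx => by
        by_contra h
        exact hx (by simp [IsTestFunction.fderiv_eq_zero h])
    have hs3 : Function.support (fun x => F (f' n x, u' n x) * η x) ⊆ K := fun x hx => by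
      refine subset_tsupport η fun h => hx ?_
      simp [h]
    have := integral_bilinear_hasFDerivAt_right_eq_neg_left_of_integrable (μ := volume)
      (f := fun x => F (f' n x, u' n x)) (f' := f'') (g := η) (g' := fderiv ℝ η) (v := v)
      (B := ContinuousLinearMap.mul ℝ ℝ) ?_ ?_ ?_ ?_ ?_
    · simp only [ContinuousLinearMap.mul_apply'] at this
      rw [hsupp _ hs1, hsupp _ hs2] at this
      rw [this, ← integral_add i1 i2]
      simp only [hpt]
    · simp only [ContinuousLinearMap.mul_apply']
      refine (integrableOn_iff_integrable_of_support_subset hs1).1 ?_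
      simp only [hpt]
      exact i1.add i2
    · simp only [ContinuousLinearMap.mul_apply']
      exact (integrableOn_iff_integrable_of_support_subset hs2).1
        ((c0.mul (hη.continuous_fderiv v).continuousOn).integrableOn_compact hK)
    · simp only [ContinuousLinearMap.mul_apply']
      exact (integrableOn_iff_integrable_of_support_subset hs3).1
        ((c0.mul hη.1.continuous.continuousOn).integrableOn_compact hK)
    · intro x hx
      have hd := (hF (f' n x, u' n x) (hBO (hn x hx))).comp x
        (((hf'1 n).differentiable (by simp) x).hasFDerivAt.prodMk
          ((hu'1 n).differentiable (by simp) x).hasFDerivAt)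
      refine hd.congr_fderiv ?_
      ext w
      simp [f'']
    · intro x _
      exact (hη.1.differentiable (by simp) x).hasFDerivAt
  have hfin := tendsto_nhds_unique (hconv0.congr' hibp) (hl1.add hl2).neg
  have i1 : IntegrableOn (fun x => F₁ (f x, u x) * η x * inner ℝ (G x) v) K :=
    hGi.continuousOn_mul ((hc1.mono hKΩ).mul hη.1.continuous.continuousOn) hK
  have i2 : IntegrableOn (fun x => F₂ (f x, u x) * η x * inner ℝ (H x) v) K :=
    hHi.continuousOn_mul ((hc2.mono hKΩ).mul hη.1.continuous.continuousOn) hK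
  rw [hη.setIntegral_mul_fderiv, hη.setIntegral_inner_mul, hsupp _ fun x hx => ?_,
    hsupp (fun x => inner ℝ (F₁ (f x, u x) • G x + F₂ (f x, u x) • H x) v * η x) fun x hx => ?_,
    hfin, ← integral_add i1 i2]
  · congr 1
    refine integral_congr_ae (ae_of_all _ fun x => ?_)
    simp only [inner_add_left, inner_smul_left, conj_trivial]
    ring
  · refine subset_tsupport η fun h => hx ?_
    simp [h]
  · by_contra h
    exact hx (by simp [IsTestFunction.fderiv_eq_zero h])

end ChainRule

/-! ### The space `W^{1,p}(Ω) ∩ C_c(Ω)` -/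

section TestSpace

open scoped Topology ContDiff
open Filter

variable {N : ℕ} {Ω : Set (EuclideanSpace ℝ (Fin N))} {p : ℝ}

local notation "𝔼" => EuclideanSpace ℝ (Fin N)

/-- A property that holds almost everywhere on each compact subset of an open set holds almost
everywhere on that set. -/
lemma ae_restrict_of_forall_isCompact (hΩ : IsOpen Ω) {P : 𝔼 → Prop}
    (h : ∀ K, IsCompact K → K ⊆ Ω → ∀ᵐ x ∂volume.restrict K, P x) :
    ∀ᵐ x ∂volume.restrict Ω, P x := by
  rw [ae_restrict_iff' hΩ.measurableSet, ae_iff]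
  refine measure_null_of_locally_null _ fun x hx => ?_
  have hxΩ : x ∈ Ω := by
    by_contra hx'
    exact hx fun h => absurd h hx'
  obtain ⟨r, hr, hrΩ⟩ := Metric.nhds_basis_closedBall.mem_iff.1 (hΩ.mem_nhds hxΩ)
  have h1 := h _ (isCompact_closedBall x r) hrΩ
  rw [ae_restrict_iff' measurableSet_closedBall, ae_iff] at h1
  refine ⟨_, inter_mem_nhdsWithin _ (Metric.closedBall_mem_nhds x hr), measure_mono_null ?_ h1⟩
  rintro y ⟨hy1, hy2⟩ hy
  exact hy1 fun _ => hy hy2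

lemma HasWeakGradient.ae_eq_zero_of_notMem_tsupport (hΩ : IsOpen Ω) {f : 𝔼 → ℝ} {G : 𝔼 → 𝔼}
    (h : HasWeakGradient Ω f G) : ∀ᵐ x ∂volume.restrict Ω, x ∉ tsupport f → G x = 0 := by
  have hO : IsOpen (Ω \ tsupport f) := hΩ.sdiff (isClosed_tsupport f)
  have h0 : HasWeakGradient (Ω \ tsupport f) f 0 := by
    refine ⟨h.1.mono_set sdiff_subset, ?_, fun η _ v => ?_⟩
    · exact (locallyIntegrable_zero).locallyIntegrableOn _
    · rw [setIntegral_eq_zero_of_forall_eq_zero fun x hx => ?_]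
      · simp
      · rw [image_eq_zero_of_notMem_tsupport hx.2, zero_mul]
  have := (h.mono sdiff_subset).ae_eq hO h0
  rw [Filter.EventuallyEq, ae_restrict_iff' hO.measurableSet] at this
  rw [ae_restrict_iff' hΩ.measurableSet]
  filter_upwards [this] with x hx hxΩ hxf using hx ⟨hxΩ, hxf⟩

lemma hasWeakGradient_of_mem_testSpace {φ : 𝔼 → ℝ} (hφ : φ ∈ testSpace p Ω) :
    HasWeakGradient Ω φ (weakGradient Ω φ) := by
  obtain ⟨⟨-, G, hG, -⟩, -⟩ := hφ
  exact hasWeakGradient_weakGradient hG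

lemma memLp_weakGradient_of_mem_testSpace (hΩ : IsOpen Ω) {φ : 𝔼 → ℝ} (hφ : φ ∈ testSpace p Ω) :
    MemLp (weakGradient Ω φ) (ENNReal.ofReal p) (volume.restrict Ω) := by
  obtain ⟨⟨-, G, hG, hGp⟩, -⟩ := hφ
  exact hGp.ae_eq (hG.weakGradient_ae_eq hΩ).symm

lemma MemLp.continuousOn_smul {F : Type*} [NormedAddCommGroup F] [NormedSpace ℝ F] {q : ℝ≥0∞}
    {c : 𝔼 → ℝ} {G : 𝔼 → F} {K : Set 𝔼} (hK : IsCompact K) (hc : ContinuousOn c K)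
    (hG : MemLp G q (volume.restrict K)) : MemLp (fun x => c x • G x) q (volume.restrict K) := by
  obtain ⟨C, hC⟩ := hK.exists_bound_of_continuousOn hc
  refine hG.of_le_mul (c := C) ((hc.aestronglyMeasurable hK.measurableSet).smul hG.1) ?_
  filter_upwards [ae_restrict_mem hK.measurableSet] with x hx
  rw [norm_smul]
  exact mul_le_mul_of_nonneg_right (hC x hx) (norm_nonneg _)

/-- A vector field in `L^p(K)`, for `K ⊆ Ω` compact, that vanishes in `Ω \ K` lies in `L^p(Ω)`. -/
lemma memLp_restrict_of_ae_eq_zero {q : ℝ≥0∞} {G : 𝔼 → 𝔼} {K : Set 𝔼}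
    (hK : IsCompact K) (hKΩ : K ⊆ Ω) (hG : MemLp G q (volume.restrict K))
    (h0 : ∀ᵐ x ∂volume.restrict Ω, x ∉ K → G x = 0) : MemLp G q (volume.restrict Ω) := by
  have h1 : MemLp (K.indicator G) q (volume.restrict Ω) := by
    rw [memLp_indicator_iff_restrict hK.measurableSet, Measure.restrict_restrict hK.measurableSet,
      inter_eq_self_of_subset_left hKΩ]
    exact hG
  refine h1.ae_eq ?_
  filter_upwards [h0] with x hx
  by_cases h : x ∈ K
  · simp [h]
  · simp [h, hx h]

/-- An element of `W^{1,p}(Ω) ∩ C_c(Ω)` has a weak gradient in the whole space. -/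
lemma exists_hasWeakGradient_univ (hΩ : IsOpen Ω) {φ : 𝔼 → ℝ} (hφ : φ ∈ testSpace p Ω) :
    ∃ G, HasWeakGradient univ φ G ∧ MemLp G (ENNReal.ofReal p) volume ∧
      G =ᵐ[volume.restrict Ω] weakGradient Ω φ := by
  obtain ⟨χ, hχ, -, U, hU, hKU, hχU⟩ := exists_testFunction_eq_one hΩ hφ.2.2.1 hφ.2.2.2
  have h := hasWeakGradient_of_mem_testSpace hφ
  have e : (fun x => χ x * φ x) = φ := by
    ext x
    by_cases hx : x ∈ tsupport φ
    · rw [hχU x (hKU hx), one_mul]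
    · rw [image_eq_zero_of_notMem_tsupport hx, mul_zero]
  have h1 := (h.testFunction_mul hχ).1
  rw [e] at h1
  set G := fun x => χ x • weakGradient Ω φ x + φ x • gradient χ x
  have h2 : G =ᵐ[volume.restrict Ω] weakGradient Ω φ := (h1.mono (subset_univ Ω)).ae_eq hΩ h
  refine ⟨G, h1, ?_, h2⟩
  have h3 := h1.ae_eq_zero_of_notMem_tsupport isOpen_univ
  have h4 := memLp_restrict_of_ae_eq_zero (G := G) (q := ENNReal.ofReal p) hφ.2.2.1
    (subset_univ _) ?_ h3
  · rwa [Measure.restrict_univ] at h4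
  · exact (memLp_weakGradient_of_mem_testSpace hΩ hφ |>.ae_eq h2.symm).mono_measure
      (Measure.restrict_mono hφ.2.2.2 le_rfl)

lemma mem_testSpace_of_isTestFunction (hΩ : IsOpen Ω) {η : 𝔼 → ℝ} (hη : IsTestFunction Ω η) :
    η ∈ testSpace p Ω ∧ weakGradient Ω η =ᵐ[volume.restrict Ω] gradient η := by
  have hg : HasCompactSupport (gradient η) := by
    refine HasCompactSupport.intro hη.2.1 fun x hx => ?_
    by_contra h
    exact hx (support_gradient_subset η h)
  have hgc := continuous_gradient_of_contDiff hη.1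
  have hw : HasWeakGradient Ω η (gradient η) := by
    refine ⟨hη.1.continuous.locallyIntegrable.locallyIntegrableOn _,
      hgc.locallyIntegrable.locallyIntegrableOn _, fun ζ hζ v => ?_⟩
    rw [hζ.setIntegral_mul_fderiv, hζ.setIntegral_inner_mul]
    simp only [inner_gradient_left]
    refine integral_mul_fderiv_eq_neg_fderiv_mul_of_integrable ?_ ?_ ?_
      (fun x _ => hη.1.differentiable (by simp) x) (fun x _ => hζ.1.differentiable (by simp) x)
    · exact ((hη.continuous_fderiv v).mul hζ.1.continuous).integrable_of_hasCompactSupport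
        hζ.2.1.mul_left
    · exact (hη.1.continuous.mul (hζ.continuous_fderiv v)).integrable_of_hasCompactSupport
        hη.2.1.mul_right
    · exact (hη.1.continuous.mul hζ.1.continuous).integrable_of_hasCompactSupport hη.2.1.mul_right
  exact ⟨⟨⟨(hη.1.continuous.memLp_of_hasCompactSupport hη.2.1).mono_measure
      Measure.restrict_le_self, gradient η, hw,
    (hgc.memLp_of_hasCompactSupport hg).mono_measure Measure.restrict_le_self⟩,
    hη.1.continuous, hη.2.1, hη.2.2⟩, hw.weakGradient_ae_eq hΩ⟩

/-- Compositions `F (φ, u)` of a test function `φ` with a positive continuous function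
`u ∈ W^{1,p}_loc(Ω)`, where `F` vanishes on `{0} × ℝ`. -/
lemma comp₂_mem_testSpace (hΩ : IsOpen Ω) {φ u : 𝔼 → ℝ} (hφ : φ ∈ testSpace p Ω)
    (hu1 : MemW1Loc p Ω u) (hu2 : ContinuousOn u Ω) (hu3 : ∀ x ∈ Ω, 0 < u x)
    {F F₁ F₂ : ℝ × ℝ → ℝ} (hF0 : ∀ t, F (0, t) = 0)
    (hF : ∀ z : ℝ × ℝ, 0 < z.2 → HasFDerivAt F (F₁ z • ContinuousLinearMap.fst ℝ ℝ ℝ +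
      F₂ z • ContinuousLinearMap.snd ℝ ℝ ℝ) z)
    (hF₁ : ContinuousOn F₁ {z | 0 < z.2}) (hF₂ : ContinuousOn F₂ {z | 0 < z.2}) :
    (fun x => F (φ x, u x)) ∈ testSpace p Ω ∧
      weakGradient Ω (fun x => F (φ x, u x)) =ᵐ[volume.restrict Ω] fun x =>
        F₁ (φ x, u x) • weakGradient Ω φ x + F₂ (φ x, u x) • weakGradient Ω u x := by
  obtain ⟨-, G', hG', hG'p⟩ := hu1
  have hGu := hasWeakGradient_weakGradient hG'
  have hGφ := hasWeakGradient_of_mem_testSpace hφ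
  have hφc : ContinuousOn φ Ω := hφ.2.1.continuousOn
  have hw := hGφ.comp₂ hΩ hGu hφc hu2 hu3 hF hF₁ hF₂
  set w := fun x => F (φ x, u x) with hwdef
  have hmaps : MapsTo (fun x => (φ x, u x)) Ω {z | 0 < z.2} := fun x hx => hu3 x hx
  have hwΩ : ContinuousOn w Ω :=
    ContinuousOn.comp (fun z hz => (hF z hz).continuousAt.continuousWithinAt) (hφc.prodMk hu2) hmaps
  have hwts : tsupport w ⊆ tsupport φ := by
    refine closure_mono fun x hx => ?_
    rw [Function.mem_support] at hx ⊢
    intro h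
    exact hx (by rw [hwdef]; simp only [h, hF0])
  have hwsupp : HasCompactSupport w := hφ.2.2.1.of_isClosed_subset (isClosed_tsupport _) hwts
  have hwc : Continuous w := by
    rw [continuous_iff_continuousAt]
    intro x
    by_cases hx : x ∈ Ω
    · exact hwΩ.continuousAt (hΩ.mem_nhds hx)
    · have hx' : x ∉ tsupport w := fun h => hx (hφ.2.2.2 (hwts h))
      have : w =ᶠ[𝓝 x] fun _ => 0 := by
        filter_upwards [(isClosed_tsupport w).isOpen_compl.mem_nhds hx'] with y hy
        exact image_eq_zero_of_notMem_tsupport hy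
      exact continuousAt_const.congr this.symm
  have hK := hφ.2.2.1
  have hKΩ := hφ.2.2.2
  have hLp : MemLp (fun x => F₁ (φ x, u x) • weakGradient Ω φ x +
      F₂ (φ x, u x) • weakGradient Ω u x) (ENNReal.ofReal p) (volume.restrict Ω) := by
    refine memLp_restrict_of_ae_eq_zero hK hKΩ ?_ ?_
    · have hmono : volume.restrict (tsupport φ) ≤ volume.restrict Ω :=
        Measure.restrict_mono hKΩ le_rfl
      refine (MemLp.continuousOn_smul hK ((hF₁.comp (hφc.prodMk hu2) hmaps).mono hKΩ)
        ((memLp_weakGradient_of_mem_testSpace hΩ hφ).mono_measure hmono)).add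
        (MemLp.continuousOn_smul hK ((hF₂.comp (hφc.prodMk hu2) hmaps).mono hKΩ)
        ((hG'p _ hK hKΩ).ae_eq ?_))
      exact ae_mono hmono (hG'.weakGradient_ae_eq hΩ).symm
    · filter_upwards [hw.ae_eq_zero_of_notMem_tsupport hΩ] with x hx hxK
      exact hx fun h => hxK (hwts h)
  exact ⟨⟨⟨(hwc.memLp_of_hasCompactSupport hwsupp).mono_measure Measure.restrict_le_self, _, hw,
    hLp⟩, hwc, hwsupp, hwts.trans hKΩ⟩, hw.weakGradient_ae_eq hΩ⟩

end TestSpace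

/-! ### The coefficient matrix -/

section Coefficients

open scoped Topology ContDiff
open Filter

variable {N : ℕ} {Ω : Set (EuclideanSpace ℝ (Fin N))} {p : ℝ}
  {A : EuclideanSpace ℝ (Fin N) → Matrix (Fin N) (Fin N) ℝ}

local notation "𝔼" => EuclideanSpace ℝ (Fin N)

lemma IsEllipticMatrix.ae_symm_nonneg (hΩ : IsOpen Ω) (hA : IsEllipticMatrix Ω A) :
    ∀ᵐ x ∂volume.restrict Ω, (A x).IsSymm ∧ ∀ ξ, 0 ≤ matForm (A x) ξ ξ := by
  refine hA.symm.and (ae_restrict_of_forall_isCompact hΩ fun K hK hKΩ => ?_)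
  obtain ⟨θ, hθ, h⟩ := hA.elliptic K hK hKΩ
  filter_upwards [h] with x hx ξ
  exact le_trans (by positivity) (hx ξ)

lemma IsEllipticMatrix.exists_matNorm_le (hA : IsEllipticMatrix Ω A) {K : Set 𝔼}
    (hK : IsCompact K) (hKΩ : K ⊆ Ω) :
    ∃ C : ℝ, 0 ≤ C ∧ ∀ᵐ x ∂volume.restrict K, ∀ ξ, matNorm (A x) ξ ≤ C * ‖ξ‖ := by
  obtain ⟨M, hM⟩ := hA.bdd K hK hKΩ
  refine ⟨√(N * (N * |M|)), Real.sqrt_nonneg _, ?_⟩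
  filter_upwards [hM] with x hx ξ
  have h1 : matForm (A x) ξ ξ ≤ N * (N * |M|) * ‖ξ‖ ^ 2 := by
    have : ∀ i j, A x i j * ξ j * ξ i ≤ |M| * ‖ξ‖ ^ 2 := fun i j => by
      calc A x i j * ξ j * ξ i ≤ |A x i j * ξ j * ξ i| := le_abs_self _
        _ = |A x i j| * (|ξ j| * |ξ i|) := by rw [abs_mul, abs_mul]; ring
        _ ≤ |M| * (‖ξ‖ * ‖ξ‖) := by
          exact mul_le_mul ((hx i j).trans (le_abs_self M))
            (mul_le_mul (PiLp.norm_apply_le ξ j) (PiLp.norm_apply_le ξ i) (abs_nonneg _)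
              (norm_nonneg _)) (by positivity) (abs_nonneg _)
        _ = _ := by ring
    calc matForm (A x) ξ ξ ≤ ∑ _i : Fin N, ∑ _j : Fin N, |M| * ‖ξ‖ ^ 2 :=
          Finset.sum_le_sum fun i _ => Finset.sum_le_sum fun j _ => this i j
      _ = _ := by simp; ring
  calc matNorm (A x) ξ ≤ √(N * (N * |M|) * ‖ξ‖ ^ 2) := Real.sqrt_le_sqrt h1
    _ = _ := by rw [Real.sqrt_mul (by positivity), Real.sqrt_sq (norm_nonneg _)]

lemma IsEllipticMatrix.exists_norm_le (hA : IsEllipticMatrix Ω A) {K : Set 𝔼}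
    (hK : IsCompact K) (hKΩ : K ⊆ Ω) :
    ∃ C : ℝ, 0 ≤ C ∧ ∀ᵐ x ∂volume.restrict K, ∀ ξ, ‖ξ‖ ≤ C * matNorm (A x) ξ := by
  obtain ⟨θ, hθ, h⟩ := hA.elliptic K hK hKΩ
  refine ⟨(√θ)⁻¹, by positivity, ?_⟩
  filter_upwards [h] with x hx ξ
  have hs : 0 < √θ := Real.sqrt_pos.2 hθ
  rw [inv_mul_eq_div, le_div_iff₀ hs, mul_comm]
  calc √θ * ‖ξ‖ = √(θ * ‖ξ‖ ^ 2) := by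
        rw [Real.sqrt_mul hθ.le, Real.sqrt_sq (norm_nonneg _)]
    _ ≤ _ := Real.sqrt_le_sqrt (hx ξ)

lemma IsEllipticMatrix.aestronglyMeasurable_matForm (hA : IsEllipticMatrix Ω A) {G H : 𝔼 → 𝔼}
    (hG : AEStronglyMeasurable G (volume.restrict Ω))
    (hH : AEStronglyMeasurable H (volume.restrict Ω)) :
    AEStronglyMeasurable (fun x => matForm (A x) (G x) (H x)) (volume.restrict Ω) := by
  have hcoord : ∀ (G : 𝔼 → 𝔼) (j : Fin N), AEStronglyMeasurable G (volume.restrict Ω) →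
      AEStronglyMeasurable (fun x => G x j) (volume.restrict Ω) := fun G j hG =>
    (EuclideanSpace.proj (𝕜 := ℝ) j).continuous.comp_aestronglyMeasurable hG
  simp only [matForm]
  refine Finset.aestronglyMeasurable_fun_sum _ fun i _ =>
    Finset.aestronglyMeasurable_fun_sum _ fun j _ => ?_
  exact ((hA.meas i j).mul (hcoord G j hG)).mul (hcoord H i hH)

lemma IsEllipticMatrix.aestronglyMeasurable_matNorm_rpow (hA : IsEllipticMatrix Ω A) {G : 𝔼 → 𝔼}
    (hG : AEStronglyMeasurable G (volume.restrict Ω)) (q : ℝ) :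
    AEStronglyMeasurable (fun x => matNorm (A x) (G x) ^ q) (volume.restrict Ω) :=
  ((hA.aestronglyMeasurable_matForm hG hG).aemeasurable.sqrt.pow_const q).aestronglyMeasurable

lemma IsEllipticMatrix.integrableOn_matNorm_rpow (hp : 1 < p)
    (hA : IsEllipticMatrix Ω A) {G : 𝔼 → 𝔼} (hG : AEStronglyMeasurable G (volume.restrict Ω))
    {K : Set 𝔼} (hK : IsCompact K) (hKΩ : K ⊆ Ω)
    (hGK : MemLp G (ENNReal.ofReal p) (volume.restrict K)) :
    IntegrableOn (fun x => matNorm (A x) (G x) ^ p) K := by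
  obtain ⟨C, hC, h⟩ := hA.exists_matNorm_le hK hKΩ
  have hi : Integrable (fun x => ‖G x‖ ^ p) (volume.restrict K) := by
    have := hGK.integrable_norm_rpow (by simpa using by linarith) ENNReal.ofReal_ne_top
    rwa [ENNReal.toReal_ofReal (by linarith)] at this
  refine (hi.const_mul (C ^ p)).mono' ((hA.aestronglyMeasurable_matNorm_rpow hG p).mono_measure
    (Measure.restrict_mono hKΩ le_rfl)) ?_
  filter_upwards [h] with x hx
  rw [Real.norm_of_nonneg (Real.rpow_nonneg (matNorm_nonneg _ _) _),
    ← Real.mul_rpow hC (norm_nonneg _)]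
  exact Real.rpow_le_rpow (matNorm_nonneg _ _) (hx _) (by linarith)

lemma matNorm_zero (M : Matrix (Fin N) (Fin N) ℝ) : matNorm M 0 = 0 := by
  simp [matNorm, matForm]

/-- Young's inequality in a crude form. -/
lemma rpow_mul_le_rpow_add_rpow (hp : 1 < p) {x z : ℝ} (hx : 0 ≤ x) (hz : 0 ≤ z) :
    x ^ (p - 1) * z ≤ x ^ p + z ^ p := by
  have hq : ∀ y : ℝ, 0 ≤ y → y ^ (p - 1) * y = y ^ p := fun y hy => by
    rcases hy.eq_or_lt with rfl | hy
    · simp [Real.zero_rpow (by linarith : p ≠ 0)]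
    · rw [← Real.rpow_add_one hy.ne']; congr 1; ring
  have h1 : 0 ≤ x ^ p := Real.rpow_nonneg hx _
  have h2 : 0 ≤ z ^ p := Real.rpow_nonneg hz _
  rcases le_total x z with h | h
  · have := mul_le_mul_of_nonneg_right (Real.rpow_le_rpow hx h (by linarith : 0 ≤ p - 1)) hz
    rw [hq z hz] at this
    linarith
  · have := mul_le_mul_of_nonneg_left h (Real.rpow_nonneg hx (p - 1))
    rw [hq x hx] at this
    linarith

/-- The flux `|a|^{p-2} ⟨M a, b⟩` is bounded by `|a|^{p-1} |b|`. -/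
lemma abs_flux_le {M : Matrix (Fin N) (Fin N) ℝ} (hS : M.IsSymm)
    (hP : ∀ ξ, 0 ≤ matForm M ξ ξ) (a b : 𝔼) :
    |matNorm M a ^ (p - 2) * matForm M a b| ≤ matNorm M a ^ (p - 1) * matNorm M b := by
  have h := abs_matForm_le hS hP a b
  have h0 := matNorm_nonneg M a
  rw [abs_mul, abs_of_nonneg (Real.rpow_nonneg h0 _)]
  rcases h0.eq_or_lt with h1 | h1
  · rw [← h1, zero_mul] at h
    have : |matForm M a b| = 0 := le_antisymm h (abs_nonneg _)
    rw [this, mul_zero]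
    exact mul_nonneg (Real.rpow_nonneg h0 _) (matNorm_nonneg _ _)
  · calc _ ≤ matNorm M a ^ (p - 2) * (matNorm M a * matNorm M b) := by gcongr
      _ = _ := by
        rw [← mul_assoc, ← Real.rpow_add_one h1.ne']; congr 2; ring

end Coefficients

/-! ### The weak equation and Picone's identity -/

section Picone

open scoped Topology ContDiff
open Filter

variable {N : ℕ} {Ω : Set (EuclideanSpace ℝ (Fin N))} {p : ℝ}
  {A : EuclideanSpace ℝ (Fin N) → Matrix (Fin N) (Fin N) ℝ} {V : EuclideanSpace ℝ (Fin N) → ℝ}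
  {u : EuclideanSpace ℝ (Fin N) → ℝ}

local notation "𝔼" => EuclideanSpace ℝ (Fin N)

lemma tendsto_integral_norm_rpow {α : Type*} [MeasurableSpace α] {μ : Measure α} (hp : 1 < p)
    {X : ℕ → α → 𝔼} (hX : ∀ n, MemLp (X n) (ENNReal.ofReal p) μ)
    (h : Tendsto (fun n => eLpNorm (X n) (ENNReal.ofReal p) μ) atTop (𝓝 0)) :
    Tendsto (fun n => ∫ x, ‖X n x‖ ^ p ∂μ) atTop (𝓝 0) := by
  have hp0 : 0 < p := by linarith
  have h1 := ((ENNReal.tendsto_toReal ENNReal.zero_ne_top).comp h).rpow_const (p := p)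
    (Or.inr hp0.le)
  rw [ENNReal.toReal_zero, Real.zero_rpow hp0.ne'] at h1
  refine h1.congr fun n => ?_
  have h0 : 0 ≤ ∫ x, ‖X n x‖ ^ p ∂μ := integral_nonneg fun x => Real.rpow_nonneg (norm_nonneg _) _
  rw [Function.comp_apply, (hX n).eLpNorm_eq_integral_rpow_norm (by simpa using hp0)
    ENNReal.ofReal_ne_top, ENNReal.toReal_ofReal hp0.le,
    ENNReal.toReal_ofReal (Real.rpow_nonneg h0 _), ← Real.rpow_mul h0, inv_mul_cancel₀ hp0.ne',
    Real.rpow_one]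

lemma IsPositiveSolution.hasWeakGradient (hu : IsPositiveSolution p Ω A V u) :
    HasWeakGradient Ω u (weakGradient Ω u) := by
  obtain ⟨-, G, hG, -⟩ := hu.memW1Loc
  exact hasWeakGradient_weakGradient hG

lemma IsPositiveSolution.memLp_weakGradient (hΩ : IsOpen Ω) (hu : IsPositiveSolution p Ω A V u)
    {K : Set 𝔼} (hK : IsCompact K) (hKΩ : K ⊆ Ω) :
    MemLp (weakGradient Ω u) (ENNReal.ofReal p) (volume.restrict K) := by
  obtain ⟨-, G, hG, hGp⟩ := hu.memW1Loc
  exact (hGp K hK hKΩ).ae_eq (ae_mono (Measure.restrict_mono hKΩ le_rfl)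
    (hG.weakGradient_ae_eq hΩ).symm)

lemma IsPositiveSolution.integrableOn_matNorm_rpow (hΩ : IsOpen Ω) (hp : 1 < p)
    (hA : IsEllipticMatrix Ω A) (hu : IsPositiveSolution p Ω A V u)
    {K : Set 𝔼} (hK : IsCompact K) (hKΩ : K ⊆ Ω) :
    IntegrableOn (fun x => matNorm (A x) (weakGradient Ω u x) ^ p) K :=
  hA.integrableOn_matNorm_rpow hp hu.hasWeakGradient.2.1.aestronglyMeasurable hK hKΩ
    (hu.memLp_weakGradient hΩ hK hKΩ)

lemma IsPositiveSolution.locallyIntegrableOn_potential (hΩ : IsOpen Ω)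
    (hV : LocallyIntegrableOn V Ω) (hu : IsPositiveSolution p Ω A V u) :
    LocallyIntegrableOn (fun x => V x * |u x| ^ (p - 2) * u x) Ω := by
  have hc : ContinuousOn (fun x => |u x| ^ (p - 2) * u x) Ω :=
    (hu.continuousOn.abs.rpow_const fun x hx => Or.inl (abs_pos.2 (hu.pos x hx).ne').ne').mul
      hu.continuousOn
  refine (hV.continuousOn_smul hΩ.isLocallyClosed hc).congr (ae_of_all _ fun x => ?_)
  rw [smul_eq_mul]; ring

/-- The weak equation may be tested with every element of `W^{1,p}(Ω) ∩ C_c(Ω)`. -/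
lemma IsPositiveSolution.weak_testSpace (hΩ : IsOpen Ω) (hp : 1 < p) (hA : IsEllipticMatrix Ω A)
    (hV : LocallyIntegrableOn V Ω) (hu : IsPositiveSolution p Ω A V u) {w : 𝔼 → ℝ}
    (hw : w ∈ testSpace p Ω) :
    IntegrableOn (fun x => matNorm (A x) (weakGradient Ω u x) ^ (p - 2) *
      matForm (A x) (weakGradient Ω u x) (weakGradient Ω w x) +
        V x * |u x| ^ (p - 2) * u x * w x) Ω ∧
    ∫ x in Ω, (matNorm (A x) (weakGradient Ω u x) ^ (p - 2) *
      matForm (A x) (weakGradient Ω u x) (weakGradient Ω w x) +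
        V x * |u x| ^ (p - 2) * u x * w x) = 0 := by
  set U := weakGradient Ω u with hU
  set flux : 𝔼 → 𝔼 → ℝ := fun x X => matNorm (A x) (U x) ^ (p - 2) * matForm (A x) (U x) X
    with hflux
  set b : 𝔼 → ℝ := fun x => V x * |u x| ^ (p - 2) * u x with hb
  have hbi : LocallyIntegrableOn b Ω := hu.locallyIntegrableOn_potential hΩ hV
  have hUm : AEStronglyMeasurable U (volume.restrict Ω) :=
    hu.hasWeakGradient.2.1.aestronglyMeasurable
  have hae := hA.ae_symm_nonneg hΩ
  obtain ⟨G, hG, hGp, hGe⟩ := exists_hasWeakGradient_univ hΩ hw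
  obtain ⟨F, K', hK', hK'Ω, hF1, hF2, hF3, hF4⟩ :=
    hG.exists_smooth_approx hp.le hw.2.1 hw.2.2.1 hGp hΩ hw.2.2.2
  set K := K' ∪ tsupport w with hKdef
  have hK : IsCompact K := hK'.union hw.2.2.1
  have hKΩ : K ⊆ Ω := union_subset hK'Ω hw.2.2.2
  have hmono : volume.restrict K ≤ volume.restrict Ω := Measure.restrict_mono hKΩ le_rfl
  have hUK := hu.integrableOn_matNorm_rpow hΩ hp hA hK hKΩ
  rw [← hU] at hUK
  have hbK : IntegrableOn b K := hbi.integrableOn_compact_subset hKΩ hK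
  -- pointwise bound of the flux with a weight `δ`
  have hfb : ∀ δ : ℝ, 0 < δ → ∀ᵐ x ∂volume.restrict K, ∀ X, |flux x X| ≤
      δ ^ p * matNorm (A x) (U x) ^ p + δ ^ ((1 - p) * p) * matNorm (A x) X ^ p := by
    intro δ hδ
    filter_upwards [ae_mono hmono hae] with x hx X
    have h1 := matNorm_nonneg (A x) (U x)
    have h2 := matNorm_nonneg (A x) X
    refine (abs_flux_le hx.1 hx.2 (U x) X).trans ?_
    have h3 := rpow_mul_le_rpow_add_rpow hp (mul_nonneg hδ.le h1)
      (mul_nonneg (Real.rpow_nonneg hδ.le (1 - p)) h2)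
    rw [Real.mul_rpow hδ.le h1, Real.mul_rpow hδ.le h1, Real.mul_rpow
      (Real.rpow_nonneg hδ.le _) h2, ← Real.rpow_mul hδ.le] at h3
    have h4 : δ ^ (p - 1) * δ ^ (1 - p) = 1 := by
      rw [← Real.rpow_add hδ]; simp
    calc _ = (δ ^ (p - 1) * δ ^ (1 - p)) * (matNorm (A x) (U x) ^ (p - 1) * matNorm (A x) X) := by
          rw [h4, one_mul]
      _ = δ ^ (p - 1) * matNorm (A x) (U x) ^ (p - 1) * (δ ^ (1 - p) * matNorm (A x) X) := by ring
      _ ≤ _ := h3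
  have hfm : ∀ X : 𝔼 → 𝔼, AEStronglyMeasurable X (volume.restrict Ω) →
      AEStronglyMeasurable (fun x => flux x (X x)) (volume.restrict Ω) := fun X hX =>
    (hA.aestronglyMeasurable_matNorm_rpow hUm _).mul (hA.aestronglyMeasurable_matForm hUm hX)
  have hfi : ∀ X : 𝔼 → 𝔼, MemLp X (ENNReal.ofReal p) volume →
      IntegrableOn (fun x => matNorm (A x) (X x) ^ p) K ∧ IntegrableOn (fun x => flux x (X x)) K := by
    intro X hX
    have h1 := hA.integrableOn_matNorm_rpow hp (hX.1.mono_measure Measure.restrict_le_self) hK hKΩ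
      (hX.mono_measure Measure.restrict_le_self)
    refine ⟨h1, ((hUK.const_mul (1 ^ p)).add (h1.const_mul (1 ^ ((1 - p) * p)))).mono'
      ((hfm X (hX.1.mono_measure Measure.restrict_le_self)).mono_measure hmono) ?_⟩
    filter_upwards [hfb 1 one_pos] with x hx using hx (X x)
  have hgF : ∀ n, MemLp (gradient (F n)) (ENNReal.ofReal p) volume := fun n =>
    (continuous_gradient_of_contDiff (hF1 n)).memLp_of_hasCompactSupport
      (hK'.of_isClosed_subset (isClosed_tsupport _) (closure_minimal
        ((support_gradient_subset _).trans (hF2 n)) hK'.isClosed))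
  have hFt : ∀ n, IsTestFunction Ω (F n) := fun n =>
    ⟨hF1 n, hK'.of_isClosed_subset (isClosed_tsupport _) (hF2 n), (hF2 n).trans hK'Ω⟩
  -- everything vanishes outside `K`
  have hzero : ∀ (X : 𝔼 → 𝔼) (f : 𝔼 → ℝ), (∀ᵐ x ∂volume, x ∉ K → X x = 0) → (∀ x, x ∉ K → f x = 0) →
      ∀ᵐ x ∂volume, x ∈ Ω \ K → flux x (X x) + b x * f x = 0 := by
    intro X f hX hf
    filter_upwards [hX] with x hx hxK
    rw [hx hxK.2, hf x hxK.2]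
    simp [hflux, matForm]
  have hG0 : ∀ᵐ x ∂volume, x ∉ K → G x = 0 := by
    have := hG.ae_eq_zero_of_notMem_tsupport isOpen_univ
    rw [Measure.restrict_univ] at this
    filter_upwards [this] with x hx hxK using hx fun h => hxK (Or.inr h)
  have hw0 : ∀ x, x ∉ K → w x = 0 := fun x hx =>
    image_eq_zero_of_notMem_tsupport fun h => hx (Or.inr h)
  have hF0 : ∀ n x, x ∉ K → F n x = 0 := fun n x hx =>
    image_eq_zero_of_notMem_tsupport fun h => hx (Or.inl (hF2 n h))
  have hgF0 : ∀ n x, x ∉ K → gradient (F n) x = 0 := fun n x hx => by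
    by_contra h
    exact hx (Or.inl (hF2 n (support_gradient_subset _ h)))
  have hwi : IntegrableOn (fun x => flux x (G x) + b x * w x) K :=
    (hfi G hGp).2.add (hbK.mul_continuousOn hw.2.1.continuousOn hK)
  have hFi : ∀ n, IntegrableOn (fun x => flux x (gradient (F n) x) + b x * F n x) K := fun n =>
    (hfi _ (hgF n)).2.add (hbK.mul_continuousOn (hF1 n).continuous.continuousOn hK)
  have hcong : (fun x => flux x (G x) + b x * w x) =ᵐ[volume.restrict Ω]
      fun x => flux x (weakGradient Ω w x) + b x * w x := by
    filter_upwards [hGe] with x hx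
    rw [hx]
  have hwiΩ : IntegrableOn (fun x => flux x (G x) + b x * w x) Ω :=
    hwi.of_ae_sdiff_eq_zero hΩ.nullMeasurableSet (hzero G w hG0 hw0)
  refine ⟨hwiΩ.congr hcong, ?_⟩
  rw [← integral_congr_ae hcong, setIntegral_eq_of_subset_of_ae_sdiff_eq_zero hΩ.nullMeasurableSet
    hKΩ (hzero G w hG0 hw0)]
  set J := ∫ x in K, (flux x (G x) + b x * w x)
  have hIn : ∀ n, ∫ x in K, (flux x (gradient (F n) x) + b x * F n x) = 0 := fun n => by
    rw [← setIntegral_eq_of_subset_of_ae_sdiff_eq_zero hΩ.nullMeasurableSet hKΩ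
      (hzero _ _ (ae_of_all _ (hgF0 n)) (hF0 n))]
    exact hu.weak (F n) (hFt n)
  set X : ℕ → 𝔼 → 𝔼 := fun n x => gradient (F n) x - G x
  have hX : ∀ n, MemLp (X n) (ENNReal.ofReal p) volume := fun n => (hgF n).sub hGp
  set E : ℕ → ℝ := fun n => ∫ x in K, matNorm (A x) (X n x) ^ p
  have hE : Tendsto E atTop (𝓝 0) := by
    obtain ⟨C, hC, hC'⟩ := hA.exists_matNorm_le hK hKΩ
    have h1 := (tendsto_integral_norm_rpow hp hX hF4).const_mul (C ^ p)
    rw [mul_zero] at h1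
    refine squeeze_zero (fun n => integral_nonneg fun x => Real.rpow_nonneg (matNorm_nonneg _ _) _)
      (fun n => ?_) h1
    have hi : Integrable (fun x => ‖X n x‖ ^ p) volume := by
      have := (hX n).integrable_norm_rpow (by simpa using by linarith) ENNReal.ofReal_ne_top
      rwa [ENNReal.toReal_ofReal (by linarith)] at this
    rw [← integral_const_mul]
    calc E n ≤ ∫ x in K, C ^ p * ‖X n x‖ ^ p := by
          refine integral_mono_ae (hfi _ (hX n)).1 (hi.restrict.const_mul _) ?_
          filter_upwards [hC'] with x hx
          rw [← Real.mul_rpow hC (norm_nonneg _)]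
          exact Real.rpow_le_rpow (matNorm_nonneg _ _) (hx _) (by linarith)
      _ ≤ _ := setIntegral_le_integral (hi.const_mul _) (ae_of_all _ fun x =>
          mul_nonneg (Real.rpow_nonneg hC _) (Real.rpow_nonneg (norm_nonneg _) _))
  have hD : Tendsto (fun n => ∫ x in K, ‖b x * (F n x - w x)‖) atTop (𝓝 0) := by
    rw [Metric.tendsto_atTop]
    intro ε hε
    set B := ∫ x in K, ‖b x‖
    have hB : 0 ≤ B := integral_nonneg fun _ => norm_nonneg _
    obtain ⟨n₀, hn₀⟩ := eventually_atTop.1 (Metric.tendstoUniformly_iff.1 hF3 (ε / (B + 1))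
      (by positivity))
    refine ⟨n₀, fun n hn => ?_⟩
    rw [Real.dist_0_eq_abs, abs_of_nonneg (integral_nonneg fun _ => norm_nonneg _)]
    calc ∫ x in K, ‖b x * (F n x - w x)‖ ≤ ∫ x in K, ‖b x‖ * (ε / (B + 1)) := by
          refine integral_mono (hbK.mul_continuousOn
            ((hF1 n).continuous.sub hw.2.1).continuousOn hK).norm (hbK.norm.mul_const _) fun x => ?_
          simp only [norm_mul]
          have := hn₀ n hn x
          rw [dist_comm, dist_eq_norm] at this
          exact mul_le_mul_of_nonneg_left this.le (norm_nonneg _)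
      _ = B * (ε / (B + 1)) := by rw [integral_mul_const]
      _ < ε := by rw [← mul_div_assoc, div_lt_iff₀ (by positivity)]; nlinarith
  have hbound : ∀ δ : ℝ, 0 < δ → |J| ≤ δ ^ p * ∫ x in K, matNorm (A x) (U x) ^ p := by
    intro δ hδ
    set C₁ := ∫ x in K, matNorm (A x) (U x) ^ p
    have hl : Tendsto (fun n => (δ ^ p * C₁ + δ ^ ((1 - p) * p) * E n) +
        ∫ x in K, ‖b x * (F n x - w x)‖) atTop (𝓝 (δ ^ p * C₁)) := by
      simpa using ((hE.const_mul (δ ^ ((1 - p) * p))).const_add (δ ^ p * C₁)).add hD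
    refine ge_of_tendsto hl (Eventually.of_forall fun n => ?_)
    have i1 := (hfi _ (hX n)).2
    have i2 : IntegrableOn (fun x => b x * (F n x - w x)) K := hbK.mul_continuousOn
      ((hF1 n).continuous.sub hw.2.1).continuousOn hK
    have e1 : -J = ∫ x in K, (flux x (X n x) + b x * (F n x - w x)) := by
      have : -J = (∫ x in K, (flux x (gradient (F n) x) + b x * F n x)) - J := by rw [hIn n]; ring
      rw [this, ← integral_sub (hFi n) hwi]
      refine integral_congr_ae (ae_of_all _ fun x => ?_)
      have : X n x = gradient (F n) x + (-1 : ℝ) • G x := by simp only [X]; module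
      simp only [hflux, this, matForm_add_right, matForm_smul_right]
      ring
    rw [← abs_neg, e1, integral_add i1 i2]
    refine (abs_add_le _ _).trans (add_le_add ?_ ?_)
    swap
    · exact norm_integral_le_integral_norm (fun x => b x * (F n x - w x))
    have i3 := (hUK.const_mul (δ ^ p)).add ((hfi _ (hX n)).1.const_mul (δ ^ ((1 - p) * p)))
    rw [← Real.norm_eq_abs]
    refine (norm_integral_le_of_norm_le i3 ?_).trans (le_of_eq ?_)
    · filter_upwards [hfb δ hδ] with x hx using hx _
    · simp only [Pi.add_apply]
      rw [integral_add (hUK.const_mul _) ((hfi _ (hX n)).1.const_mul _), integral_const_mul,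
        integral_const_mul]
  have hlim : Tendsto (fun δ : ℝ => δ ^ p * ∫ x in K, matNorm (A x) (U x) ^ p) (𝓝[>] 0) (𝓝 0) := by
    have h1 : Tendsto (fun δ : ℝ => δ ^ p) (𝓝 0) (𝓝 0) := by
      have := (Real.continuous_rpow_const (q := p) (by linarith)).tendsto 0
      rwa [Real.zero_rpow (by linarith)] at this
    simpa using (h1.mono_left nhdsWithin_le_nhds).mul_const (∫ x in K, matNorm (A x) (U x) ^ p)
  have : |J| ≤ 0 := ge_of_tendsto hlim (by
    filter_upwards [self_mem_nhdsWithin] with δ hδ using hbound δ hδ)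
  exact abs_nonpos_iff.1 this

lemma integrableOn_energy (hΩ : IsOpen Ω) (hp : 1 < p) (hA : IsEllipticMatrix Ω A)
    (hV : LocallyIntegrableOn V Ω) {φ : 𝔼 → ℝ} (hφ : φ ∈ testSpace p Ω) :
    IntegrableOn (fun x => matNorm (A x) (weakGradient Ω φ x) ^ p + V x * |φ x| ^ p) Ω := by
  have h1 : IntegrableOn (fun x => matNorm (A x) (weakGradient Ω φ x) ^ p) (tsupport φ) :=
    hA.integrableOn_matNorm_rpow hp (memLp_weakGradient_of_mem_testSpace hΩ hφ).1 hφ.2.2.1 hφ.2.2.2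
      ((memLp_weakGradient_of_mem_testSpace hΩ hφ).mono_measure
        (Measure.restrict_mono hφ.2.2.2 le_rfl))
  have h2 : IntegrableOn (fun x => matNorm (A x) (weakGradient Ω φ x) ^ p) Ω := by
    refine h1.of_ae_sdiff_eq_zero hΩ.nullMeasurableSet ?_
    have := (hasWeakGradient_of_mem_testSpace hφ).ae_eq_zero_of_notMem_tsupport hΩ
    rw [ae_restrict_iff' hΩ.measurableSet] at this
    filter_upwards [this] with x hx hxΩ
    rw [hx hxΩ.1 hxΩ.2, matNorm_zero, Real.zero_rpow (by linarith)]
  have hc : Continuous fun x => |φ x| ^ p :=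
    hφ.2.1.abs.rpow_const fun _ => Or.inr (by linarith)
  have hts : tsupport (fun x => |φ x| ^ p) ⊆ tsupport φ := closure_mono fun x hx => by
    rw [Function.mem_support] at hx ⊢
    intro h
    exact hx (by rw [h, abs_zero, Real.zero_rpow (by linarith)])
  have h3 : Integrable fun x => |φ x| ^ p • V x := integrable_smul_of_tsupport_subset hV hc
    (hφ.2.2.1.of_isClosed_subset (isClosed_tsupport _) hts) (hts.trans hφ.2.2.2)
  refine h2.add (h3.integrableOn.congr (ae_of_all _ fun x => ?_))
  simp only [smul_eq_mul, mul_comm]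

/-- **Picone's identity**: the energy of `φ` is the integral of the Bregman divergence at `∇φ` based
at `(φ / u) ∇u`. It arises by testing the equation of `u` with `|φ|^p u^{1-p}`. -/
lemma IsPositiveSolution.energy_eq_integral_bregman (hΩ : IsOpen Ω) (hp : 1 < p)
    (hA : IsEllipticMatrix Ω A) (hV : LocallyIntegrableOn V Ω)
    (hu : IsPositiveSolution p Ω A V u) {φ : 𝔼 → ℝ} (hφ : φ ∈ testSpace p Ω) :
    IntegrableOn (fun x => bregman p (A x) (weakGradient Ω φ x)
      ((φ x / u x) • weakGradient Ω u x)) Ω ∧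
    energy p Ω A V φ = ∫ x in Ω, bregman p (A x) (weakGradient Ω φ x)
      ((φ x / u x) • weakGradient Ω u x) := by
  set F : ℝ × ℝ → ℝ := fun z => |z.1| ^ p * z.2 ^ (1 - p)
  set F₁ : ℝ × ℝ → ℝ := fun z => p * |z.1| ^ (p - 2) * z.1 * z.2 ^ (1 - p)
  set F₂ : ℝ × ℝ → ℝ := fun z => |z.1| ^ p * ((1 - p) * z.2 ^ (-p))
  have hF : ∀ z : ℝ × ℝ, 0 < z.2 → HasFDerivAt F (F₁ z • ContinuousLinearMap.fst ℝ ℝ ℝ +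
      F₂ z • ContinuousLinearMap.snd ℝ ℝ ℝ) z := by
    intro z hz
    have h1 := (hasDerivAt_abs_rpow z.1 hp).comp_hasFDerivAt z
      (ContinuousLinearMap.fst ℝ ℝ ℝ).hasFDerivAt
    have h2 := (Real.hasDerivAt_rpow_const (x := z.2) (p := 1 - p) (Or.inl hz.ne')).comp_hasFDerivAt
      z (ContinuousLinearMap.snd ℝ ℝ ℝ).hasFDerivAt
    refine (h1.mul h2).congr_fderiv ?_
    ext
    · simp [F₁]; ring
    · simp [F₂, show 1 - p - 1 = -p by ring]
  have hpow : ∀ q : ℝ, ContinuousOn (fun z : ℝ × ℝ => z.2 ^ q) {z | 0 < z.2} := fun q =>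
    continuousOn_snd.rpow_const fun z hz => Or.inl (ne_of_gt hz)
  have hF₁ : ContinuousOn F₁ {z | 0 < z.2} := by
    have h1 : Continuous fun s : ℝ => p * |s| ^ (p - 2) * s := by
      have h2 : deriv (fun s : ℝ => ‖s‖ ^ p) = fun s => p * |s| ^ (p - 2) * s := by
        ext s
        simpa only [Real.norm_eq_abs] using (hasDerivAt_abs_rpow s hp).deriv
      rw [← h2]
      exact (contDiff_norm_rpow hp).continuous_deriv le_rfl
    exact (h1.comp continuous_fst).continuousOn.mul (hpow _)
  have hF₂ : ContinuousOn F₂ {z | 0 < z.2} :=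
    (continuous_fst.abs.rpow_const fun _ => Or.inr (by linarith)).continuousOn.mul
      (continuousOn_const.mul (hpow _))
  obtain ⟨hw, hwg⟩ := comp₂_mem_testSpace hΩ hφ hu.memW1Loc hu.continuousOn hu.pos (F := F)
    (fun t => by simp [F, Real.zero_rpow (by linarith : p ≠ 0)]) hF hF₁ hF₂
  obtain ⟨hi, h0⟩ := hu.weak_testSpace hΩ hp hA hV hw
  have hie := integrableOn_energy hΩ hp hA hV hφ
  have hpt : (fun x => (matNorm (A x) (weakGradient Ω φ x) ^ p + V x * |φ x| ^ p) -
      (matNorm (A x) (weakGradient Ω u x) ^ (p - 2) * matForm (A x) (weakGradient Ω u x)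
        (weakGradient Ω (fun x => F (φ x, u x)) x) + V x * |u x| ^ (p - 2) * u x * F (φ x, u x)))
      =ᵐ[volume.restrict Ω] fun x => bregman p (A x) (weakGradient Ω φ x)
        ((φ x / u x) • weakGradient Ω u x) := by
    filter_upwards [hwg, hA.ae_symm_nonneg hΩ, ae_restrict_mem hΩ.measurableSet] with x hx hAx hxΩ
    have hux := hu.pos x hxΩ
    rw [hx]
    set a := weakGradient Ω u x
    set c := weakGradient Ω φ x
    obtain ⟨ψ, hψ⟩ : ∃ ψ, φ x / u x = ψ := ⟨_, rfl⟩
    have hφψ : φ x = ψ * u x := by rw [← hψ]; field_simp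
    have e1 : u x ^ (p - 2) * u x * u x ^ (1 - p) = 1 := by
      rw [← Real.rpow_add_one hux.ne', ← Real.rpow_add hux,
        show p - 2 + 1 + (1 - p) = 0 by ring, Real.rpow_zero]
    have e2 : u x ^ p * u x ^ (-p) = 1 := by rw [← Real.rpow_add hux]; simp
    have e3 : u x ^ p = u x ^ (p - 2) * u x * u x := by
      rw [← Real.rpow_add_one hux.ne', ← Real.rpow_add_one hux.ne']; congr 1; ring
    have e4 : V x * |u x| ^ (p - 2) * u x * F (φ x, u x) = V x * |φ x| ^ p := by
      simp only [F]
      rw [abs_of_pos hux]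
      linear_combination V x * |φ x| ^ p * e1
    have e5 : F₁ (φ x, u x) = p * |ψ| ^ (p - 2) * ψ := by
      simp only [F₁]
      rw [hφψ, abs_mul, abs_of_pos hux, Real.mul_rpow (abs_nonneg _) hux.le]
      linear_combination p * |ψ| ^ (p - 2) * ψ * e1
    have e6 : F₂ (φ x, u x) = (1 - p) * |ψ| ^ p := by
      simp only [F₂]
      rw [hφψ, abs_mul, abs_of_pos hux, Real.mul_rpow (abs_nonneg _) hux.le]
      linear_combination (1 - p) * |ψ| ^ p * e2
    have e7 : matNorm (A x) a ^ (p - 2) * matForm (A x) a a = matNorm (A x) a ^ p := by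
      rw [← matNorm_sq hAx.2, rpow_sub_two_mul_sq hp (matNorm_nonneg _ _)]
    rw [e4, e5, e6, hψ, bregman, matForm_add_right, matForm_smul_right, matForm_smul_right,
      matForm_smul_left, matNorm_smul, Real.mul_rpow (abs_nonneg _) (matNorm_nonneg _ _),
      Real.mul_rpow (abs_nonneg _) (matNorm_nonneg _ _)]
    linear_combination (p - 1) * |ψ| ^ p * e7
  refine ⟨(hie.sub hi).congr hpt, ?_⟩
  rw [← integral_congr_ae hpt, integral_sub hie hi, h0, sub_zero, energy]

end Picone

/-! ### Truncation of test functions -/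

section Truncation

open scoped Topology ContDiff
open Filter

variable {N : ℕ} {Ω : Set (EuclideanSpace ℝ (Fin N))} {p : ℝ}
  {A : EuclideanSpace ℝ (Fin N) → Matrix (Fin N) (Fin N) ℝ} {V : EuclideanSpace ℝ (Fin N) → ℝ}
  {u : EuclideanSpace ℝ (Fin N) → ℝ}

local notation "𝔼" => EuclideanSpace ℝ (Fin N)

/-- A `C^1` even profile that equals `t² (2 - t²)` on `[-1, 1]` and `1` elsewhere. Its quadratic
vanishing at `0` makes the energies of dyadic truncations summable. -/
noncomputable def truncProfile (t : ℝ) : ℝ := 1 - max (1 - t ^ 2) 0 ^ 2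

/-- The derivative of `truncProfile`. -/
noncomputable def truncProfileDeriv (t : ℝ) : ℝ := 4 * t * max (1 - t ^ 2) 0

lemma hasDerivAt_max_zero_sq (x : ℝ) :
    HasDerivAt (fun x : ℝ => max x 0 ^ 2) (2 * max x 0) x := by
  have hne : ∀ y : ℝ, y ≠ 0 → HasDerivAt (fun x : ℝ => max x 0 ^ 2) (2 * max y 0) y := by
    intro y hy
    rcases lt_or_gt_of_ne hy with h | h
    · have : (fun x : ℝ => max x 0 ^ 2) =ᶠ[𝓝 y] fun _ => 0 := by
        filter_upwards [gt_mem_nhds h] with z hz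
        rw [max_eq_right hz.le]; norm_num
      rw [max_eq_right h.le, mul_zero]
      exact (hasDerivAt_const y (0 : ℝ)).congr_of_eventuallyEq this
    · have : (fun x : ℝ => max x 0 ^ 2) =ᶠ[𝓝 y] fun x => x ^ 2 := by
        filter_upwards [lt_mem_nhds h] with z hz
        rw [max_eq_left hz.le]
      rw [max_eq_left h.le]
      simpa using (hasDerivAt_pow 2 y).congr_of_eventuallyEq this
  by_cases hx : x = 0
  · subst hx
    exact hasDerivAt_of_hasDerivAt_of_ne hne (by fun_prop) (by fun_prop)
  · exact hne x hx

lemma hasDerivAt_truncProfile (t : ℝ) : HasDerivAt truncProfile (truncProfileDeriv t) t := by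
  have h1 : HasDerivAt (fun t : ℝ => 1 - t ^ 2) (-(2 * t)) t := by
    simpa using (hasDerivAt_pow 2 t).const_sub 1
  have h2 := ((hasDerivAt_max_zero_sq (1 - t ^ 2)).comp t h1).const_sub 1
  refine h2.congr_deriv ?_
  rw [truncProfileDeriv]; ring

lemma continuous_truncProfile : Continuous truncProfile := by
  unfold truncProfile; fun_prop

lemma continuous_truncProfileDeriv : Continuous truncProfileDeriv := by
  unfold truncProfileDeriv; fun_prop

lemma truncProfile_of_one_le {t : ℝ} (h : 1 ≤ |t|) : truncProfile t = 1 := by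
  have : 1 ≤ t ^ 2 := by rw [← sq_abs]; nlinarith
  rw [truncProfile, max_eq_right (by linarith)]; norm_num

lemma truncProfileDeriv_of_one_le {t : ℝ} (h : 1 ≤ |t|) : truncProfileDeriv t = 0 := by
  have : 1 ≤ t ^ 2 := by rw [← sq_abs]; nlinarith
  rw [truncProfileDeriv, max_eq_right (by linarith), mul_zero]

lemma truncProfile_of_lt_one {t : ℝ} (h : |t| < 1) : truncProfile t = t ^ 2 * (2 - t ^ 2) := by
  have : t ^ 2 < 1 := by rw [← sq_abs]; nlinarith [abs_nonneg t]
  rw [truncProfile, max_eq_left (by linarith)]; ring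

lemma truncProfileDeriv_of_lt_one {t : ℝ} (h : |t| < 1) :
    truncProfileDeriv t = 4 * t * (1 - t ^ 2) := by
  have : t ^ 2 < 1 := by rw [← sq_abs]; nlinarith [abs_nonneg t]
  rw [truncProfileDeriv, max_eq_left (by linarith)]

lemma truncProfile_zero : truncProfile 0 = 0 := by simp [truncProfile]

lemma truncProfile_nonneg (t : ℝ) : 0 ≤ truncProfile t := by
  have h1 : max (1 - t ^ 2) 0 ≤ 1 := max_le (by nlinarith) zero_le_one
  have h2 : 0 ≤ max (1 - t ^ 2) 0 := le_max_right _ _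
  rw [truncProfile]; nlinarith

lemma truncProfile_le_one (t : ℝ) : truncProfile t ≤ 1 := by
  rw [truncProfile]; nlinarith [sq_nonneg (max (1 - t ^ 2) 0)]

/-- The weight `|t|^p` for `|t| < 1`, and `0` elsewhere, which bounds the energy density of
truncations. -/
noncomputable def truncWeight (p t : ℝ) : ℝ := if |t| < 1 then |t| ^ p else 0

lemma truncWeight_nonneg (p t : ℝ) : 0 ≤ truncWeight p t := by
  unfold truncWeight
  split_ifs
  exacts [Real.rpow_nonneg (abs_nonneg _) _, le_rfl]

lemma measurable_truncWeight (p : ℝ) : Measurable (truncWeight p) :=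
  Measurable.ite (measurableSet_lt measurable_norm measurable_const)
    (measurable_norm.pow_const p) measurable_const

/-- The truncation `u f(c φ / u)` of a test function `φ` relative to the solution `u`. -/
noncomputable def truncation (u : 𝔼 → ℝ) (c : ℝ) (φ : 𝔼 → ℝ) (x : 𝔼) : ℝ :=
  u x * truncProfile (c * φ x / u x)

lemma IsPositiveSolution.truncation_mem_testSpace (hΩ : IsOpen Ω)
    (hu : IsPositiveSolution p Ω A V u) {φ : 𝔼 → ℝ} (hφ : φ ∈ testSpace p Ω) (c : ℝ) :
    truncation u c φ ∈ testSpace p Ω ∧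
      weakGradient Ω (truncation u c φ) =ᵐ[volume.restrict Ω] fun x =>
        (c * truncProfileDeriv (c * φ x / u x)) • weakGradient Ω φ x +
          (truncProfile (c * φ x / u x) -
            c * φ x / u x * truncProfileDeriv (c * φ x / u x)) • weakGradient Ω u x := by
  have hq : ContinuousOn (fun z : ℝ × ℝ => c * z.1 / z.2) {z | 0 < z.2} :=
    (continuous_const.mul continuous_fst).continuousOn.div continuousOn_snd
      fun z hz => ne_of_gt hz
  refine comp₂_mem_testSpace hΩ hφ hu.memW1Loc hu.continuousOn hu.pos
    (F := fun z => z.2 * truncProfile (c * z.1 / z.2))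
    (F₁ := fun z => c * truncProfileDeriv (c * z.1 / z.2))
    (F₂ := fun z => truncProfile (c * z.1 / z.2) -
      c * z.1 / z.2 * truncProfileDeriv (c * z.1 / z.2)) ?_ ?_ ?_ ?_
  · intro t
    simp [truncProfile_zero]
  · intro z hz
    have h1 : HasFDerivAt (fun z : ℝ × ℝ => c * z.1) (c • ContinuousLinearMap.fst ℝ ℝ ℝ) z :=
      (ContinuousLinearMap.fst ℝ ℝ ℝ).hasFDerivAt.const_mul c
    have h2 := (hasDerivAt_inv hz.ne').comp_hasFDerivAt z
      (ContinuousLinearMap.snd ℝ ℝ ℝ).hasFDerivAt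
    have h3 := (hasDerivAt_truncProfile (c * z.1 * z.2⁻¹)).comp_hasFDerivAt z (h1.mul h2)
    have h4 := (ContinuousLinearMap.snd ℝ ℝ ℝ).hasFDerivAt (x := z) |>.mul h3
    have hz' := hz.ne'
    refine h4.congr_fderiv ?_
    ext
    · simp [div_eq_mul_inv]; field_simp
    · simp [div_eq_mul_inv]; field_simp; ring
  · exact continuousOn_const.mul (continuous_truncProfileDeriv.comp_continuousOn hq)
  · exact (continuous_truncProfile.comp_continuousOn hq).sub
      (hq.mul (continuous_truncProfileDeriv.comp_continuousOn hq))

lemma truncation_eq_of_one_le {φ : 𝔼 → ℝ} {c : ℝ} {x : 𝔼} (h : 1 ≤ |c * φ x / u x|) :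
    truncation u c φ x = u x := by
  rw [truncation, truncProfile_of_one_le h, mul_one]

/-- The divergence that Picone's identity attaches to a truncation, in terms of the one attached to
the original function (`ψ = φ / u`, `a = ∇u`, `d = ∇φ`). -/
lemma exists_bregman_truncation_le (hp : 1 < p) :
    ∃ C : ℝ, 0 < C ∧ ∀ {N : ℕ} (M : Matrix (Fin N) (Fin N) ℝ), M.IsSymm →
      (∀ ξ, 0 ≤ matForm M ξ ξ) → ∀ (a d : EuclideanSpace ℝ (Fin N)) (c ψ : ℝ), 0 < c →
        bregman p M ((c * truncProfileDeriv (c * ψ)) • d +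
          (truncProfile (c * ψ) - c * ψ * truncProfileDeriv (c * ψ)) • a)
          (truncProfile (c * ψ) • a) ≤
        C * (c ^ p * truncWeight p (c * ψ) * bregman p M d (ψ • a)) := by
  obtain ⟨C, hC, H⟩ := exists_bregman_doubling hp
  refine ⟨2 ^ p * C, by positivity, fun M hS hP a d c ψ hc => ?_⟩
  set τ := c * ψ with hτ
  have hB := bregman_nonneg hp hS hP d (ψ • a)
  have hR : 0 ≤ 2 ^ p * C * (c ^ p * truncWeight p τ * bregman p M d (ψ • a)) := by
    have := truncWeight_nonneg p τ
    positivity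
  rcases le_or_gt 1 |τ| with h | h
  · rw [truncProfileDeriv_of_one_le h]
    simpa [bregman_self hp hP] using hR
  by_cases hψ : ψ = 0
  · have hτ0 : τ = 0 := by rw [hτ, hψ, mul_zero]
    rw [hτ0] at hR ⊢
    simpa [truncProfile_zero, truncProfileDeriv, bregman_self hp hP] using hR
  have hτ0 : τ ≠ 0 := mul_ne_zero hc.ne' hψ
  have hτ2 : 0 < τ ^ 2 := by positivity
  have hτ1 : τ ^ 2 < 1 := by rw [← sq_abs]; nlinarith [abs_nonneg τ]
  -- the ratio `t f'(t) / f(t)` takes values in `[0, 2]`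
  set k := 4 * (1 - τ ^ 2) / (2 - τ ^ 2) with hk
  have h2τ : 0 < 2 - τ ^ 2 := by linarith
  have hk0 : 0 ≤ k := div_nonneg (by linarith) h2τ.le
  have hk2 : k ≤ 2 := by rw [hk, div_le_iff₀ h2τ]; linarith
  set l := c * (τ * (2 - τ ^ 2)) with hl
  have e1 : truncProfile τ = l * ψ := by
    rw [truncProfile_of_lt_one h, hl, hτ]; ring
  have e2 : c * truncProfileDeriv τ = l * k := by
    rw [truncProfileDeriv_of_lt_one h, hl, hk]; field_simp
  have e3 : (c * truncProfileDeriv τ) • d + (truncProfile τ - τ * truncProfileDeriv τ) • a =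
      l • (ψ • a + k • (d - ψ • a)) := by
    have : τ * truncProfileDeriv τ = ψ * (l * k) := by rw [← e2, hτ]; ring
    rw [this, e1, e2]
    module
  have e5 : (l * ψ) • a = l • (ψ • a) := (smul_smul _ _ _).symm
  rw [e3, e1, e5, bregman_smul hp]
  have h1 := H M hS hP (ψ • a) (d - ψ • a) k hk0 hk2
  rw [add_sub_cancel] at h1
  have h2 : |l| ^ p ≤ 2 ^ p * (c ^ p * |τ| ^ p) := by
    have : |l| ≤ 2 * (c * |τ|) := by
      rw [hl, abs_mul, abs_mul, abs_of_pos hc, abs_of_pos h2τ]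
      nlinarith [mul_nonneg hc.le (abs_nonneg τ)]
    calc |l| ^ p ≤ (2 * (c * |τ|)) ^ p := Real.rpow_le_rpow (abs_nonneg _) this (by linarith)
      _ = _ := by
        rw [Real.mul_rpow (by norm_num) (by positivity), Real.mul_rpow hc.le (abs_nonneg _)]
  have e4 : truncWeight p τ = |τ| ^ p := by rw [truncWeight, if_pos h]
  rw [e4]
  calc |l| ^ p * bregman p M (ψ • a + k • (d - ψ • a)) (ψ • a)
      ≤ 2 ^ p * (c ^ p * |τ| ^ p) * (C * bregman p M d (ψ • a)) :=
        mul_le_mul h2 h1 (bregman_nonneg hp hS hP _ _) (by positivity)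
    _ = _ := by ring

/-- The energy of a truncation is bounded by a weighted integral of the energy density of the
original function. -/
lemma IsPositiveSolution.exists_energy_truncation_le (hΩ : IsOpen Ω) (hp : 1 < p)
    (hA : IsEllipticMatrix Ω A) (hV : LocallyIntegrableOn V Ω)
    (hu : IsPositiveSolution p Ω A V u) :
    ∃ C : ℝ, 0 < C ∧ ∀ φ ∈ testSpace p Ω, ∀ c : ℝ, 0 < c →
      (∀ᵐ x ∂volume.restrict Ω,
        bregman p (A x) (weakGradient Ω (truncation u c φ) x)
          ((truncation u c φ x / u x) • weakGradient Ω u x) ≤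
        C * (c ^ p * truncWeight p (c * (φ x / u x)) * bregman p (A x) (weakGradient Ω φ x)
          ((φ x / u x) • weakGradient Ω u x))) ∧
      ENNReal.ofReal (energy p Ω A V (truncation u c φ)) ≤
        ENNReal.ofReal (C * c ^ p) * ∫⁻ x in Ω, ENNReal.ofReal (truncWeight p (c * (φ x / u x))) *
          ENNReal.ofReal (bregman p (A x) (weakGradient Ω φ x)
            ((φ x / u x) • weakGradient Ω u x)) := by
  obtain ⟨C, hC, H⟩ := exists_bregman_truncation_le hp
  refine ⟨C, hC, fun φ hφ c hc => ?_⟩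
  obtain ⟨hw, hwg⟩ := hu.truncation_mem_testSpace hΩ hφ c
  obtain ⟨hi, he⟩ := hu.energy_eq_integral_bregman hΩ hp hA hV hw
  have hae := hA.ae_symm_nonneg hΩ
  have hpt : ∀ᵐ x ∂volume.restrict Ω,
        bregman p (A x) (weakGradient Ω (truncation u c φ) x)
          ((truncation u c φ x / u x) • weakGradient Ω u x) ≤
        C * (c ^ p * truncWeight p (c * (φ x / u x)) * bregman p (A x) (weakGradient Ω φ x)
          ((φ x / u x) • weakGradient Ω u x)) := by
    filter_upwards [hwg, hae, ae_restrict_mem hΩ.measurableSet] with x hx hAx hxΩ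
    have hux := (hu.pos x hxΩ).ne'
    have e : truncation u c φ x / u x = truncProfile (c * (φ x / u x)) := by
      rw [truncation, mul_div_cancel_left₀ _ hux, mul_div_assoc]
    rw [hx, e, mul_div_assoc]
    exact H (A x) hAx.1 hAx.2 _ _ c _ hc
  refine ⟨hpt, ?_⟩
  rw [he, ofReal_integral_eq_lintegral_ofReal hi (by
    filter_upwards [hae] with x hx using bregman_nonneg hp hx.1 hx.2 _ _),
    ← lintegral_const_mul' _ _ ENNReal.ofReal_ne_top]
  refine lintegral_mono_ae ?_
  filter_upwards [hpt, hae] with x hx hAx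
  have h1 := truncWeight_nonneg p (c * (φ x / u x))
  have h2 : 0 ≤ c ^ p := Real.rpow_nonneg hc.le _
  rw [← ENNReal.ofReal_mul h1, ← ENNReal.ofReal_mul (by positivity)]
  refine ENNReal.ofReal_le_ofReal (hx.trans (le_of_eq ?_))
  ring

end Truncation

/-! ### Dyadic sums -/

section Dyadic

/-- A power is bounded by its dyadic layers. -/
lemma rpow_le_tsum_dyadic {p : ℝ} (hp : 0 < p) (t : ℝ) :
    ENNReal.ofReal (|t| ^ p) ≤
      ∑' k : ℤ, if (2 : ℝ) ^ k ≤ |t| then ENNReal.ofReal (((2 : ℝ) ^ (k + 1)) ^ p) else 0 := by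
  rcases eq_or_ne t 0 with rfl | ht
  · simp [Real.zero_rpow hp.ne']
  obtain ⟨n, hn⟩ := exists_mem_Ico_zpow (abs_pos.2 ht) (one_lt_two (α := ℝ))
  refine le_trans ?_ (ENNReal.le_tsum n)
  rw [if_pos hn.1]
  exact ENNReal.ofReal_le_ofReal (Real.rpow_le_rpow (abs_nonneg _) hn.2.le hp.le)

/-- The dyadic rescalings of `truncWeight` form a bounded sum. -/
lemma tsum_truncWeight_le {p : ℝ} (hp : 0 < p) (t : ℝ) :
    ∑' k : ℤ, ENNReal.ofReal (truncWeight p ((2 : ℝ) ^ (-k) * t)) ≤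
      (1 - ENNReal.ofReal ((2 : ℝ) ^ (-p)))⁻¹ := by
  rcases eq_or_ne t 0 with rfl | ht
  · simp [truncWeight, Real.zero_rpow hp.ne']
  obtain ⟨n, hn⟩ := exists_mem_Ico_zpow (abs_pos.2 ht) (one_lt_two (α := ℝ))
  have hinj : Function.Injective (fun j : ℕ => n + 1 + (j : ℤ)) := fun i j h => by
    simpa using h
  have habs : ∀ k : ℤ, |(2 : ℝ) ^ (-k) * t| = 2 ^ (-k) * |t| := fun k => by
    rw [abs_mul, abs_of_pos (by positivity)]
  rw [← hinj.tsum_eq, ← ENNReal.tsum_geometric]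
  · refine ENNReal.tsum_le_tsum fun j => ?_
    rw [← ENNReal.ofReal_pow (by positivity)]
    refine ENNReal.ofReal_le_ofReal ?_
    have h1 : |(2 : ℝ) ^ (-(n + 1 + (j : ℤ))) * t| ≤ 2 ^ (-(j : ℤ)) := by
      rw [habs]
      calc (2 : ℝ) ^ (-(n + 1 + (j : ℤ))) * |t|
          ≤ (2 : ℝ) ^ (-(n + 1 + (j : ℤ))) * 2 ^ (n + 1) := by gcongr; exact hn.2.le
        _ = 2 ^ (-(j : ℤ)) := by rw [← zpow_add₀ two_ne_zero]; congr 1; ring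
    have h2 : ((2 : ℝ) ^ (-p)) ^ j = (2 ^ (-(j : ℤ))) ^ p := by
      rw [← Real.rpow_natCast, ← Real.rpow_intCast, ← Real.rpow_mul zero_le_two,
        ← Real.rpow_mul zero_le_two]
      congr 1; push_cast; ring
    rw [h2, truncWeight]
    split_ifs
    · exact Real.rpow_le_rpow (abs_nonneg _) h1 hp.le
    · positivity
  · intro k hk
    by_contra hkn
    refine hk ?_
    have hle : k ≤ n := by
      by_contra hlt
      exact hkn ⟨(k - n - 1).toNat, by simp only; omega⟩
    have : ¬ |(2 : ℝ) ^ (-k) * t| < 1 := by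
      rw [habs, not_lt]
      calc (1 : ℝ) = 2 ^ (-k) * 2 ^ k := by rw [← zpow_add₀ two_ne_zero]; simp
        _ ≤ 2 ^ (-k) * 2 ^ n := by gcongr; exact one_le_two
        _ ≤ _ := by gcongr; exact hn.1
    simp only [truncWeight, if_neg this, ENNReal.ofReal_zero]

end Dyadic

/-! ### The capacitary criterion for Hardy-type inequalities -/

section Capacity

open scoped Topology
open Filter

variable {N : ℕ} {Ω : Set (EuclideanSpace ℝ (Fin N))} {p : ℝ}
  {A : EuclideanSpace ℝ (Fin N) → Matrix (Fin N) (Fin N) ℝ} {V : EuclideanSpace ℝ (Fin N) → ℝ}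
  {u : EuclideanSpace ℝ (Fin N) → ℝ}

local notation "𝔼" => EuclideanSpace ℝ (Fin N)

lemma capacity_le_energy (hQ : ∀ φ ∈ testSpace p Ω, 0 ≤ energy p Ω A V φ) {F : Set 𝔼}
    {φ : 𝔼 → ℝ} (hφ : φ ∈ testSpace p Ω) (hF : ∀ x ∈ F, u x ≤ φ x) :
    capacity p Ω A V u F ≤ energy p Ω A V φ :=
  csInf_le ⟨0, by rintro _ ⟨φ, hφ, rfl⟩; exact hQ φ hφ.1⟩ ⟨φ, ⟨hφ, hF⟩, rfl⟩

lemma integrableOn_abs_mul_rpow (hp : 0 < p) {g v : 𝔼 → ℝ} (hg : LocallyIntegrableOn g Ω)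
    (hv : ContinuousOn v Ω) {K : Set 𝔼} (hK : IsCompact K) (hKΩ : K ⊆ Ω) :
    IntegrableOn (fun x => |g x| * |v x| ^ p) K :=
  IntegrableOn.mul_continuousOn (hg.integrableOn_compact_subset hKΩ hK).abs
    ((hv.mono hKΩ).abs.rpow_const fun _ _ => Or.inr hp.le) hK

lemma integrableOn_abs_mul_rpow_testSpace (hp : 0 < p) {g φ : 𝔼 → ℝ}
    (hg : LocallyIntegrableOn g Ω) (hφ : φ ∈ testSpace p Ω) :
    IntegrableOn (fun x => |g x| * |φ x| ^ p) Ω := by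
  have h := integrableOn_abs_mul_rpow hp hg hφ.2.1.continuousOn hφ.2.2.1 hφ.2.2.2
  refine (h.integrable_of_forall_notMem_eq_zero fun x hx => ?_).integrableOn
  rw [image_eq_zero_of_notMem_tsupport hx, abs_zero, Real.zero_rpow hp.ne', mul_zero]

/-- When the norm is finite, it controls the weighted measure of each compact set. -/
lemma setLIntegral_le_hardyNorm_mul (hp : 0 < p) (hu : ContinuousOn u Ω) {g : 𝔼 → ℝ}
    (hg : LocallyIntegrableOn g Ω) (hfin : hardyNorm p Ω A V u g ≠ ∞) {F : Set 𝔼}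
    (hF : IsCompact F) (hFΩ : F ⊆ Ω) :
    ∫⁻ x in F, ENNReal.ofReal (|g x| * |u x| ^ p) ≤
      hardyNorm p Ω A V u g * ENNReal.ofReal (capacity p Ω A V u F) := by
  rw [← ofReal_integral_eq_lintegral_ofReal (integrableOn_abs_mul_rpow hp hg hu hF hFΩ)
    (ae_of_all _ fun x => by positivity)]
  have h : capacityQuotient p Ω A V u g F ≤ hardyNorm p Ω A V u g :=
    le_iSup₂ (f := fun F (_ : IsCompact F ∧ F ⊆ Ω) => capacityQuotient p Ω A V u g F) F ⟨hF, hFΩ⟩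
  exact (ENNReal.div_le_iff_le_mul (Or.inr hfin) (Or.inl ENNReal.ofReal_ne_top)).1 h

/-- Capacitary bounds on compact sets imply the Hardy-type inequality: the test function is split
into dyadic layers relative to the solution, and each layer is estimated by the energy of the
corresponding truncation. -/
lemma IsPositiveSolution.exists_lintegral_le_hardyNorm_mul_energy (hΩ : IsOpen Ω) (hp : 1 < p)
    (hA : IsEllipticMatrix Ω A) (hV : LocallyIntegrableOn V Ω)
    (hQ : ∀ φ ∈ testSpace p Ω, 0 ≤ energy p Ω A V φ)
    (hu : IsPositiveSolution p Ω A V u) :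
    ∃ C : ℝ, 0 < C ∧ ∀ g, LocallyIntegrableOn g Ω → hardyNorm p Ω A V u g ≠ ∞ →
      ∀ φ ∈ testSpace p Ω, ENNReal.ofReal (∫ x in Ω, |g x| * |φ x| ^ p) ≤
        ENNReal.ofReal C * hardyNorm p Ω A V u g * ENNReal.ofReal (energy p Ω A V φ) := by
  have hp0 : 0 < p := by linarith
  obtain ⟨C₁, hC₁, H⟩ := hu.exists_energy_truncation_le hΩ hp hA hV
  set S : ℝ≥0∞ := (1 - ENNReal.ofReal ((2 : ℝ) ^ (-p)))⁻¹ with hS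
  have hlt : ENNReal.ofReal ((2 : ℝ) ^ (-p)) < 1 := by
    rw [← ENNReal.ofReal_one]
    exact (ENNReal.ofReal_lt_ofReal_iff one_pos).2
      (Real.rpow_lt_one_of_one_lt_of_neg one_lt_two (by linarith))
  have hS_top : S ≠ ∞ := ENNReal.inv_ne_top.2 (tsub_pos_of_lt hlt).ne'
  have hS_pos : 0 < S.toReal := by
    refine ENNReal.toReal_pos (ENNReal.inv_ne_zero.2 ?_) hS_top
    exact ne_top_of_le_ne_top ENNReal.one_ne_top tsub_le_self
  refine ⟨2 ^ p * C₁ * S.toReal, by positivity, fun g hg hfin φ hφ => ?_⟩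
  set h := hardyNorm p Ω A V u g with hh
  obtain ⟨hi, he⟩ := hu.energy_eq_integral_bregman hΩ hp hA hV hφ
  set E : 𝔼 → ℝ≥0∞ := fun x => ENNReal.ofReal (bregman p (A x) (weakGradient Ω φ x)
    ((φ x / u x) • weakGradient Ω u x)) with hE
  have hEm : AEMeasurable E (volume.restrict Ω) := hi.aestronglyMeasurable.aemeasurable.ennreal_ofReal
  have heE : ENNReal.ofReal (energy p Ω A V φ) = ∫⁻ x in Ω, E x := by
    rw [he, ofReal_integral_eq_lintegral_ofReal hi]
    filter_upwards [hA.ae_symm_nonneg hΩ] with x hx using bregman_nonneg hp hx.1 hx.2 _ _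
  set F : ℤ → Set 𝔼 := fun k => tsupport φ ∩ {x | (2 : ℝ) ^ k * u x ≤ |φ x|} with hF
  have hFc : ∀ k, IsCompact (F k) := fun k => by
    refine hφ.2.2.1.of_isClosed_subset ?_ inter_subset_left
    have hcl : IsClosed (tsupport φ) := isClosed_tsupport φ
    have h1 : ContinuousOn (fun x => |φ x| - (2 : ℝ) ^ k * u x) (tsupport φ) :=
      hφ.2.1.abs.continuousOn.sub (continuousOn_const.mul (hu.continuousOn.mono hφ.2.2.2))
    have h2 := h1.preimage_isClosed_of_isClosed hcl (isClosed_Ici (a := (0 : ℝ)))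
    convert h2 using 1
    ext x; simp [hF]
  have hFΩ : ∀ k, F k ⊆ Ω := fun k => inter_subset_left.trans hφ.2.2.2
  have hFm : ∀ k, MeasurableSet (F k) := fun k => (hFc k).measurableSet
  have hgu : AEMeasurable (fun x => ENNReal.ofReal (|g x| * |u x| ^ p)) (volume.restrict Ω) := by
    have h1 : AEMeasurable g (volume.restrict Ω) := hg.aestronglyMeasurable.aemeasurable
    have h2 : AEMeasurable u (volume.restrict Ω) := hu.continuousOn.aemeasurable hΩ.measurableSet
    exact ((measurable_norm.comp_aemeasurable h1).mul
      ((measurable_norm.comp_aemeasurable h2).pow_const p)).ennreal_ofReal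
  have hφu : AEMeasurable (fun x => φ x / u x) (volume.restrict Ω) :=
    hφ.2.1.measurable.aemeasurable.div (hu.continuousOn.aemeasurable hΩ.measurableSet)
  have hWm : ∀ k : ℤ, AEMeasurable (fun x => ENNReal.ofReal
      (truncWeight p ((2 : ℝ) ^ (-k) * (φ x / u x)))) (volume.restrict Ω) := fun k =>
    ((measurable_truncWeight p).comp_aemeasurable (hφu.const_mul _)).ennreal_ofReal
  -- one dyadic layer
  have hlayer : ∀ k : ℤ, ENNReal.ofReal (((2 : ℝ) ^ (k + 1)) ^ p) *
      ∫⁻ x in F k, ENNReal.ofReal (|g x| * |u x| ^ p) ≤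
      ENNReal.ofReal (2 ^ p * C₁) * h * ∫⁻ x in Ω,
        ENNReal.ofReal (truncWeight p ((2 : ℝ) ^ (-k) * (φ x / u x))) * E x := fun k => by
    have hc : (0 : ℝ) < 2 ^ (-k) := by positivity
    have h1 : ENNReal.ofReal (capacity p Ω A V u (F k)) ≤
        ENNReal.ofReal (energy p Ω A V (truncation u (2 ^ (-k)) φ)) := by
      refine ENNReal.ofReal_le_ofReal (capacity_le_energy hQ
        (hu.truncation_mem_testSpace hΩ hφ _).1 fun x hx => ?_)
      refine (truncation_eq_of_one_le ?_).ge
      have hux := hu.pos x (hFΩ k hx)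
      rw [abs_div, abs_mul, abs_of_pos hc, abs_of_pos hux, le_div_iff₀ hux, one_mul]
      calc u x = 2 ^ (-k) * (2 ^ k * u x) := by
            rw [← mul_assoc, ← zpow_add₀ two_ne_zero]; simp
        _ ≤ _ := by gcongr; exact hx.2
    have h2 := h1.trans (H φ hφ _ hc).2
    have h3 := setLIntegral_le_hardyNorm_mul hp0 hu.continuousOn hg hfin (hFc k) (hFΩ k)
    have h4 : ((2 : ℝ) ^ (k + 1)) ^ p * (C₁ * ((2 : ℝ) ^ (-k)) ^ p) = 2 ^ p * C₁ := by
      have : ((2 : ℝ) ^ (k + 1)) ^ p * ((2 : ℝ) ^ (-k)) ^ p = 2 ^ p := by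
        rw [← Real.mul_rpow (by positivity) (by positivity), ← zpow_add₀ two_ne_zero]
        simp
      rw [← this]; ring
    calc _ ≤ ENNReal.ofReal (((2 : ℝ) ^ (k + 1)) ^ p) * (h * (ENNReal.ofReal
          (C₁ * ((2 : ℝ) ^ (-k)) ^ p) * ∫⁻ x in Ω,
          ENNReal.ofReal (truncWeight p ((2 : ℝ) ^ (-k) * (φ x / u x))) * E x)) := by
          gcongr
          exact h3.trans (by gcongr)
      _ = _ := by
          rw [← h4, ENNReal.ofReal_mul (p := ((2 : ℝ) ^ (k + 1)) ^ p) (by positivity)]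
          ring
  have hpt : ∀ x ∈ Ω, ENNReal.ofReal (|g x| * |φ x| ^ p) ≤
      ∑' k : ℤ, (F k).indicator (fun x => ENNReal.ofReal (((2 : ℝ) ^ (k + 1)) ^ p) *
        ENNReal.ofReal (|g x| * |u x| ^ p)) x := fun x hx => by
    have hux := hu.pos x hx
    have h1 : |g x| * |φ x| ^ p = |φ x / u x| ^ p * (|g x| * |u x| ^ p) := by
      rw [abs_div, Real.div_rpow (abs_nonneg _) (abs_nonneg _)]
      have : |u x| ^ p ≠ 0 := (Real.rpow_pos_of_pos (abs_pos.2 hux.ne') _).ne'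
      field_simp
    rw [h1, ENNReal.ofReal_mul (by positivity)]
    refine (mul_le_mul_left (rpow_le_tsum_dyadic hp0 (φ x / u x)) _).trans ?_
    rw [← ENNReal.tsum_mul_right]
    refine ENNReal.tsum_le_tsum fun k => ?_
    split_ifs with hk
    · have h2 : (2 : ℝ) ^ k * u x ≤ |φ x| := by
        rwa [abs_div, abs_of_pos hux, le_div_iff₀ hux] at hk
      have h3 : x ∈ tsupport φ := by
        refine subset_tsupport φ fun h0 => ?_
        rw [h0, abs_zero] at h2
        have : 0 < (2 : ℝ) ^ k * u x := by positivity
        linarith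
      rw [indicator_of_mem (show x ∈ F k from ⟨h3, h2⟩)]
    · simp
  rw [ofReal_integral_eq_lintegral_ofReal (integrableOn_abs_mul_rpow_testSpace hp0 hg hφ)
    (ae_of_all _ fun x => by positivity)]
  calc ∫⁻ x in Ω, ENNReal.ofReal (|g x| * |φ x| ^ p)
      ≤ ∫⁻ x in Ω, ∑' k : ℤ, (F k).indicator (fun x => ENNReal.ofReal (((2 : ℝ) ^ (k + 1)) ^ p) *
        ENNReal.ofReal (|g x| * |u x| ^ p)) x := setLIntegral_mono' hΩ.measurableSet hpt
    _ = ∑' k : ℤ, ENNReal.ofReal (((2 : ℝ) ^ (k + 1)) ^ p) *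
          ∫⁻ x in F k, ENNReal.ofReal (|g x| * |u x| ^ p) := by
        rw [lintegral_tsum fun k => (hgu.const_mul _).indicator (hFm k)]
        refine tsum_congr fun k => ?_
        rw [lintegral_indicator (hFm k), Measure.restrict_restrict (hFm k),
          inter_eq_left.2 (hFΩ k), lintegral_const_mul' _ _ ENNReal.ofReal_ne_top]
    _ ≤ ∑' k : ℤ, ENNReal.ofReal (2 ^ p * C₁) * h * ∫⁻ x in Ω,
          ENNReal.ofReal (truncWeight p ((2 : ℝ) ^ (-k) * (φ x / u x))) * E x :=
        ENNReal.tsum_le_tsum hlayer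
    _ = ENNReal.ofReal (2 ^ p * C₁) * h * ∫⁻ x in Ω, (∑' k : ℤ,
          ENNReal.ofReal (truncWeight p ((2 : ℝ) ^ (-k) * (φ x / u x)))) * E x := by
        simp_rw [← ENNReal.tsum_mul_right]
        rw [ENNReal.tsum_mul_left, lintegral_tsum fun k => (hWm k).fun_mul hEm]
    _ ≤ ENNReal.ofReal (2 ^ p * C₁) * h * ∫⁻ x in Ω, S * E x := by
        gcongr
        exact tsum_truncWeight_le hp0 _
    _ = _ := by
        rw [lintegral_const_mul' _ _ hS_top, ← heE, ENNReal.ofReal_mul (q := S.toReal)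
          (by positivity), ENNReal.ofReal_toReal hS_top]
        ring

/-- A two-sided comparison of the capacitary norm with the best constant. -/
lemma IsPositiveSolution.exists_bestConstant_le (hΩ : IsOpen Ω) (hp : 1 < p)
    (hA : IsEllipticMatrix Ω A) (hV : LocallyIntegrableOn V Ω)
    (hQ : ∀ φ ∈ testSpace p Ω, 0 ≤ energy p Ω A V φ)
    (hu : IsPositiveSolution p Ω A V u) :
    ∃ C : ℝ, 0 < C ∧ ∀ g, LocallyIntegrableOn g Ω →
      (hardyNorm p Ω A V u g ≠ ∞ → ∃ C : ℝ, 0 < C ∧ HardyInequality p Ω A V g C) ∧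
      bestConstant p Ω A V g ≤ ENNReal.ofReal C * hardyNorm p Ω A V u g := by
  obtain ⟨C, hC, H⟩ := hu.exists_lintegral_le_hardyNorm_mul_energy hΩ hp hA hV hQ
  refine ⟨C, hC, fun g hg => ?_⟩
  by_cases hfin : hardyNorm p Ω A V u g = ∞
  · simp [hfin, hC]
  have key : ∀ D : ℝ, ENNReal.ofReal C * hardyNorm p Ω A V u g < ENNReal.ofReal D →
      0 < D ∧ HardyInequality p Ω A V g D := fun D hD => by
    have hD0 : 0 < D := ENNReal.ofReal_pos.1 (bot_le.trans_lt hD)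
    refine ⟨hD0, fun φ hφ => ?_⟩
    rw [← ENNReal.ofReal_le_ofReal_iff (mul_nonneg hD0.le (hQ φ hφ)), ENNReal.ofReal_mul hD0.le]
    exact (H g hg hfin φ hφ).trans (by gcongr)
  have hne : ENNReal.ofReal C * hardyNorm p Ω A V u g ≠ ∞ :=
    ENNReal.mul_ne_top ENNReal.ofReal_ne_top hfin
  refine ⟨fun _ => ?_, ?_⟩
  · refine ⟨(ENNReal.ofReal C * hardyNorm p Ω A V u g).toReal + 1, key _ ?_⟩
    rw [ENNReal.lt_ofReal_iff_toReal_lt hne]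
    linarith
  · refine le_of_forall_gt_imp_ge_of_dense fun D hD => ?_
    rcases eq_or_ne D ∞ with rfl | hDt
    · exact le_top
    have h1 := key D.toReal (by rwa [ENNReal.ofReal_toReal hDt])
    exact (iInf₂_le D.toReal h1).trans (ENNReal.ofReal_toReal_le)

lemma exists_testSpace_ge (hΩ : IsOpen Ω) (hu : ContinuousOn u Ω) {F : Set 𝔼} (hF : IsCompact F)
    (hFΩ : F ⊆ Ω) : ∃ φ ∈ testSpace p Ω, ∀ x ∈ F, u x ≤ φ x := by
  obtain ⟨M, hM⟩ := hF.bddAbove_image (hu.mono hFΩ)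
  obtain ⟨χ, hχ, -, U, -, hFU, hU⟩ := exists_testFunction_eq_one hΩ hF hFΩ
  have h1 : IsTestFunction Ω (fun x => M * χ x) :=
    ⟨contDiff_const.mul hχ.1, hχ.2.1.mul_left,
      tsupport_mul_subset_right.trans hχ.2.2⟩
  refine ⟨_, (mem_testSpace_of_isTestFunction hΩ h1).1, fun x hx => ?_⟩
  simp only [hU x (hFU hx), mul_one]
  exact hM (mem_image_of_mem u hx)

lemma HardyInequality.setIntegral_le (hΩ : IsOpen Ω) (hp : 0 < p)
    (hu : ContinuousOn u Ω) (hpos : ∀ x ∈ Ω, 0 < u x) {g : 𝔼 → ℝ}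
    (hg : LocallyIntegrableOn g Ω) {C : ℝ} (hC : 0 < C) (h : HardyInequality p Ω A V g C)
    {F : Set 𝔼} (hF : IsCompact F) (hFΩ : F ⊆ Ω) :
    ∫ x in F, |g x| * |u x| ^ p ≤ C * capacity p Ω A V u F := by
  rw [mul_comm, ← div_le_iff₀ hC]
  obtain ⟨φ₀, hφ₀, hF₀⟩ := exists_testSpace_ge (p := p) hΩ hu hF hFΩ
  refine le_csInf ⟨_, φ₀, ⟨hφ₀, hF₀⟩, rfl⟩ ?_
  rintro _ ⟨φ, ⟨hφ, hFφ⟩, rfl⟩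
  rw [div_le_iff₀' hC]
  refine le_trans ?_ (h φ hφ)
  have hi := integrableOn_abs_mul_rpow_testSpace hp hg hφ
  calc ∫ x in F, |g x| * |u x| ^ p ≤ ∫ x in F, |g x| * |φ x| ^ p := by
        refine setIntegral_mono_on (integrableOn_abs_mul_rpow hp hg hu hF hFΩ)
          (hi.mono_set hFΩ) hF.measurableSet fun x hx => ?_
        have h0 := hpos x (hFΩ hx)
        rw [abs_of_pos h0]
        gcongr
        exact (hFφ x hx).trans (le_abs_self _)
    _ ≤ _ := setIntegral_mono_set hi (ae_of_all _ fun x => by positivity) hFΩ.eventuallyLE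

lemma HardyInequality.hardyNorm_le (hΩ : IsOpen Ω) (hp : 0 < p)
    (hu : ContinuousOn u Ω) (hpos : ∀ x ∈ Ω, 0 < u x) {g : 𝔼 → ℝ}
    (hg : LocallyIntegrableOn g Ω) {C : ℝ} (hC : 0 < C) (h : HardyInequality p Ω A V g C) :
    hardyNorm p Ω A V u g ≤ ENNReal.ofReal C := by
  refine iSup₂_le fun F hF => ENNReal.div_le_of_le_mul ?_
  rw [← ENNReal.ofReal_mul hC.le]
  exact ENNReal.ofReal_le_ofReal (h.setIntegral_le hΩ hp hu hpos hg hC hF.1 hF.2)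

lemma hardyNorm_le_bestConstant (hΩ : IsOpen Ω) (hp : 0 < p)
    (hu : ContinuousOn u Ω) (hpos : ∀ x ∈ Ω, 0 < u x) {g : 𝔼 → ℝ}
    (hg : LocallyIntegrableOn g Ω) :
    hardyNorm p Ω A V u g ≤ bestConstant p Ω A V g :=
  le_iInf₂ fun _ hC => hC.2.hardyNorm_le hΩ hp hu hpos hg hC.1

end Capacity

/-! ### The space of Hardy weights and its norms -/

section Norms

variable {N : ℕ} {Ω : Set (EuclideanSpace ℝ (Fin N))} {p : ℝ}
  {A : EuclideanSpace ℝ (Fin N) → Matrix (Fin N) (Fin N) ℝ} {V : EuclideanSpace ℝ (Fin N) → ℝ}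
  {u : EuclideanSpace ℝ (Fin N) → ℝ}

local notation "𝔼" => EuclideanSpace ℝ (Fin N)

lemma HardyInequality.mono (hQ : ∀ φ ∈ testSpace p Ω, 0 ≤ energy p Ω A V φ) {g : 𝔼 → ℝ} {C D : ℝ}
    (h : HardyInequality p Ω A V g C) (hCD : C ≤ D) : HardyInequality p Ω A V g D :=
  fun φ hφ => (h φ hφ).trans (mul_le_mul_of_nonneg_right hCD (hQ φ hφ))

lemma HardyInequality.add (hp : 0 < p) {g h : 𝔼 → ℝ} (hg : LocallyIntegrableOn g Ω)
    (hh : LocallyIntegrableOn h Ω) {C D : ℝ} (hgC : HardyInequality p Ω A V g C)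
    (hhD : HardyInequality p Ω A V h D) : HardyInequality p Ω A V (g + h) (C + D) := by
  intro φ hφ
  have h1 := integrableOn_abs_mul_rpow_testSpace hp hg hφ
  have h2 := integrableOn_abs_mul_rpow_testSpace hp hh hφ
  calc ∫ x in Ω, |(g + h) x| * |φ x| ^ p
      ≤ ∫ x in Ω, (|g x| * |φ x| ^ p + |h x| * |φ x| ^ p) := by
        refine integral_mono (integrableOn_abs_mul_rpow_testSpace hp (hg.add hh) hφ) (h1.add h2)
          fun x => ?_
        simp only [Pi.add_apply]
        rw [← add_mul]
        gcongr
        exact abs_add_le _ _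
    _ = _ := integral_add h1 h2
    _ ≤ _ := by rw [add_mul]; exact add_le_add (hgC φ hφ) (hhD φ hφ)

lemma HardyInequality.smul {g : 𝔼 → ℝ} {C : ℝ} (hg : HardyInequality p Ω A V g C) (c : ℝ) :
    HardyInequality p Ω A V (c • g) (|c| * C) := by
  intro φ hφ
  have : ∀ x, |(c • g) x| * |φ x| ^ p = |c| * (|g x| * |φ x| ^ p) := fun x => by
    simp only [Pi.smul_apply, smul_eq_mul, abs_mul]; ring
  simp_rw [this]
  rw [integral_const_mul, mul_assoc]
  exact mul_le_mul_of_nonneg_left (hg φ hφ) (abs_nonneg c)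

lemma HardyInequality.congr {g h : 𝔼 → ℝ} {C : ℝ} (hg : HardyInequality p Ω A V g C)
    (hgh : g =ᵐ[volume.restrict Ω] h) : HardyInequality p Ω A V h C := by
  intro φ hφ
  refine (integral_congr_ae ?_).trans_le (hg φ hφ)
  filter_upwards [hgh] with x hx
  rw [hx]

/-- The infimum defining the best constant is attained. -/
lemma bestConstant_le_ofReal_iff (hQ : ∀ φ ∈ testSpace p Ω, 0 ≤ energy p Ω A V φ) {g : 𝔼 → ℝ}
    {C : ℝ} (hC : 0 ≤ C) :
    bestConstant p Ω A V g ≤ ENNReal.ofReal C ↔ HardyInequality p Ω A V g C := by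
  constructor
  · intro h φ hφ
    have hE := hQ φ hφ
    refine le_of_forall_pos_le_add fun δ hδ => ?_
    set ε := δ / (energy p Ω A V φ + 1) with hε
    have hε0 : 0 < ε := by positivity
    have h1 : bestConstant p Ω A V g < ENNReal.ofReal (C + ε) :=
      h.trans_lt ((ENNReal.ofReal_lt_ofReal_iff (by positivity)).2 (by linarith))
    simp only [bestConstant, iInf_lt_iff] at h1
    obtain ⟨D, hD, hlt⟩ := h1
    have hDC := (ENNReal.ofReal_lt_ofReal_iff (by positivity)).1 hlt
    have h2 := (hD.2.mono hQ hDC.le) φ hφ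
    have h3 : ε * energy p Ω A V φ ≤ δ := by
      rw [hε, div_mul_eq_mul_div, div_le_iff₀ (by positivity)]
      nlinarith
    linarith
  · intro h
    refine ENNReal.le_of_forall_pos_le_add fun ε hε _ => ?_
    have hε' : (0 : ℝ) < ε := hε
    have h1 : bestConstant p Ω A V g ≤ ENNReal.ofReal (C + ε) :=
      iInf₂_le (C + ε) ⟨by positivity, h.mono hQ (by linarith)⟩
    rwa [ENNReal.ofReal_add hC hε'.le, ENNReal.ofReal_coe_nnreal] at h1

lemma bestConstant_lt_top {g : 𝔼 → ℝ} (hg : g ∈ hardySpace p Ω A V) :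
    bestConstant p Ω A V g < ∞ := by
  obtain ⟨-, C, hC⟩ := hg
  exact (iInf₂_le C hC).trans_lt ENNReal.ofReal_lt_top

lemma hardyInequality_bestConstant (hQ : ∀ φ ∈ testSpace p Ω, 0 ≤ energy p Ω A V φ) {g : 𝔼 → ℝ}
    (hg : g ∈ hardySpace p Ω A V) :
    HardyInequality p Ω A V g (bestConstant p Ω A V g).toReal := by
  rw [← bestConstant_le_ofReal_iff hQ ENNReal.toReal_nonneg,
    ENNReal.ofReal_toReal (bestConstant_lt_top hg).ne]

lemma bestConstant_congr {g h : 𝔼 → ℝ} (hgh : g =ᵐ[volume.restrict Ω] h) :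
    bestConstant p Ω A V g = bestConstant p Ω A V h := by
  have : ∀ C, HardyInequality p Ω A V g C ↔ HardyInequality p Ω A V h C := fun C =>
    ⟨fun H => H.congr hgh, fun H => H.congr hgh.symm⟩
  simp only [bestConstant, this]

lemma bestConstant_add_le (hp : 0 < p) (hQ : ∀ φ ∈ testSpace p Ω, 0 ≤ energy p Ω A V φ)
    {g h : 𝔼 → ℝ} (hg : g ∈ hardySpace p Ω A V) (hh : h ∈ hardySpace p Ω A V) :
    bestConstant p Ω A V (g + h) ≤ bestConstant p Ω A V g + bestConstant p Ω A V h := by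
  have h1 := (hardyInequality_bestConstant hQ hg).add hp hg.1 hh.1
    (hardyInequality_bestConstant hQ hh)
  rw [← bestConstant_le_ofReal_iff hQ (by positivity), ENNReal.ofReal_add (by positivity)
    (by positivity), ENNReal.ofReal_toReal (bestConstant_lt_top hg).ne,
    ENNReal.ofReal_toReal (bestConstant_lt_top hh).ne] at h1
  exact h1

lemma hardyInequality_zero : HardyInequality p Ω A V (0 : 𝔼 → ℝ) 0 := by
  intro φ _
  simp

lemma bestConstant_zero (hQ : ∀ φ ∈ testSpace p Ω, 0 ≤ energy p Ω A V φ) :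
    bestConstant p Ω A V (0 : 𝔼 → ℝ) = 0 := by
  have := (bestConstant_le_ofReal_iff hQ le_rfl).2 (hardyInequality_zero (A := A) (V := V))
  simpa using this

lemma smul_mem_hardySpace {g : 𝔼 → ℝ} (hg : g ∈ hardySpace p Ω A V)
    (hQ : ∀ φ ∈ testSpace p Ω, 0 ≤ energy p Ω A V φ) (c : ℝ) :
    c • g ∈ hardySpace p Ω A V := by
  obtain ⟨hgl, C, hC, h⟩ := hg
  exact ⟨hgl.smul c, |c| * C + 1, by positivity, (h.smul c).mono hQ (by linarith)⟩

lemma bestConstant_smul_le (hQ : ∀ φ ∈ testSpace p Ω, 0 ≤ energy p Ω A V φ) {g : 𝔼 → ℝ}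
    (hg : g ∈ hardySpace p Ω A V) (c : ℝ) :
    bestConstant p Ω A V (c • g) ≤ ENNReal.ofReal |c| * bestConstant p Ω A V g := by
  have h1 := (hardyInequality_bestConstant hQ hg).smul c
  rwa [← bestConstant_le_ofReal_iff hQ (by positivity), ENNReal.ofReal_mul (abs_nonneg c),
    ENNReal.ofReal_toReal (bestConstant_lt_top hg).ne] at h1

lemma bestConstant_smul (hQ : ∀ φ ∈ testSpace p Ω, 0 ≤ energy p Ω A V φ) {g : 𝔼 → ℝ}
    (hg : g ∈ hardySpace p Ω A V) (c : ℝ) :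
    bestConstant p Ω A V (c • g) = ENNReal.ofReal |c| * bestConstant p Ω A V g := by
  refine le_antisymm (bestConstant_smul_le hQ hg c) ?_
  rcases eq_or_ne c 0 with rfl | hc
  · simp
  have h1 := bestConstant_smul_le hQ (smul_mem_hardySpace hg hQ c) c⁻¹
  rw [inv_smul_smul₀ hc] at h1
  calc _ ≤ ENNReal.ofReal |c| * (ENNReal.ofReal |c⁻¹| * bestConstant p Ω A V (c • g)) := by gcongr
    _ = _ := by
      rw [← mul_assoc, ← ENNReal.ofReal_mul (abs_nonneg c), ← abs_mul, mul_inv_cancel₀ hc]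
      simp

lemma hardyNorm_congr {g h : 𝔼 → ℝ} (hgh : g =ᵐ[volume.restrict Ω] h) :
    hardyNorm p Ω A V u g = hardyNorm p Ω A V u h := by
  refine iSup_congr fun F => iSup_congr fun hF => ?_
  have : ∫ x in F, |g x| * |u x| ^ p = ∫ x in F, |h x| * |u x| ^ p := by
    refine integral_congr_ae ?_
    filter_upwards [ae_restrict_of_ae_restrict_of_subset hF.2 hgh] with x hx
    rw [hx]
  rw [capacityQuotient, capacityQuotient, this]

lemma hardyNorm_smul (c : ℝ) (g : 𝔼 → ℝ) :
    hardyNorm p Ω A V u (c • g) = ENNReal.ofReal |c| * hardyNorm p Ω A V u g := by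
  simp only [hardyNorm, ENNReal.mul_iSup]
  refine iSup_congr fun F => iSup_congr fun hF => ?_
  have : ∀ x, |(c • g) x| * |u x| ^ p = |c| * (|g x| * |u x| ^ p) := fun x => by
    simp only [Pi.smul_apply, smul_eq_mul, abs_mul]; ring
  simp_rw [capacityQuotient, this]
  rw [integral_const_mul, ENNReal.ofReal_mul (abs_nonneg c), mul_div_assoc]

lemma hardyNorm_add_le (hp : 0 < p) (hu : ContinuousOn u Ω) {g h : 𝔼 → ℝ}
    (hg : LocallyIntegrableOn g Ω) (hh : LocallyIntegrableOn h Ω) :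
    hardyNorm p Ω A V u (g + h) ≤ hardyNorm p Ω A V u g + hardyNorm p Ω A V u h := by
  refine iSup₂_le fun F hF => ?_
  have h1 := integrableOn_abs_mul_rpow hp hg hu hF.1 hF.2
  have h2 := integrableOn_abs_mul_rpow hp hh hu hF.1 hF.2
  have h3 : ∫ x in F, |(g + h) x| * |u x| ^ p ≤
      (∫ x in F, |g x| * |u x| ^ p) + ∫ x in F, |h x| * |u x| ^ p := by
    rw [← integral_add h1 h2]
    refine integral_mono (integrableOn_abs_mul_rpow hp (hg.add hh) hu hF.1 hF.2) (h1.add h2)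
      fun x => ?_
    simp only [Pi.add_apply]
    rw [← add_mul]
    gcongr
    exact abs_add_le _ _
  have h4 : capacityQuotient p Ω A V u (g + h) F ≤
      capacityQuotient p Ω A V u g F + capacityQuotient p Ω A V u h F := by
    rw [capacityQuotient, capacityQuotient, capacityQuotient, ← ENNReal.add_div]
    exact ENNReal.div_le_div_right ((ENNReal.ofReal_le_ofReal h3).trans ENNReal.ofReal_add_le) _
  refine h4.trans (add_le_add ?_ ?_)
  · exact le_iSup₂ (f := fun F (_ : IsCompact F ∧ F ⊆ Ω) => capacityQuotient p Ω A V u g F) F hF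
  · exact le_iSup₂ (f := fun F (_ : IsCompact F ∧ F ⊆ Ω) => capacityQuotient p Ω A V u h F) F hF

lemma ae_eq_zero_of_hardyNorm_eq_zero (hΩ : IsOpen Ω) (hp : 0 < p) (hu : ContinuousOn u Ω)
    (hpos : ∀ x ∈ Ω, 0 < u x) {g : 𝔼 → ℝ} (hg : LocallyIntegrableOn g Ω)
    (h : hardyNorm p Ω A V u g = 0) : g =ᵐ[volume.restrict Ω] 0 := by
  refine ae_restrict_of_forall_isCompact hΩ fun K hK hKΩ => ?_
  have h1 := setLIntegral_le_hardyNorm_mul (A := A) (V := V) hp hu hg (by simp [h]) hK hKΩ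
  rw [h, zero_mul, nonpos_iff_eq_zero, lintegral_eq_zero_iff' (integrableOn_abs_mul_rpow hp hg hu
    hK hKΩ).aestronglyMeasurable.aemeasurable.ennreal_ofReal] at h1
  filter_upwards [h1, ae_restrict_mem hK.measurableSet] with x hx hxK
  have hux := hpos x (hKΩ hxK)
  have h2 : |g x| * |u x| ^ p ≤ 0 := ENNReal.ofReal_eq_zero.1 hx
  have h3 : 0 < |u x| ^ p := Real.rpow_pos_of_pos (abs_pos.2 hux.ne') _
  have h4 : |g x| ≤ 0 := by
    by_contra hlt
    push Not at hlt
    nlinarith [mul_pos hlt h3]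
  simpa using h4

lemma LocallyIntegrableOn.congr_ae_restrict (hΩ : IsOpen Ω) {g h : 𝔼 → ℝ}
    (hg : LocallyIntegrableOn g Ω) (hgh : g =ᵐ[volume.restrict Ω] h) :
    LocallyIntegrableOn h Ω := by
  rw [locallyIntegrableOn_iff hΩ.isLocallyClosed] at hg ⊢
  exact fun K hKΩ hK => (hg K hKΩ hK).congr_fun_ae
    (ae_restrict_of_ae_restrict_of_subset hKΩ hgh)

/-- Any positively homogeneous, subadditive quantity on the space of Hardy weights that is squeezed
between the capacitary norm and the best constant is a norm. -/
lemma isNormOn_hardySpace (hΩ : IsOpen Ω) (hp : 0 < p) (hu : ContinuousOn u Ω)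
    (hpos : ∀ x ∈ Ω, 0 < u x) (hQ : ∀ φ ∈ testSpace p Ω, 0 ≤ energy p Ω A V φ)
    {ν : (𝔼 → ℝ) → ℝ≥0∞}
    (hν₁ : ∀ g ∈ hardySpace p Ω A V, hardyNorm p Ω A V u g ≤ ν g)
    (hν₂ : ∀ g ∈ hardySpace p Ω A V, ν g ≤ bestConstant p Ω A V g)
    (hcongr : ∀ g h, g =ᵐ[volume.restrict Ω] h → ν g = ν h)
    (hsmul : ∀ c : ℝ, ∀ g ∈ hardySpace p Ω A V, ν (c • g) = ENNReal.ofReal |c| * ν g)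
    (hadd : ∀ g ∈ hardySpace p Ω A V, ∀ h ∈ hardySpace p Ω A V, ν (g + h) ≤ ν g + ν h) :
    IsNormOn Ω (hardySpace p Ω A V) ν := by
  have h0 : (0 : 𝔼 → ℝ) ∈ hardySpace p Ω A V :=
    ⟨locallyIntegrableOn_zero, 1, one_pos, hardyInequality_zero.mono hQ zero_le_one⟩
  refine ⟨h0, ?_, fun c g hg => smul_mem_hardySpace hg hQ c, ?_, fun g _ h => hcongr g h,
    fun g hg => (hν₂ g hg).trans_lt (bestConstant_lt_top hg), ?_, hsmul, hadd⟩
  · rintro g ⟨hg, C, hC, hgC⟩ h ⟨hh, D, hD, hhD⟩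
    exact ⟨hg.add hh, C + D, by positivity, hgC.add hp hg hh hhD⟩
  · rintro g ⟨hg, C, hC, hgC⟩ h hgh
    exact ⟨LocallyIntegrableOn.congr_ae_restrict hΩ hg hgh, C, hC, hgC.congr hgh⟩
  · intro g hg
    constructor
    · intro h
      exact ae_eq_zero_of_hardyNorm_eq_zero hΩ hp hu hpos hg.1
        (nonpos_iff_eq_zero.1 ((hν₁ g hg).trans h.le))
    · intro h
      rw [hcongr g 0 h]
      exact nonpos_iff_eq_zero.1 ((hν₂ 0 h0).trans (bestConstant_zero hQ).le)

end Norms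

/-! ### A Poincaré inequality on balls -/

section Poincare

open scoped Topology ContDiff
open Filter

variable {N : ℕ} {Ω : Set (EuclideanSpace ℝ (Fin N))}

local notation "𝔼" => EuclideanSpace ℝ (Fin N)

lemma enorm_sub_le_lintegral_gradient {F : 𝔼 → ℝ} (hF : ContDiff ℝ ∞ F) (x h : 𝔼) :
    ‖F (x + h) - F x‖ₑ ≤ ∫⁻ t in Ioc (0 : ℝ) 1, ‖h‖ₑ * ‖gradient F (x + t • h)‖ₑ := by
  have hd : ∀ t : ℝ, HasDerivAt (fun t : ℝ => F (x + t • h))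
      (inner ℝ (gradient F (x + t • h)) h) t := fun t => by
    have h1 : HasDerivAt (fun t : ℝ => x + t • h) h t := by
      simpa using ((hasDerivAt_id t).smul_const h).const_add x
    have h2 := ((hF.differentiable (by simp)) (x + t • h)).hasFDerivAt
    exact (h2.comp_hasDerivAt t h1).congr_deriv (by simp)
  have hc : Continuous fun t : ℝ => inner ℝ (gradient F (x + t • h)) h :=
    ((continuous_gradient_of_contDiff hF).comp (by fun_prop)).inner continuous_const
  have h1 := intervalIntegral.integral_eq_sub_of_hasDerivAt (a := 0) (b := 1) (fun t _ => hd t)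
    (hc.intervalIntegrable 0 1)
  rw [one_smul, zero_smul, add_zero, intervalIntegral.integral_of_le zero_le_one] at h1
  rw [← h1]
  refine (enorm_integral_le_lintegral_enorm _).trans (lintegral_mono fun t => ?_)
  rw [mul_comm, ← enorm_norm h, ← enorm_norm (gradient F (x + t • h)), ← enorm_mul]
  refine enorm_le_iff_norm_le.2 ?_
  rw [norm_mul, norm_norm, norm_norm]
  exact norm_inner_le_norm _ _

/-- The `L^1` Poincaré inequality on a ball, for smooth functions. Writing `y = x + h`, the integral
over `x` for fixed `h` is estimated by translation invariance, since the segment from `x` to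
`x + h` stays in the ball. -/
lemma lintegral_lintegral_enorm_sub_le_of_contDiff {F : 𝔼 → ℝ} (hF : ContDiff ℝ ∞ F) (x₀ : 𝔼)
    (r : ℝ) :
    ∫⁻ x in Metric.ball x₀ r, ∫⁻ y in Metric.ball x₀ r, ‖F y - F x‖ₑ ≤
      ENNReal.ofReal (2 * r) * volume (Metric.ball (0 : 𝔼) (2 * r)) *
        ∫⁻ x in Metric.ball x₀ r, ‖gradient F x‖ₑ := by
  set B := Metric.ball x₀ r with hB
  set D := Metric.ball (0 : 𝔼) (2 * r) with hD
  have hBm : MeasurableSet B := Metric.isOpen_ball.measurableSet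
  have hDm : MeasurableSet D := Metric.isOpen_ball.measurableSet
  set Φ : 𝔼 → ℝ≥0∞ := B.indicator fun z => ‖gradient F z‖ₑ with hΦ
  have hΦm : Measurable Φ :=
    (continuous_gradient_of_contDiff hF).measurable.enorm.indicator hBm
  set c := ENNReal.ofReal (2 * r) with hc
  have hpt : ∀ x ∈ B, ∀ h : 𝔼, B.indicator (fun y => ‖F y - F x‖ₑ) (x + h) ≤
      D.indicator (fun h => ∫⁻ t in Ioc (0 : ℝ) 1, c * Φ (x + t • h)) h := by
    intro x hx h
    by_cases hxh : x + h ∈ B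
    · have hhn : ‖h‖ < 2 * r := by
        have h1 : ‖h‖ = dist (x + h) x := by rw [dist_eq_norm, add_sub_cancel_left]
        rw [h1]
        have := dist_triangle_right (x + h) x x₀
        rw [hB, Metric.mem_ball] at hx hxh
        linarith
      rw [indicator_of_mem hxh, indicator_of_mem (by simpa [hD] using hhn)]
      refine (enorm_sub_le_lintegral_gradient hF x h).trans
        (setLIntegral_mono' measurableSet_Ioc fun t ht => ?_)
      have hmem : x + t • h ∈ B := by
        have := (convex_ball x₀ r).add_smul_sub_mem hx hxh ⟨ht.1.le, ht.2⟩
        rwa [add_sub_cancel_left] at this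
      rw [hΦ, indicator_of_mem hmem]
      gcongr
      rw [hc, ← ofReal_norm]
      exact ENNReal.ofReal_le_ofReal hhn.le
    · rw [indicator_of_notMem hxh]
      exact bot_le
  have hm3 : Measurable fun q : (𝔼 × 𝔼) × ℝ => c * Φ (q.1.1 + q.2 • q.1.2) :=
    (hΦm.comp (by fun_prop)).const_mul c
  calc ∫⁻ x in B, ∫⁻ y in B, ‖F y - F x‖ₑ
      = ∫⁻ x in B, ∫⁻ h, B.indicator (fun y => ‖F y - F x‖ₑ) (x + h) := by
        refine lintegral_congr fun x => ?_
        rw [lintegral_add_left_eq_self (B.indicator fun y => ‖F y - F x‖ₑ) x,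
          lintegral_indicator hBm]
    _ ≤ ∫⁻ x in B, ∫⁻ h in D, ∫⁻ t in Ioc (0 : ℝ) 1, c * Φ (x + t • h) := by
        refine setLIntegral_mono' hBm fun x hx => ?_
        rw [← lintegral_indicator hDm]
        exact lintegral_mono (hpt x hx)
    _ ≤ ∫⁻ x, ∫⁻ h in D, ∫⁻ t in Ioc (0 : ℝ) 1, c * Φ (x + t • h) := setLIntegral_le_lintegral _ _
    _ = ∫⁻ h in D, ∫⁻ x, ∫⁻ t in Ioc (0 : ℝ) 1, c * Φ (x + t • h) :=
        lintegral_lintegral_swap hm3.lintegral_prod_right'.aemeasurable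
    _ = ∫⁻ h in D, ∫⁻ t in Ioc (0 : ℝ) 1, ∫⁻ x, c * Φ (x + t • h) := by
        refine lintegral_congr fun h => lintegral_lintegral_swap ?_
        exact ((hΦm.comp (by fun_prop :
          Measurable fun q : 𝔼 × ℝ => q.1 + q.2 • h)).const_mul c).aemeasurable
    _ = ∫⁻ h in D, ∫⁻ t in Ioc (0 : ℝ) 1, c * ∫⁻ x, Φ x := by
        refine lintegral_congr fun h => lintegral_congr fun t => ?_
        rw [lintegral_const_mul' _ _ ENNReal.ofReal_ne_top, lintegral_add_right_eq_self Φ]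
    _ = _ := by
        simp only [lintegral_const, Measure.restrict_apply_univ, Real.volume_Ioc]
        rw [hΦ, lintegral_indicator hBm]
        simp
        ring

/-- The `L^1` Poincaré inequality on a ball. -/
lemma HasWeakGradient.lintegral_lintegral_enorm_sub_le (hΩ : IsOpen Ω) {f : 𝔼 → ℝ} {G : 𝔼 → 𝔼}
    (h : HasWeakGradient Ω f G) (hf : ContinuousOn f Ω) {x₀ : 𝔼} {r : ℝ}
    (hr : Metric.closedBall x₀ r ⊆ Ω) :
    ∫⁻ x in Metric.ball x₀ r, ∫⁻ y in Metric.ball x₀ r, ‖f y - f x‖ₑ ≤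
      ENNReal.ofReal (2 * r) * volume (Metric.ball (0 : 𝔼) (2 * r)) *
        ∫⁻ x in Metric.closedBall x₀ r, ‖G x‖ₑ := by
  set B := Metric.ball x₀ r with hB
  set K := Metric.closedBall x₀ r with hK
  have hBK : B ⊆ K := Metric.ball_subset_closedBall
  have hBm : MeasurableSet B := Metric.isOpen_ball.measurableSet
  have hBt : volume B ≠ ⊤ := measure_ball_lt_top.ne
  set c := ENNReal.ofReal (2 * r) * volume (Metric.ball (0 : 𝔼) (2 * r)) with hc
  have hct : c ≠ ⊤ := ENNReal.mul_ne_top ENNReal.ofReal_ne_top measure_ball_lt_top.ne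
  obtain ⟨F, hF, hFu, hFg⟩ := h.exists_local_smooth_approx hΩ hf (isCompact_closedBall x₀ r) hr
  set I := ∫⁻ x in K, ‖G x‖ₑ with hI
  have key : ∀ ε : ℝ, 0 < ε → ∫⁻ x in B, ∫⁻ y in B, ‖f y - f x‖ₑ ≤
      c * (I + ENNReal.ofReal ε) + ENNReal.ofReal (2 * ε) * (volume B * volume B) := by
    intro ε hε
    have h1 := Metric.tendstoUniformlyOn_iff.1 hFu ε hε
    have h2 := (ENNReal.tendsto_nhds_zero.1 hFg) (ENNReal.ofReal ε) (by simpa using hε)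
    obtain ⟨n, hn1, hn2⟩ := (h1.and h2).exists
    rw [eLpNorm_one_eq_lintegral_enorm] at hn2
    have h3 : ∀ x ∈ B, ∀ y ∈ B, ‖f y - f x‖ₑ ≤ ‖F n y - F n x‖ₑ + ENNReal.ofReal (2 * ε) := by
      intro x hx y hy
      have hx' := hn1 x (hBK hx)
      have hy' := hn1 y (hBK hy)
      rw [Real.dist_eq] at hx' hy'
      rw [← ofReal_norm, ← ofReal_norm, ← ENNReal.ofReal_add (norm_nonneg _) (by positivity)]
      refine ENNReal.ofReal_le_ofReal ?_
      rw [Real.norm_eq_abs, Real.norm_eq_abs]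
      rw [abs_lt] at hx' hy'
      have := le_abs_self (F n y - F n x)
      have := neg_abs_le (F n y - F n x)
      rw [abs_le]
      constructor <;> linarith
    have hFc : Continuous (F n) := (hF n).continuous
    have h4 : ∫⁻ x in B, ‖gradient (F n) x‖ₑ ≤ I + ENNReal.ofReal ε := by
      have hGm : AEMeasurable (fun x => ‖G x‖ₑ) (volume.restrict K) :=
        ((h.2.1.integrableOn_compact_subset hr
          (isCompact_closedBall x₀ r)).aestronglyMeasurable).enorm
      calc ∫⁻ x in B, ‖gradient (F n) x‖ₑ ≤ ∫⁻ x in K, ‖gradient (F n) x‖ₑ :=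
            lintegral_mono_set hBK
        _ ≤ ∫⁻ x in K, (‖G x‖ₑ + ‖gradient (F n) x - G x‖ₑ) := by
            refine lintegral_mono fun x => ?_
            calc ‖gradient (F n) x‖ₑ = ‖G x + (gradient (F n) x - G x)‖ₑ := by
                  rw [add_sub_cancel]
              _ ≤ _ := enorm_add_le _ _
        _ = I + ∫⁻ x in K, ‖gradient (F n) x - G x‖ₑ := lintegral_add_left' hGm _
        _ ≤ _ := by gcongr
    calc ∫⁻ x in B, ∫⁻ y in B, ‖f y - f x‖ₑ
        ≤ ∫⁻ x in B, ∫⁻ y in B, (‖F n y - F n x‖ₑ + ENNReal.ofReal (2 * ε)) :=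
          setLIntegral_mono' hBm fun x hx => setLIntegral_mono' hBm fun y hy => h3 x hx y hy
      _ = (∫⁻ x in B, ∫⁻ y in B, ‖F n y - F n x‖ₑ) +
            ENNReal.ofReal (2 * ε) * (volume B * volume B) := by
          have h5 : ∀ x, ∫⁻ y in B, (‖F n y - F n x‖ₑ + ENNReal.ofReal (2 * ε)) =
              (∫⁻ y in B, ‖F n y - F n x‖ₑ) + ENNReal.ofReal (2 * ε) * volume B := fun x => by
            rw [lintegral_add_right _ measurable_const, setLIntegral_const]
          simp_rw [h5]
          rw [lintegral_add_right _ measurable_const, setLIntegral_const, mul_assoc]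
      _ ≤ _ := by
          gcongr
          exact (lintegral_lintegral_enorm_sub_le_of_contDiff (hF n) x₀ r).trans (by gcongr)
  have hlim : Tendsto (fun ε : ℝ => c * (I + ENNReal.ofReal ε) +
      ENNReal.ofReal (2 * ε) * (volume B * volume B)) (𝓝[>] 0) (𝓝 (c * I)) := by
    have hcont : Continuous fun ε : ℝ => c * (I + ENNReal.ofReal ε) +
        ENNReal.ofReal (2 * ε) * (volume B * volume B) :=
      ((ENNReal.continuous_const_mul hct).comp
        (continuous_const.add ENNReal.continuous_ofReal)).add
        ((ENNReal.continuous_mul_const (ENNReal.mul_ne_top hBt hBt)).comp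
          (ENNReal.continuous_ofReal.comp (continuous_const.mul continuous_id)))
    have := (hcont.tendsto 0).mono_left (nhdsWithin_le_nhds (s := Ioi 0))
    simpa using this
  exact ge_of_tendsto hlim (by filter_upwards [self_mem_nhdsWithin] with ε hε using key ε hε)

/-- If the gradients of a sequence tend to zero in `L^1_loc`, then convergence to `1` in mean
spreads from a subset of positive measure of a ball to the whole ball. -/
lemma tendsto_lintegral_ball_of_tendsto_lintegral_gradient (hΩ : IsOpen Ω) {θ : ℕ → 𝔼 → ℝ}
    {G : ℕ → 𝔼 → 𝔼} (hθ : ∀ n, HasWeakGradient Ω (θ n) (G n)) (hθc : ∀ n, ContinuousOn (θ n) Ω)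
    (hG : ∀ K, IsCompact K → K ⊆ Ω → Tendsto (fun n => ∫⁻ x in K, ‖G n x‖ₑ) atTop (𝓝 0))
    {x₀ : 𝔼} {r : ℝ} (hr : Metric.closedBall x₀ r ⊆ Ω) {S : Set 𝔼} (hS : MeasurableSet S)
    (hSB : S ⊆ Metric.ball x₀ r) (hS0 : volume S ≠ 0)
    (hlim : Tendsto (fun n => ∫⁻ x in S, ‖1 - θ n x‖ₑ) atTop (𝓝 0)) :
    Tendsto (fun n => ∫⁻ x in Metric.ball x₀ r, ‖1 - θ n x‖ₑ) atTop (𝓝 0) := by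
  set B := Metric.ball x₀ r with hB
  have hBm : MeasurableSet B := Metric.isOpen_ball.measurableSet
  have hBt : volume B ≠ ⊤ := measure_ball_lt_top.ne
  have hSt : volume S ≠ ⊤ := ne_top_of_le_ne_top hBt (measure_mono hSB)
  set c := ENNReal.ofReal (2 * r) * volume (Metric.ball (0 : 𝔼) (2 * r)) with hc
  have hct : c ≠ ⊤ := ENNReal.mul_ne_top ENNReal.ofReal_ne_top measure_ball_lt_top.ne
  have hBΩ : B ⊆ Ω := Metric.ball_subset_closedBall.trans hr
  have key : ∀ n, ∫⁻ x in B, ‖1 - θ n x‖ₑ ≤ (volume S)⁻¹ *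
      (volume B * (∫⁻ x in S, ‖1 - θ n x‖ₑ) +
        c * ∫⁻ x in Metric.closedBall x₀ r, ‖G n x‖ₑ) := by
    intro n
    rw [← ENNReal.mul_le_iff_le_inv hS0 hSt]
    have hm : AEMeasurable (fun x => ‖1 - θ n x‖ₑ) (volume.restrict S) := by
      have := ((hθc n).mono (hSB.trans hBΩ)).aemeasurable (μ := volume) hS
      exact (aemeasurable_const.sub this).enorm
    calc volume S * ∫⁻ x in B, ‖1 - θ n x‖ₑ
        = ∫⁻ y in S, ∫⁻ x in B, ‖1 - θ n x‖ₑ := by rw [setLIntegral_const, mul_comm]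
      _ ≤ ∫⁻ y in S, (volume B * ‖1 - θ n y‖ₑ + ∫⁻ x in B, ‖θ n x - θ n y‖ₑ) := by
          refine lintegral_mono fun y => ?_
          calc ∫⁻ x in B, ‖1 - θ n x‖ₑ
              ≤ ∫⁻ x in B, (‖1 - θ n y‖ₑ + ‖θ n x - θ n y‖ₑ) := by
                refine lintegral_mono fun x => ?_
                calc ‖1 - θ n x‖ₑ = ‖(1 - θ n y) - (θ n x - θ n y)‖ₑ := by
                      congr 1; ring
                  _ ≤ _ := enorm_sub_le
            _ = _ := by
                rw [lintegral_add_left measurable_const, setLIntegral_const, mul_comm]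
      _ = volume B * (∫⁻ x in S, ‖1 - θ n x‖ₑ) + ∫⁻ y in S, ∫⁻ x in B, ‖θ n x - θ n y‖ₑ := by
          rw [lintegral_add_left' (hm.const_mul _), lintegral_const_mul' _ _ hBt]
      _ ≤ volume B * (∫⁻ x in S, ‖1 - θ n x‖ₑ) + ∫⁻ y in B, ∫⁻ x in B, ‖θ n x - θ n y‖ₑ := by
          gcongr
      _ ≤ _ := by
          gcongr
          exact (hθ n).lintegral_lintegral_enorm_sub_le hΩ (hθc n) hr
  refine tendsto_of_tendsto_of_tendsto_of_le_of_le tendsto_const_nhds ?_ (fun n => bot_le) key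
  have h1 := ENNReal.Tendsto.const_mul (a := volume B) hlim (Or.inr hBt)
  have h2 := ENNReal.Tendsto.const_mul (a := c) (hG _ (isCompact_closedBall x₀ r) hr) (Or.inr hct)
  have h3 := ENNReal.Tendsto.const_mul (a := (volume S)⁻¹) (h1.add h2)
    (Or.inr (ENNReal.inv_ne_top.2 hS0))
  simpa using h3

/-- If the gradients of a sequence tend to zero in `L^1_loc` of a connected open set, and the
sequence equals `1` on a set of positive measure, then it tends to `1` in mean near each point. -/
lemma exists_ball_tendsto_lintegral (hΩ : IsOpen Ω) (hΩc : IsPreconnected Ω) {θ : ℕ → 𝔼 → ℝ}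
    {G : ℕ → 𝔼 → 𝔼} (hθ : ∀ n, HasWeakGradient Ω (θ n) (G n)) (hθc : ∀ n, ContinuousOn (θ n) Ω)
    (hG : ∀ K, IsCompact K → K ⊆ Ω → Tendsto (fun n => ∫⁻ x in K, ‖G n x‖ₑ) atTop (𝓝 0))
    {S : Set 𝔼} (hS : MeasurableSet S) (hSΩ : S ⊆ Ω) (hS0 : volume S ≠ 0)
    (hθS : ∀ n, ∀ x ∈ S, θ n x = 1) {x : 𝔼} (hx : x ∈ Ω) :
    ∃ r > 0, Tendsto (fun n => ∫⁻ y in Metric.ball x r, ‖1 - θ n y‖ₑ) atTop (𝓝 0) := by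
  set U : Set 𝔼 := {x | ∃ r > 0,
    Tendsto (fun n => ∫⁻ y in Metric.ball x r, ‖1 - θ n y‖ₑ) atTop (𝓝 0)} with hU
  have hmono : ∀ {S T : Set 𝔼}, S ⊆ T →
      Tendsto (fun n => ∫⁻ y in T, ‖1 - θ n y‖ₑ) atTop (𝓝 0) →
      Tendsto (fun n => ∫⁻ y in S, ‖1 - θ n y‖ₑ) atTop (𝓝 0) := fun hST h =>
    tendsto_of_tendsto_of_tendsto_of_le_of_le tendsto_const_nhds h (fun n => bot_le)
      fun n => lintegral_mono_set hST
  have hball : ∀ z ∈ Ω, ∃ r > 0, Metric.closedBall z r ⊆ Ω := fun z hz =>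
    Metric.nhds_basis_closedBall.mem_iff.1 (hΩ.mem_nhds hz)
  refine hΩc.subset_of_closure_inter_subset (u := U) ?_ ?_ ?_ hx
  · rw [Metric.isOpen_iff]
    rintro y ⟨r, hr, h⟩
    refine ⟨r / 2, by positivity, fun z hz => ⟨r / 2, by positivity, hmono ?_ h⟩⟩
    refine Metric.ball_subset_ball' ?_
    rw [Metric.mem_ball] at hz
    linarith
  · obtain ⟨y, hyS, hy⟩ := exists_mem_forall_mem_nhdsWithin_pos_measure hS0
    obtain ⟨r, hr, hrΩ⟩ := hball y (hSΩ hyS)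
    refine ⟨y, hSΩ hyS, r, hr, ?_⟩
    refine tendsto_lintegral_ball_of_tendsto_lintegral_gradient hΩ hθ hθc hG hrΩ
      (hS.inter Metric.isOpen_ball.measurableSet) inter_subset_right
      (hy _ (inter_mem_nhdsWithin S (Metric.ball_mem_nhds y hr))).ne' ?_
    have : ∀ n, ∫⁻ x in S ∩ Metric.ball y r, ‖1 - θ n x‖ₑ = 0 := fun n => by
      rw [setLIntegral_congr_fun (hS.inter Metric.isOpen_ball.measurableSet)
        (g := fun _ => (0 : ℝ≥0∞)) fun x hx => by simp [hθS n x hx.1]]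
      simp
    simp [this]
  · rintro y ⟨hyU, hyΩ⟩
    obtain ⟨r, hr, hrΩ⟩ := hball y hyΩ
    obtain ⟨z, ⟨s, hs, hz⟩, hzy⟩ := Metric.mem_closure_iff.1 hyU r hr
    refine ⟨r, hr, ?_⟩
    have hzB : z ∈ Metric.ball y r := by rwa [Metric.mem_ball, dist_comm]
    refine tendsto_lintegral_ball_of_tendsto_lintegral_gradient hΩ hθ hθc hG hrΩ
      (S := Metric.ball y r ∩ Metric.ball z s)
      (Metric.isOpen_ball.inter Metric.isOpen_ball).measurableSet inter_subset_left ?_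
      (hmono inter_subset_right hz)
    exact ((Metric.isOpen_ball.inter Metric.isOpen_ball).measure_pos volume
      ⟨z, hzB, Metric.mem_ball_self hs⟩).ne'

end Poincare

/-! ### Sets of zero capacity -/

section ZeroCapacity

open scoped Topology
open Filter

variable {N : ℕ} {Ω : Set (EuclideanSpace ℝ (Fin N))} {p : ℝ}
  {A : EuclideanSpace ℝ (Fin N) → Matrix (Fin N) (Fin N) ℝ} {V : EuclideanSpace ℝ (Fin N) → ℝ}
  {u : EuclideanSpace ℝ (Fin N) → ℝ}

local notation "𝔼" => EuclideanSpace ℝ (Fin N)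

lemma IsPositiveSolution.hasWeakGradient_div (hΩ : IsOpen Ω) (hu : IsPositiveSolution p Ω A V u)
    {w : 𝔼 → ℝ} (hw : w ∈ testSpace p Ω) :
    HasWeakGradient Ω (fun x => w x / u x)
      (fun x => (u x)⁻¹ • (weakGradient Ω w x - (w x / u x) • weakGradient Ω u x)) := by
  have h := (hasWeakGradient_of_mem_testSpace hw).comp₂ hΩ hu.hasWeakGradient
    hw.2.1.continuousOn hu.continuousOn hu.pos (F := fun z => z.1 / z.2) (F₁ := fun z => z.2⁻¹)
    (F₂ := fun z => -(z.2⁻¹ * (z.1 / z.2))) ?_ ?_ ?_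
  · convert h using 2 with x
    module
  · intro z hz
    have h2 := (hasDerivAt_inv hz.ne').comp_hasFDerivAt z
      (ContinuousLinearMap.snd ℝ ℝ ℝ).hasFDerivAt
    have h3 := (ContinuousLinearMap.fst ℝ ℝ ℝ).hasFDerivAt (x := z) |>.mul h2
    have hz' := hz.ne'
    simp only [div_eq_mul_inv]
    refine h3.congr_fderiv ?_
    ext
    · simp
    · simp; field_simp
  · exact continuousOn_snd.inv₀ fun z hz => ne_of_gt hz
  · exact ((continuousOn_snd.inv₀ fun z hz => ne_of_gt hz).mul
      (continuousOn_fst.div continuousOn_snd fun z hz => ne_of_gt hz)).neg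

lemma le_add_rpow_mul_rpow {p δ t : ℝ} (hp : 1 < p) (hδ : 0 < δ) (ht : 0 ≤ t) :
    t ≤ δ + δ ^ (1 - p) * t ^ p := by
  rcases le_or_gt t δ with h | h
  · have : 0 ≤ δ ^ (1 - p) * t ^ p := by positivity
    linarith
  · have ht0 : 0 < t := hδ.trans h
    have h1 : t ^ (1 - p) ≤ δ ^ (1 - p) :=
      Real.rpow_le_rpow_of_nonpos hδ h.le (by linarith)
    calc t = t ^ (1 - p) * t ^ p := by
          rw [← Real.rpow_add ht0]; simp
      _ ≤ δ ^ (1 - p) * t ^ p := by gcongr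
      _ ≤ _ := by linarith

/-- Functions between `0` and the solution whose energy is small have quotients by the solution
whose gradients are small in `L^1_loc`. -/
lemma IsPositiveSolution.exists_lintegral_gradient_div_le (hΩ : IsOpen Ω) (hp : 1 < p)
    (hA : IsEllipticMatrix Ω A) (hV : LocallyIntegrableOn V Ω)
    (hu : IsPositiveSolution p Ω A V u) {K : Set 𝔼} (hK : IsCompact K) (hKΩ : K ⊆ Ω)
    {ε : ℝ} (hε : 0 < ε) :
    ∃ κ > 0, ∀ w ∈ testSpace p Ω, (∀ x ∈ Ω, |w x / u x| ≤ 1) → energy p Ω A V w ≤ κ →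
      ∫⁻ x in K, ‖(u x)⁻¹ • (weakGradient Ω w x - (w x / u x) • weakGradient Ω u x)‖ₑ ≤
        ENNReal.ofReal ε := by
  obtain ⟨m, hm, hmu⟩ : ∃ m > 0, ∀ x ∈ K, m ≤ u x := by
    rcases K.eq_empty_or_nonempty with h | h
    · exact ⟨1, one_pos, by simp [h]⟩
    · obtain ⟨x₀, hx₀, hmin⟩ := hK.exists_isMinOn h (hu.continuousOn.mono hKΩ)
      exact ⟨u x₀, hu.pos x₀ (hKΩ hx₀), fun x hx => hmin hx⟩
  obtain ⟨C₁, hC₁, hAK⟩ := hA.exists_norm_le hK hKΩ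
  set D := (C₁ + 1) / m with hD
  have hD0 : 0 < D := by positivity
  have hI := hu.integrableOn_matNorm_rpow hΩ hp hA hK hKΩ
  set I := ∫ x in K, matNorm (A x) (weakGradient Ω u x) ^ p with hIdef
  have hI0 : 0 ≤ I := integral_nonneg fun x => Real.rpow_nonneg (matNorm_nonneg _ _) _
  set vol := volume.real K with hvol
  have hvol0 : 0 ≤ vol := measureReal_nonneg
  -- the parameters make each of the three terms of the final estimate at most `ε / 3`
  set δ := ε / (3 * D * (vol + 1)) with hδ
  have hδ0 : 0 < δ := by positivity
  set s := δ ^ (1 - p) with hs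
  have hs0 : 0 < s := by positivity
  set η := ε / (3 * D * s * (I + 1)) with hη
  have hη0 : 0 < η := by positivity
  clear_value D δ s η
  obtain ⟨Cη, hCη, H⟩ := exists_matNorm_rpow_le_bregman hp hη0
  refine ⟨ε / (3 * D * s * Cη), by positivity, fun w hw hwu hwE => ?_⟩
  obtain ⟨hi, he⟩ := hu.energy_eq_integral_bregman hΩ hp hA hV hw
  set b := fun x => bregman p (A x) (weakGradient Ω w x) ((w x / u x) • weakGradient Ω u x) with hb
  have hae := hA.ae_symm_nonneg hΩ
  have hb0 : 0 ≤ᵐ[volume.restrict Ω] b := by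
    filter_upwards [hae] with x hx using bregman_nonneg hp hx.1 hx.2 _ _
  have hbK : ∫ x in K, b x ≤ ε / (3 * D * s * Cη) :=
    (setIntegral_mono_set hi hb0 hKΩ.eventuallyLE).trans (he.symm.trans_le hwE)
  have hiK : IntegrableOn b K := hi.mono_set hKΩ
  have hcK : IntegrableOn (fun _ : 𝔼 => D * δ) K :=
    integrableOn_const hK.measure_lt_top.ne
  set R := fun x => D * δ + ((D * s * Cη) * b x +
    (D * s * η) * matNorm (A x) (weakGradient Ω u x) ^ p) with hR
  have hRi : IntegrableOn R K := hcK.add ((hiK.const_mul _).add (hI.const_mul _))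
  have hpt : ∀ᵐ x ∂volume.restrict K,
      ‖(u x)⁻¹ • (weakGradient Ω w x - (w x / u x) • weakGradient Ω u x)‖ ≤ R x := by
    filter_upwards [hAK, ae_restrict_of_ae_restrict_of_subset hKΩ hae,
      ae_restrict_mem hK.measurableSet] with x hx hAx hxK
    have hux := hu.pos x (hKΩ hxK)
    obtain ⟨a, ha⟩ : ∃ a, a = (w x / u x) • weakGradient Ω u x := ⟨_, rfl⟩
    obtain ⟨d, hd⟩ : ∃ d, d = weakGradient Ω w x - a := ⟨_, rfl⟩
    have hbx : b x = bregman p (A x) (a + d) a := by rw [hd, add_sub_cancel, ha]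
    have h1 := H (A x) hAx.1 hAx.2 a d
    rw [← hbx] at h1
    have h2 : matNorm (A x) a ^ p ≤ matNorm (A x) (weakGradient Ω u x) ^ p := by
      refine Real.rpow_le_rpow (matNorm_nonneg _ _) ?_ (by linarith)
      rw [ha, matNorm_smul]
      exact mul_le_of_le_one_left (matNorm_nonneg _ _) (hwu x (hKΩ hxK))
    have h3 := le_add_rpow_mul_rpow hp hδ0 (matNorm_nonneg (A x) d)
    rw [← ha, ← hd, norm_smul, norm_inv, Real.norm_of_nonneg hux.le]
    have h5 : ‖d‖ ≤ (C₁ + 1) * matNorm (A x) d := by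
      linarith [hx d, matNorm_nonneg (A x) d]
    have h4 : (u x)⁻¹ * ‖d‖ ≤ D * matNorm (A x) d := by
      rw [hD, div_eq_inv_mul, mul_assoc]
      exact mul_le_mul (inv_anti₀ hm (hmu x hxK)) h5 (norm_nonneg _) (by positivity)
    have h7 := h1.trans (add_le_add_right (mul_le_mul_of_nonneg_left h2 hη0.le) _)
    have h8 := mul_le_mul_of_nonneg_left h7 hs0.le
    rw [← hs] at h3
    have h9 := mul_le_mul_of_nonneg_left (h3.trans (add_le_add_right h8 δ)) hD0.le
    refine (h4.trans h9).trans (le_of_eq ?_)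
    simp only [hR]
    ring
  have hR0 : 0 ≤ᵐ[volume.restrict K] R := by
    filter_upwards [hpt] with x hx using (norm_nonneg _).trans hx
  calc ∫⁻ x in K, ‖(u x)⁻¹ • (weakGradient Ω w x - (w x / u x) • weakGradient Ω u x)‖ₑ
      ≤ ∫⁻ x in K, ENNReal.ofReal (R x) := by
        refine lintegral_mono_ae ?_
        filter_upwards [hpt] with x hx
        rw [← ofReal_norm]
        exact ENNReal.ofReal_le_ofReal hx
    _ = ENNReal.ofReal (∫ x in K, R x) := (ofReal_integral_eq_lintegral_ofReal hRi hR0).symm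
    _ ≤ ENNReal.ofReal ε := by
        refine ENNReal.ofReal_le_ofReal ?_
        have e1 : ∫ x in K, R x = D * δ * vol + ((D * s * Cη) * (∫ x in K, b x) +
            (D * s * η) * I) := by
          have i1 : IntegrableOn (fun x => D * s * Cη * b x) K := hiK.const_mul _
          have i2 : IntegrableOn (fun x => D * s * η * matNorm (A x) (weakGradient Ω u x) ^ p) K :=
            hI.const_mul _
          have i3 : IntegrableOn (fun x => D * s * Cη * b x +
            D * s * η * matNorm (A x) (weakGradient Ω u x) ^ p) K := i1.add i2
          simp only [hR]
          rw [integral_add hcK i3, integral_add i1 i2, setIntegral_const, smul_eq_mul,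
            integral_const_mul (D * s * Cη), integral_const_mul (D * s * η), mul_comm, hIdef]
        have e2 : D * δ * vol ≤ ε / 3 := by
          rw [hδ]
          have : D * (ε / (3 * D * (vol + 1))) * vol = ε / 3 * (vol / (vol + 1)) := by
            field_simp
          rw [this]
          exact mul_le_of_le_one_right (by positivity) (by rw [div_le_one (by positivity)]; linarith)
        have e3 : (D * s * Cη) * (∫ x in K, b x) ≤ ε / 3 := by
          calc _ ≤ (D * s * Cη) * (ε / (3 * D * s * Cη)) := by gcongr
            _ = ε / 3 := by field_simp
        have e4 : (D * s * η) * I ≤ ε / 3 := by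
          rw [hη]
          have : D * s * (ε / (3 * D * s * (I + 1))) * I = ε / 3 * (I / (I + 1)) := by
            field_simp
          rw [this]
          exact mul_le_of_le_one_right (by positivity) (by rw [div_le_one (by positivity)]; linarith)
        rw [e1]
        linarith

lemma truncWeight_le_one {p : ℝ} (hp : 0 ≤ p) (t : ℝ) : truncWeight p t ≤ 1 := by
  unfold truncWeight
  split_ifs with h
  · exact Real.rpow_le_one (abs_nonneg _) h.le hp
  · exact zero_le_one

/-- For a set of zero capacity, there is a sequence of test functions with energies tending to zero
whose quotients by the solution lie in `[0, 1]` and equal `1` on the set. -/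
lemma IsPositiveSolution.exists_seq_of_capacity_eq_zero (hΩ : IsOpen Ω) (hp : 1 < p)
    (hA : IsEllipticMatrix Ω A) (hV : LocallyIntegrableOn V Ω)
    (hQ : ∀ φ ∈ testSpace p Ω, 0 ≤ energy p Ω A V φ) (hu : IsPositiveSolution p Ω A V u)
    {F : Set 𝔼} (hF : IsCompact F) (hFΩ : F ⊆ Ω) (hcap : capacity p Ω A V u F = 0) :
    ∃ w : ℕ → 𝔼 → ℝ, (∀ n, w n ∈ testSpace p Ω) ∧
      (∀ n, ∀ x ∈ Ω, 0 ≤ w n x / u x ∧ w n x / u x ≤ 1) ∧ (∀ n, ∀ x ∈ F, w n x / u x = 1) ∧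
      Tendsto (fun n => energy p Ω A V (w n)) atTop (𝓝 0) := by
  obtain ⟨C, hC, H⟩ := hu.exists_energy_truncation_le hΩ hp hA hV
  have hex : ∀ n : ℕ, ∃ φ ∈ testSpace p Ω, (∀ x ∈ F, u x ≤ φ x) ∧
      energy p Ω A V φ < 1 / ((n : ℝ) + 1) := fun n => by
    obtain ⟨φ₀, hφ₀, hF₀⟩ := exists_testSpace_ge (p := p) hΩ hu.continuousOn hF hFΩ
    have h1 : sInf (energy p Ω A V '' {φ | φ ∈ testSpace p Ω ∧ ∀ x ∈ F, u x ≤ φ x}) <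
        1 / ((n : ℝ) + 1) := by
      change capacity p Ω A V u F < _
      rw [hcap]; positivity
    have hne : (energy p Ω A V '' {φ | φ ∈ testSpace p Ω ∧ ∀ x ∈ F, u x ≤ φ x}).Nonempty :=
      ⟨_, φ₀, ⟨hφ₀, hF₀⟩, rfl⟩
    obtain ⟨_, ⟨φ, hφ, rfl⟩, hlt⟩ := exists_lt_of_csInf_lt hne h1
    exact ⟨φ, hφ.1, hφ.2, hlt⟩
  choose φ hφ hφF hφE using hex
  have hmem : ∀ n, truncation u 1 (φ n) ∈ testSpace p Ω := fun n =>
    (hu.truncation_mem_testSpace hΩ (hφ n) 1).1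
  have hquot : ∀ n, ∀ x ∈ Ω, truncation u 1 (φ n) x / u x = truncProfile (1 * φ n x / u x) :=
    fun n x hx => by rw [truncation, mul_div_cancel_left₀ _ (hu.pos x hx).ne']
  refine ⟨fun n => truncation u 1 (φ n), hmem, fun n x hx => ?_, fun n x hx => ?_, ?_⟩
  · rw [hquot n x hx]
    exact ⟨truncProfile_nonneg _, truncProfile_le_one _⟩
  · rw [hquot n x (hFΩ hx)]
    have hux := hu.pos x (hFΩ hx)
    refine truncProfile_of_one_le ?_
    rw [one_mul, abs_div, abs_of_pos hux, one_le_div hux]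
    exact (hφF n x hx).trans (le_abs_self _)
  · have hle : ∀ n, energy p Ω A V (truncation u 1 (φ n)) ≤ C * (1 / ((n : ℝ) + 1)) := fun n => by
      obtain ⟨hi, he⟩ := hu.energy_eq_integral_bregman hΩ hp hA hV (hφ n)
      have h1 : ENNReal.ofReal (energy p Ω A V (truncation u 1 (φ n))) ≤
          ENNReal.ofReal (C * energy p Ω A V (φ n)) := by
        refine ((H (φ n) (hφ n) 1 one_pos).2).trans ?_
        rw [Real.one_rpow, mul_one, ENNReal.ofReal_mul hC.le, he,
          ofReal_integral_eq_lintegral_ofReal hi (by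
            filter_upwards [hA.ae_symm_nonneg hΩ] with x hx using
              bregman_nonneg hp hx.1 hx.2 _ _)]
        gcongr
        refine mul_le_of_le_one_left bot_le ?_
        rw [← ENNReal.ofReal_one]
        exact ENNReal.ofReal_le_ofReal (truncWeight_le_one (by linarith) _)
      rw [ENNReal.ofReal_le_ofReal_iff (mul_nonneg hC.le (hQ _ (hφ n)))] at h1
      exact h1.trans (by gcongr; exact (hφE n).le)
    refine squeeze_zero (fun n => hQ _ (hmem n)) hle ?_
    simpa using tendsto_one_div_add_atTop_nhds_zero_nat.const_mul C

/-- If some compact set of positive measure has zero capacity, every Hardy weight vanishes. -/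
lemma IsPositiveSolution.ae_eq_zero_of_capacity_eq_zero (hΩ : IsOpen Ω) (hΩc : IsPreconnected Ω)
    (hp : 1 < p) (hA : IsEllipticMatrix Ω A) (hV : LocallyIntegrableOn V Ω)
    (hQ : ∀ φ ∈ testSpace p Ω, 0 ≤ energy p Ω A V φ) (hu : IsPositiveSolution p Ω A V u)
    {F : Set 𝔼} (hF : IsCompact F) (hFΩ : F ⊆ Ω) (hcap : capacity p Ω A V u F = 0)
    (hvol : volume F ≠ 0) {g : 𝔼 → ℝ} (hg : g ∈ hardySpace p Ω A V) :
    g =ᵐ[volume.restrict Ω] 0 := by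
  have hp0 : 0 < p := by linarith
  obtain ⟨hgl, C, hC, hgC⟩ := hg
  obtain ⟨w, hw, hw01, hwF, hwE⟩ :=
    hu.exists_seq_of_capacity_eq_zero hΩ hp hA hV hQ hF hFΩ hcap
  have hθc : ∀ n, ContinuousOn (fun x => w n x / u x) Ω := fun n =>
    (hw n).2.1.continuousOn.div hu.continuousOn fun x hx => (hu.pos x hx).ne'
  have hgrad : ∀ K, IsCompact K → K ⊆ Ω → Tendsto (fun n => ∫⁻ x in K,
      ‖(u x)⁻¹ • (weakGradient Ω (w n) x - (w n x / u x) • weakGradient Ω u x)‖ₑ) atTop (𝓝 0) := by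
    intro K hK hKΩ
    refine ENNReal.tendsto_nhds_zero.2 fun ε hε => ?_
    rcases eq_or_ne ε ⊤ with rfl | hεt
    · exact Eventually.of_forall fun n => le_top
    obtain ⟨κ, hκ, H⟩ := hu.exists_lintegral_gradient_div_le hΩ hp hA hV hK hKΩ
      (ENNReal.toReal_pos hε.ne' hεt)
    filter_upwards [hwE.eventually (ge_mem_nhds hκ)] with n hn
    rw [← ENNReal.ofReal_toReal hεt]
    refine H (w n) (hw n) (fun x hx => ?_) hn
    rw [abs_of_nonneg (hw01 n x hx).1]
    exact (hw01 n x hx).2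
  have hgw : Tendsto (fun n => ENNReal.ofReal (∫ x in Ω, |g x| * |w n x| ^ p)) atTop (𝓝 0) := by
    have h1 : Tendsto (fun n => ∫ x in Ω, |g x| * |w n x| ^ p) atTop (𝓝 0) := by
      refine squeeze_zero (fun n => integral_nonneg fun x => by positivity)
        (fun n => hgC (w n) (hw n)) ?_
      simpa using hwE.const_mul C
    simpa using ENNReal.tendsto_ofReal h1
  have hloc : ∀ x ∈ Ω, ∃ r > 0, ∀ᵐ y ∂volume.restrict (Metric.ball x r), g y = 0 := by
    intro x hx
    obtain ⟨r₁, hr₁, h₁⟩ := exists_ball_tendsto_lintegral hΩ hΩc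
      (fun n => hu.hasWeakGradient_div hΩ (hw n)) hθc hgrad hF.measurableSet hFΩ hvol hwF hx
    obtain ⟨r₂, hr₂, h₂⟩ := Metric.isOpen_iff.1 hΩ x hx
    refine ⟨min r₁ r₂, lt_min hr₁ hr₂, ?_⟩
    set B := Metric.ball x (min r₁ r₂) with hB
    have hBm : MeasurableSet B := Metric.isOpen_ball.measurableSet
    have hBΩ : B ⊆ Ω := (Metric.ball_subset_ball (min_le_right _ _)).trans h₂
    have hgu : AEMeasurable (fun x => ENNReal.ofReal (|g x| * |u x| ^ p)) (volume.restrict B) := by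
      have h1 : AEMeasurable g (volume.restrict B) :=
        (hgl.mono_set hBΩ).aestronglyMeasurable.aemeasurable
      have h2 : AEMeasurable u (volume.restrict B) :=
        (hu.continuousOn.mono hBΩ).aemeasurable hBm
      exact ((measurable_norm.comp_aemeasurable h1).mul
        ((measurable_norm.comp_aemeasurable h2).pow_const p)).ennreal_ofReal
    have key : ∀ n, ∫⁻ y in B, min (ENNReal.ofReal (|g y| * |u y| ^ p)) 1 ≤
        ENNReal.ofReal (2 ^ p) * ENNReal.ofReal (∫ x in Ω, |g x| * |w n x| ^ p) +
          2 * ∫⁻ y in Metric.ball x r₁, ‖1 - w n y / u y‖ₑ := by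
      intro n
      have hwi := integrableOn_abs_mul_rpow_testSpace hp0 hgl (hw n)
      have hpt : ∀ y ∈ B, min (ENNReal.ofReal (|g y| * |u y| ^ p)) 1 ≤
          ENNReal.ofReal (2 ^ p) * ENNReal.ofReal (|g y| * |w n y| ^ p) +
            2 * ‖1 - w n y / u y‖ₑ := by
        intro y hy
        have huy := hu.pos y (hBΩ hy)
        -- the first term dominates where the quotient is at least `1 / 2`, the second elsewhere
        rcases le_or_gt (1 / 2) (w n y / u y) with h | h
        · refine (min_le_left _ _).trans (le_trans ?_ le_self_add)
          rw [← ENNReal.ofReal_mul (by positivity)]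
          refine ENNReal.ofReal_le_ofReal ?_
          have h3 : |u y| ≤ 2 * |w n y| := by
            rw [le_div_iff₀ huy] at h
            rw [abs_of_pos huy]
            linarith [le_abs_self (w n y)]
          calc |g y| * |u y| ^ p ≤ |g y| * (2 * |w n y|) ^ p := by gcongr
            _ = _ := by rw [Real.mul_rpow zero_le_two (abs_nonneg _)]; ring
        · refine (min_le_right _ _).trans (le_trans ?_ le_add_self)
          rw [← ofReal_norm, ← ENNReal.ofReal_ofNat 2, ← ENNReal.ofReal_mul zero_le_two,
            ← ENNReal.ofReal_one, Real.norm_eq_abs]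
          refine ENNReal.ofReal_le_ofReal ?_
          linarith [le_abs_self (1 - w n y / u y)]
      have hwm : AEMeasurable (fun y => ENNReal.ofReal (2 ^ p) *
          ENNReal.ofReal (|g y| * |w n y| ^ p)) (volume.restrict B) :=
        ((hwi.mono_set hBΩ).aestronglyMeasurable.aemeasurable.ennreal_ofReal).const_mul _
      calc ∫⁻ y in B, min (ENNReal.ofReal (|g y| * |u y| ^ p)) 1
          ≤ ∫⁻ y in B, (ENNReal.ofReal (2 ^ p) * ENNReal.ofReal (|g y| * |w n y| ^ p) +
            2 * ‖1 - w n y / u y‖ₑ) := setLIntegral_mono' hBm hpt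
        _ = ENNReal.ofReal (2 ^ p) * (∫⁻ y in B, ENNReal.ofReal (|g y| * |w n y| ^ p)) +
            2 * ∫⁻ y in B, ‖1 - w n y / u y‖ₑ := by
          rw [lintegral_add_left' hwm, lintegral_const_mul' _ _ ENNReal.ofReal_ne_top,
            lintegral_const_mul' _ _ (by simp)]
        _ ≤ _ := by
          rw [ofReal_integral_eq_lintegral_ofReal hwi (ae_of_all _ fun x => by positivity)]
          gcongr
          exact Metric.ball_subset_ball (min_le_left _ _)
    have hlim : Tendsto (fun n => ENNReal.ofReal (2 ^ p) *
        ENNReal.ofReal (∫ x in Ω, |g x| * |w n x| ^ p) +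
          2 * ∫⁻ y in Metric.ball x r₁, ‖1 - w n y / u y‖ₑ) atTop (𝓝 0) := by
      have h1 := ENNReal.Tendsto.const_mul (a := ENNReal.ofReal (2 ^ p)) hgw
        (Or.inr ENNReal.ofReal_ne_top)
      have h2 := ENNReal.Tendsto.const_mul (a := 2) h₁ (Or.inr (by simp))
      simpa using h1.add h2
    have hzero : ∫⁻ y in B, min (ENNReal.ofReal (|g y| * |u y| ^ p)) 1 = 0 :=
      nonpos_iff_eq_zero.1 (ge_of_tendsto' hlim key)
    rw [lintegral_eq_zero_iff' (hgu.min aemeasurable_const)] at hzero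
    filter_upwards [hzero, ae_restrict_mem hBm] with y hy hyB
    have h1 : ENNReal.ofReal (|g y| * |u y| ^ p) = 0 := by
      rcases min_choice (ENNReal.ofReal (|g y| * |u y| ^ p)) 1 with h | h
      · rw [← h]; exact hy
      · exact absurd (h.symm.trans hy) one_ne_zero
    have h3 : 0 < |u y| ^ p := Real.rpow_pos_of_pos (abs_pos.2 (hu.pos y (hBΩ hyB)).ne') _
    by_contra hgy
    exact absurd (ENNReal.ofReal_eq_zero.1 h1) (not_le.2 (mul_pos (abs_pos.2 hgy) h3))
  rw [Filter.EventuallyEq, ae_restrict_iff' hΩ.measurableSet, ae_iff]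
  refine measure_null_of_locally_null _ fun x hx => ?_
  have hxΩ : x ∈ Ω := by
    by_contra hx'
    exact hx fun h => absurd h hx'
  obtain ⟨r, hr, h⟩ := hloc x hxΩ
  rw [ae_restrict_iff' Metric.isOpen_ball.measurableSet, ae_iff] at h
  refine ⟨_, inter_mem_nhdsWithin _ (Metric.ball_mem_nhds x hr), measure_mono_null ?_ h⟩
  rintro y ⟨hy, hyB⟩ hy'
  exact hy fun _ => hy' hyB

/-- In the subcritical case sets of zero capacity are null sets, and their quotients are `0 / 0 = 0`. -/
lemma IsPositiveSolution.hardyNorm_eq_hardyNormPosCap (hΩ : IsOpen Ω) (hΩc : IsPreconnected Ω)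
    (hp : 1 < p) (hA : IsEllipticMatrix Ω A) (hV : LocallyIntegrableOn V Ω)
    (hQ : ∀ φ ∈ testSpace p Ω, 0 ≤ energy p Ω A V φ) (hu : IsPositiveSolution p Ω A V u)
    (hsub : IsSubcritical p Ω A V) (g : 𝔼 → ℝ) :
    hardyNorm p Ω A V u g = hardyNormPosCap p Ω A V u g := by
  obtain ⟨g₀, hg₀, hne⟩ := hsub
  refine le_antisymm (iSup₂_le fun F hF => ?_)
    (iSup₂_le fun F hF => le_iSup₂ (f := fun F (_ : IsCompact F ∧ F ⊆ Ω) =>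
      capacityQuotient p Ω A V u g F) F ⟨hF.1, hF.2.1⟩)
  by_cases hcap : capacity p Ω A V u F = 0
  · have hvol : volume F = 0 := by
      by_contra hvol
      exact hne (hu.ae_eq_zero_of_capacity_eq_zero hΩ hΩc hp hA hV hQ hF.1 hF.2 hcap hvol hg₀)
    rw [capacityQuotient, Measure.restrict_eq_zero.2 hvol]
    simp
  · exact le_iSup₂ (f := fun F (_ : IsCompact F ∧ F ⊆ Ω ∧ capacity p Ω A V u F ≠ 0) =>
      capacityQuotient p Ω A V u g F) F ⟨hF.1, hF.2, hcap⟩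

end ZeroCapacity

/-! ### Equivalence of the norms -/

section Equivalence

variable {N : ℕ} {S : Set (EuclideanSpace ℝ (Fin N) → ℝ)}
  {ν₁ ν₂ ν₃ : (EuclideanSpace ℝ (Fin N) → ℝ) → ℝ≥0∞}

lemma EquivalentOn.symm (h : EquivalentOn S ν₁ ν₂) : EquivalentOn S ν₂ ν₁ := by
  obtain ⟨c, C, hc, hC, H⟩ := h
  have key : ∀ {a : ℝ} (t : ℝ≥0∞), 0 < a → ENNReal.ofReal a⁻¹ * (ENNReal.ofReal a * t) = t :=
    fun t ha => by
      rw [← mul_assoc, ← ENNReal.ofReal_mul (inv_nonneg.2 ha.le), inv_mul_cancel₀ ha.ne']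
      simp
  refine ⟨C⁻¹, c⁻¹, inv_pos.2 hC, inv_pos.2 hc, fun g hg => ⟨?_, ?_⟩⟩
  · exact (mul_le_mul_right (H g hg).2 _).trans_eq (key _ hC)
  · exact (key _ hc).symm.trans_le (mul_le_mul_right (H g hg).1 _)

lemma EquivalentOn.trans (h : EquivalentOn S ν₁ ν₂) (h' : EquivalentOn S ν₂ ν₃) :
    EquivalentOn S ν₁ ν₃ := by
  obtain ⟨c, C, hc, hC, H⟩ := h
  obtain ⟨d, D, hd, hD, H'⟩ := h'
  refine ⟨d * c, D * C, by positivity, by positivity, fun g hg => ⟨?_, ?_⟩⟩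
  · rw [ENNReal.ofReal_mul hd.le, mul_assoc]
    exact (mul_le_mul_right (H g hg).1 _).trans (H' g hg).1
  · rw [ENNReal.ofReal_mul hD.le, mul_assoc]
    exact (H' g hg).2.trans (mul_le_mul_right (H g hg).2 _)

end Equivalence

end HardyWeights

theorem theorem1p1 {N : ℕ} (hN : 1 ≤ N) (p : ℝ) (hp : 1 < p)
    (Ω : Set (EuclideanSpace ℝ (Fin N))) (hΩ : IsOpen Ω) (hΩc : IsConnected Ω)
    (A : EuclideanSpace ℝ (Fin N) → Matrix (Fin N) (Fin N) ℝ) (hA : IsEllipticMatrix Ω A)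
    (V : EuclideanSpace ℝ (Fin N) → ℝ) (hV : MemMorreyLoc p Ω V)
    (hQ : ∀ φ ∈ testSpace p Ω, 0 ≤ energy p Ω A V φ)
    (u : EuclideanSpace ℝ (Fin N) → ℝ) (hu : IsPositiveSolution p Ω A V u) :
    -- characterization of the Hardy weights
    (∀ g, LocallyIntegrableOn g Ω →
      (hardyNorm p Ω A V u g < ∞ ↔ ∃ C : ℝ, 0 < C ∧ HardyInequality p Ω A V g C)) ∧
    -- two-sided estimate of the best constant
    (∃ C_H : ℝ, 0 < C_H ∧ ∀ g, LocallyIntegrableOn g Ω →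
      hardyNorm p Ω A V u g ≤ bestConstant p Ω A V g ∧
      bestConstant p Ω A V g ≤ ENNReal.ofReal C_H * hardyNorm p Ω A V u g) ∧
    -- both quantities are norms on the space of Hardy weights, and they are equivalent
    IsNormOn Ω (hardySpace p Ω A V) (hardyNorm p Ω A V u) ∧
    IsNormOn Ω (hardySpace p Ω A V) (bestConstant p Ω A V) ∧
    EquivalentOn (hardySpace p Ω A V) (hardyNorm p Ω A V u) (bestConstant p Ω A V) ∧
    -- independence of the positive solution
    (∀ v, IsPositiveSolution p Ω A V v →
      EquivalentOn (hardySpace p Ω A V) (hardyNorm p Ω A V u) (hardyNorm p Ω A V v)) ∧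
    -- in the subcritical case only sets of nonzero capacity matter in the norm
    (IsSubcritical p Ω A V → ∀ g, LocallyIntegrableOn g Ω →
      hardyNorm p Ω A V u g = hardyNormPosCap p Ω A V u g) := by
  have hp0 : 0 < p := by linarith
  have hlow : ∀ v, IsPositiveSolution p Ω A V v → ∀ g, LocallyIntegrableOn g Ω →
      hardyNorm p Ω A V v g ≤ bestConstant p Ω A V g := fun v hv g hg =>
    hardyNorm_le_bestConstant hΩ hp0 hv.continuousOn hv.pos hg
  have hequiv : ∀ v, IsPositiveSolution p Ω A V v →
      EquivalentOn (hardySpace p Ω A V) (hardyNorm p Ω A V v) (bestConstant p Ω A V) := by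
    intro v hv
    obtain ⟨C, hC, H⟩ := hv.exists_bestConstant_le hΩ hp hA hV.1 hQ
    exact ⟨1, C, one_pos, hC, fun g hg => ⟨by simpa using hlow v hv g hg.1, (H g hg.1).2⟩⟩
  obtain ⟨C, hC, H⟩ := hu.exists_bestConstant_le hΩ hp hA hV.1 hQ
  refine ⟨fun g hg => ⟨fun h => (H g hg).1 h.ne, ?_⟩, ⟨C, hC, fun g hg =>
    ⟨hlow u hu g hg, (H g hg).2⟩⟩, ?_, ?_, hequiv u hu, fun v hv =>
    (hequiv u hu).trans (hequiv v hv).symm, fun hsub g _ =>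
    hu.hardyNorm_eq_hardyNormPosCap hΩ hΩc.isPreconnected hp hA hV.1 hQ hsub g⟩
  · rintro ⟨D, hD⟩
    exact (hD.2.hardyNorm_le hΩ hp0 hu.continuousOn hu.pos hg hD.1).trans_lt ENNReal.ofReal_lt_top
  · exact isNormOn_hardySpace hΩ hp0 hu.continuousOn hu.pos hQ (fun _ _ => le_rfl)
      (fun g hg => hlow u hu g hg.1) (fun _ _ => hardyNorm_congr) (fun c g _ => hardyNorm_smul c g)
      fun g hg h hh => hardyNorm_add_le hp0 hu.continuousOn hg.1 hh.1
  · exact isNormOn_hardySpace hΩ hp0 hu.continuousOn hu.pos hQ (fun g hg => hlow u hu g hg.1)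
      (fun _ _ => le_rfl) (fun _ _ => bestConstant_congr) (fun c g hg => bestConstant_smul hQ hg c)
      fun g hg h hh => bestConstant_add_le hp0 hQ hg hh
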